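/- **Notation.** Let $1\le m\le n$. On $\mathbb R^n$ with coordinates $x_1,\dots,x_n$ and the standard scalar product consider the exterior algebra generated by $dx_1,\dots,dx_n,d\xi_1,\dots,d\xi_n$, and for a covector $a=\sum a_k\,dx_k$ put $a^\#=\sum a_k\,d\xi_k$ (so $(a_1\wedge\dots\wedge a_p)^\#=a_1^\#\wedge\dots\wedge a_p^\#$). A supercurrent is a sum $T=\sum T_{I,J}\,dx_I\wedge d\xi_J$ whose coefficients $T_{I,J}$ are distributions on $\mathbb R^n$ (a measure $\mu$, used as a coefficient, is written $*\mu$ and acts on test functions by $\rho\mapsto\int\rho\,d\mu$), and $$dT=\sum_k dx_k\wedge\frac{\partial T}{\partial x_k},\qquad d^\#T=\sum_k d\xi_k\wedge\frac{\partial T}{\partial x_k}.$$ Put $\beta=\sum_k dx_k\wedge d\xi_k$ and $\beta_k=\beta^k/k!$. Let $M\subset\mathbb R^n$ be a smooth embedded $m$-dimensional submanifold without boundary which is a closed subset of $\mathbb R^n$, let $p=n-m$, and let $dS_M$ be its surface measure. Near each of its points $M$ is defined by equations $\rho_1=\dots=\rho_p=0$ with $\rho_j$ smooth and $n_j=d\rho_j$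 orthonormal on $M$; put $N=n_1\wedge\dots\wedge n_p$, $c_p=(-1)^{p(p-1)/2}$, $$[M]_s=c_p\,N\wedge N^\#\,{*dS_M},\qquad \sigma_M=[M]_s\wedge\beta_m .$$ The mean curvature vector of $M$ is $\vec H=\sum_j H_j\vec n_j$, where $\vec n_j=\nabla\rho_j$ and $H_j$ is the trace on the tangent space of $M$ of the Hessian of $\rho_j$ (so it points outwards for a sphere). None of this depends on the choice of the $\rho_j$. Let $I\subset\mathbb R$ be an interval with more than one point, $0\in I$. A family $(M_t)_{t\in I}$ of such submanifolds *moves by the mean curvature flow* if there is a smooth, possibly time dependent, vector field $\vec V_t$, $t\in I$, on $\mathbb R^n$ whose restriction to $M_t$ is the mean curvature vector field of $M_t$ for each $t\in I$, and such that $F_t(M_0)=M_t$ for each $t\in I$, where $F_t$ is the flow of $-\vec V_t$ (that is, $F_0(x)=x$ and $\frac{d}{dt}F_t(x)=-\vec V_t(F_t(x))$ on $I$ for $x\in M_0$). **Theorem.** Let $(M_t)_{t\in I}$ be a family of smooth $m$-dimensional submanifolds of $\mathbb R^n$ as above, moving by the mean curvature flow, with $M_0=M$. Let $\sigma_t=[M_t]_s\wedge\beta_m$,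 $\sigma=\sigma_0$, let $\vec H$ be the mean curvature vector of $M$, and let $S=[M]_s\wedge\beta_{m-1}$. Then $$\frac{d\sigma_t}{dt}\Big|_{t=0}=-|\vec H|^2\,\sigma-d\,d^\#S$$ in the sense of currents, i.e. after pairing with an arbitrary smooth compactly supported function on $\mathbb R^n$ (the derivative is one-sided if $0$ is an endpoint of $I$). -/

import Mathlib

open MeasureTheory Set TopologicalSpace
open scoped Distributions Gradient ContDiff LineDeriv RealInnerProductSpace

noncomputable section

namespace Superform

/-- Euclidean space `ℝⁿ`. -/
abbrev E (n : ℕ) : Type := EuclideanSpace ℝ (Fin n)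

/-! ### The algebra of constant superforms -/

/-- The exterior algebra of `T^*(E_s) = T^*(E₀) ⊕ T^*(E₁)`, where covectors on `ℝⁿ` are identified
with vectors through the scalar product. Superforms are functions of `x`, and supercurrents
distributions on `ℝⁿ`, with values in this algebra; the product is the wedge product. -/
abbrev SuperAlg (n : ℕ) : Type := ExteriorAlgebra ℝ (E n × E n)

/-- The `(1,0)`-form `∑ vₖ dxₖ`. -/
def form {n : ℕ} (v : E n) : SuperAlg n := ExteriorAlgebra.ι ℝ (v, 0)

/-- The `(0,1)`-form `∑ vₖ dξₖ`, that is, `(∑ vₖ dxₖ)^#`. -/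
def formSharp {n : ℕ} (v : E n) : SuperAlg n := ExteriorAlgebra.ι ℝ (0, v)

/-- `dxₖ`. -/
def dx {n : ℕ} (k : Fin n) : SuperAlg n := form (EuclideanSpace.single k 1)

/-- `dξₖ`. -/
def dxi {n : ℕ} (k : Fin n) : SuperAlg n := formSharp (EuclideanSpace.single k 1)

/-- The basis of `SuperAlg n` formed by the `dx_I ∧ dξ_J` with `I`, `J` increasing. -/
def superBasis (n : ℕ) : Module.Basis (Finset (Fin (n + n))) ℝ (SuperAlg n) :=
  Module.Basis.ExteriorAlgebra
    ((((EuclideanSpace.basisFun (Fin n) ℝ).toBasis.prod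
      (EuclideanSpace.basisFun (Fin n) ℝ).toBasis)).reindex finSumFinEquiv)

instance (n : ℕ) : FiniteDimensional ℝ (SuperAlg n) := .of_basis (superBasis n)

/-- The maximum norm of the coefficients. As the space is finite dimensional, the choice of a norm
is immaterial: only its topology is used. -/
instance (n : ℕ) : NormedAddCommGroup (SuperAlg n) :=
  NormedAddCommGroup.induced (SuperAlg n) (Finset (Fin (n + n)) → ℝ)
    (superBasis n).equivFun.toLinearMap (superBasis n).equivFun.injective

instance (n : ℕ) : NormedSpace ℝ (SuperAlg n) :=
  NormedSpace.induced ℝ (SuperAlg n) (Finset (Fin (n + n)) → ℝ) (superBasis n).equivFun.toLinearMap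

/-- The Kähler form `β = ∑ dxₖ ∧ dξₖ`. -/
def beta (n : ℕ) : SuperAlg n := ∑ k : Fin n, dx k * dxi k

/-- `β_k = β^k / k!`. -/
def betaPow (n k : ℕ) : SuperAlg n := ((k.factorial : ℝ)⁻¹) • beta n ^ k

/-! ### Supercurrents -/

/-- Supercurrents on `ℝⁿ`: sums `T = ∑ T_{I,J} dx_I ∧ dξ_J` whose coefficients `T_{I,J}` are
distributions on `ℝⁿ`. A distribution coefficient is regarded as a generalized function: a measure
`μ` used as a coefficient is the functional `ρ ↦ ∫ ρ dμ`, which is the object `*μ`. -/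
abbrev Supercurrent (n : ℕ) : Type := 𝓓'((⊤ : Opens (E n)), SuperAlg n)

namespace Supercurrent

variable {n : ℕ}

/-- `a ∧ T` for a constant superform `a`. -/
def wedgeLeft (a : SuperAlg n) (T : Supercurrent n) : Supercurrent n :=
  Distribution.mapCLM (LinearMap.mulLeft ℝ a).toContinuousLinearMap T

/-- `T ∧ a` for a constant superform `a`. -/
def wedge (T : Supercurrent n) (a : SuperAlg n) : Supercurrent n :=
  Distribution.mapCLM (LinearMap.mulRight ℝ a).toContinuousLinearMap T

/-- `d T = ∑ₖ dxₖ ∧ ∂T/∂xₖ`. -/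
def d (T : Supercurrent n) : Supercurrent n :=
  ∑ k : Fin n, wedgeLeft (dx k) (∂_{EuclideanSpace.single k (1 : ℝ)} T)

/-- `d^# T = ∑ₖ dξₖ ∧ ∂T/∂xₖ`. -/
def dSharp (T : Supercurrent n) : Supercurrent n :=
  ∑ k : Fin n, wedgeLeft (dxi k) (∂_{EuclideanSpace.single k (1 : ℝ)} T)

end Supercurrent

/-! ### Submanifolds of `ℝⁿ` -/

/-- `M` is a smooth embedded `m`-dimensional submanifold of `ℝⁿ` without boundary which is a closed
subset of `ℝⁿ`: locally it is the common zero set of `n - m` smooth functions whose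
differentials are linearly independent on `M`. -/
structure IsClosedSubmanifold {n : ℕ} (m : ℕ) (M : Set (E n)) : Prop where
  dim_le : m ≤ n
  isClosed : IsClosed M
  exists_defining : ∀ x ∈ M, ∃ (U : Set (E n)) (ρ : Fin (n - m) → E n → ℝ),
    IsOpen U ∧ x ∈ U ∧ (∀ j, ContDiffOn ℝ ∞ (ρ j) U) ∧
    M ∩ U = {y ∈ U | ∀ j, ρ j y = 0} ∧
    ∀ y ∈ M ∩ U, LinearIndependent ℝ (fun j => ∇ (ρ j) y)

/-- The functions `ρ₁, …, ρ_p` are smooth near `x`, define `M` near `x`, and their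
differentials `n_j = dρ_j` are orthonormal on `M` near `x`. -/
def IsOrthonormalDefining {n p : ℕ} (M : Set (E n)) (x : E n) (ρ : Fin p → E n → ℝ) : Prop :=
  ∃ U : Set (E n), IsOpen U ∧ x ∈ U ∧ (∀ j, ContDiffOn ℝ ∞ (ρ j) U) ∧
    M ∩ U = {y ∈ U | ∀ j, ρ j y = 0} ∧
    ∀ y ∈ M ∩ U, Orthonormal ℝ (fun j => ∇ (ρ j) y)

/-- A choice of defining functions of `M` near `x` as in `IsOrthonormalDefining`. They exist at
every point of a submanifold, and the notions built from them below do not depend on the choice. -/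
def definingFun {n : ℕ} (p : ℕ) (M : Set (E n)) (x : E n) : Fin p → E n → ℝ :=
  Classical.epsilon (IsOrthonormalDefining M x)

section Submanifold

variable {n : ℕ} (m : ℕ) (M : Set (E n))

/-- The unit conormal forms `n_j = dρ_j` at `x ∈ M` (as vectors). -/
def conormal (x : E n) (j : Fin (n - m)) : E n := ∇ (definingFun (n - m) M x j) x

/-- The tangent space of `M` at `x ∈ M`, the orthogonal complement of the `n_j`. -/
def tangentSpace (x : E n) : Submodule ℝ (E n) := (Submodule.span ℝ (range (conormal m M x)))ᗮ

/-- `H_j = tr'(F_j)`, the trace on the tangent space of `M` at `x` of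
`F_j = d n_j^# = ∑ (∂²ρ_j/∂x_k∂x_l) dx_k ∧ dξ_l`. -/
def meanCurvatureCoeff (x : E n) (j : Fin (n - m)) : ℝ :=
  ∑ i, ⟪fderiv ℝ (∇ (definingFun (n - m) M x j)) x
          (stdOrthonormalBasis ℝ (tangentSpace m M x) i : E n),
        (stdOrthonormalBasis ℝ (tangentSpace m M x) i : E n)⟫

/-- The mean curvature vector `H = ∑ H_j n_j` of `M` at `x ∈ M`, with the sign convention for
which the mean curvature vector of a sphere points outwards. -/
def meanCurvature (x : E n) : E n := ∑ j, meanCurvatureCoeff m M x j • conormal m M x j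

/-- `c_p n ∧ n^#` at `x ∈ M`, where `n = n₁ ∧ … ∧ n_p`, `p = n - m` is the codimension and
`c_p = (-1)^{p(p-1)/2}`. -/
def normalSuperform (x : E n) : SuperAlg n :=
  (-1 : ℝ) ^ ((n - m) * (n - m - 1) / 2) •
    ((List.ofFn fun j => form (conormal m M x j)).prod *
      (List.ofFn fun j => formSharp (conormal m M x j)).prod)

/-- The supercurrent `φ *dS_M`, that is, `ρ ↦ ∫_M ρ φ dS_M`, where `dS_M` is the surface
(`m`-dimensional Euclidean Hausdorff) measure on `M` and `φ` is a locally integrable superform on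
`M`. -/
def surfaceCurrent (φ : E n → SuperAlg n) : Supercurrent n :=
  TestFunction.integralAgainstBilinCLM (ContinuousLinearMap.lsmul ℝ ℝ)
    ((Measure.euclideanHausdorffMeasure m).restrict M) φ

/-- The supercurrent `[M]_s = c_p n ∧ n^# *dS_M`. -/
def superCurrent : Supercurrent n := surfaceCurrent m M (normalSuperform m M)

/-- The volume form `σ_M = [M]_s ∧ β_m`. -/
def volumeForm : Supercurrent n := (superCurrent m M).wedge (betaPow n m)

/-- `|H|² σ_M`, the product of the volume form with the function `|H|²` on `M`. -/
def sqMeanCurvatureVolumeForm : Supercurrent n :=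
  (surfaceCurrent m M fun x => ‖meanCurvature m M x‖ ^ 2 • normalSuperform m M x).wedge
    (betaPow n m)

end Submanifold

/-- The family `M_t`, `t ∈ I`, of `m`-dimensional submanifolds moves by the mean curvature flow:
there is a smooth (possibly time dependent) vector field `V` on the ambient space which restricts
to the mean curvature vector field of `M_t` on each `M_t`, and the flow `F_t` of `-V` satisfies
`F_t(M_0) = M_t`. -/
def MovesByMeanCurvature {n : ℕ} (m : ℕ) (I : Set ℝ) (M : ℝ → Set (E n)) : Prop :=
  ∃ V F : ℝ → E n → E n,
    ContDiffOn ℝ ∞ (fun q : ℝ × E n => V q.1 q.2) (I ×ˢ univ) ∧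
    (∀ t ∈ I, ∀ x ∈ M t, V t x = meanCurvature m (M t) x) ∧
    (∀ x ∈ M 0, F 0 x = x) ∧
    (∀ x ∈ M 0, ∀ t ∈ I, HasDerivWithinAt (fun s => F s x) (-V t (F t x)) I t) ∧
    ∀ t ∈ I, F t '' M 0 = M t

end Superform

end

open Superform

open Superform
open Filter Topology
open scoped NNReal ENNReal

/-! Since `[M]_s ∧ β_m` is the surface measure times the constant top form `β_n`, pairing `σ_t` with
a test function `g` gives `(∫_{M_t} g dS) β_n`. Moving both derivatives of `d d^# S` onto `g` and
contracting the Hessian of `g` with `c_p N ∧ N^# ∧ β_{m-1}` gives `(∫_M tr_T Hess g dS) β_n`, where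
`tr_T` is the trace over the tangent space (`tanTrace`). The theorem thus reduces to the scalar
identity `d/dt ∫_{M_t} g = -∫_M |H|² g - ∫_M tr_T Hess g` at `t = 0`.

Let `X` be the initial velocity, which equals `-H` on `M`. The first variation formula gives the
derivative `∫_M (dg(X) + g div_M X)`. As `X` is normal along `M`, `div_M X = ⟨X, H⟩ = -|H|²`
(`tanTrace_fderiv_of_normal`). The other term is `∫ dg(X) = -∫ ⟨∇g, H⟩ = -∫ div_M ∇g = -∫ tr_T Hess
g`, by the divergence theorem on `M` (`integral_tanTrace`).

The first variation formula is proved without differentiating the flow in space: `F_t` is only known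
on `M_0`, as a family of integral curves. ODE estimates (`exists_expansion`) show that `F_t` differs
from `x ↦ x + t X₀(x)` by a map that is `o(t)` on bounded sets, together with its Lipschitz
constant. Hausdorff measures of images are controlled by Lipschitz comparison of the maps, so the
integrals over the two images differ by `o(t)` (`abs_setIntegral_image_sub_le`). For the explicit
deformation the area formula (`euclideanHausdorffMeasure_image_eq`) moves the integral to a fixed
compact set of parameters, and the derivative of the volume factor is computed in `fderiv_normDet`.
A partition of unity passes from small supports to arbitrary ones.

On the algebraic side, `(1,1)`-forms `v ∧ w^#` commute and `v ∧ v^#` has square zero. With `ν = ∑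
n_j ∧ n_j^#` and `τ` the analogous sum over an orthonormal tangent basis, `β = ν + τ` and `c_p N ∧
N^# = ν^p / p!`. Both contractions above then follow by counting generators
(`factorial_smul_frameForm_pow_mul_betaPow`, `sum_pair_mul_eq_tanTrace`). -/

namespace Superform

/-! ### The area formula for immersions -/

section AreaFormula

/-- If distances between values of `f` are at most `a` times those between values of `g`, then the
Hausdorff measure of the image of `f` is at most `a ^ d` times that of the image of `g`. -/
lemma euclideanHausdorffMeasure_image_le_of_dist_le {X Y Z : Type*}
    [MetricSpace Y] [MeasurableSpace Y] [BorelSpace Y] [MetricSpace Z] [MeasurableSpace Z]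
    [BorelSpace Z] (d : ℕ) {f : X → Y} {g : X → Z} {s : Set X} {a : ℝ≥0}
    (h : ∀ x ∈ s, ∀ y ∈ s, dist (f x) (f y) ≤ a * dist (g x) (g y)) :
    Measure.euclideanHausdorffMeasure d (f '' s) ≤
      (a : ℝ≥0∞) ^ d * Measure.euclideanHausdorffMeasure d (g '' s) := by
  rcases s.eq_empty_or_nonempty with rfl | ⟨x₀, hx₀⟩
  · simp
  have : Nonempty X := ⟨x₀⟩
  -- `g` need not be injective, but the hypothesis makes `f` constant on its fibres in `s`, so any
  -- choice of preimage lets `f` factor through `g` by an `a`-Lipschitz map.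
  set k : Z → Y := fun z => f (Function.invFunOn g s z) with hk
  have hinv : ∀ x ∈ s, Function.invFunOn g s (g x) ∈ s ∧ g (Function.invFunOn g s (g x)) = g x :=
    fun x hx => ⟨Function.invFunOn_mem ⟨x, hx, rfl⟩, Function.invFunOn_eq ⟨x, hx, rfl⟩⟩
  have hkg : ∀ x ∈ s, k (g x) = f x := by
    intro x hx
    have h1 := h _ (hinv x hx).1 x hx
    rw [(hinv x hx).2, dist_self, mul_zero] at h1
    exact dist_le_zero.mp h1
  have hL : LipschitzOnWith a k (g '' s) := by
    refine LipschitzOnWith.of_dist_le_mul ?_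
    rintro _ ⟨x, hx, rfl⟩ _ ⟨y, hy, rfl⟩
    rw [hkg x hx, hkg y hy]
    exact h x hx y hy
  have himg : f '' s = k '' (g '' s) := by
    rw [image_image]
    exact image_congr fun x hx => (hkg x hx).symm
  have := hL.hausdorffMeasure_image_le (d := (d : ℝ)) (by positivity)
  rw [himg, Measure.euclideanHausdorffMeasure_def, Measure.euclideanHausdorffMeasure_def,
    Measure.smul_apply, Measure.smul_apply, ENNReal.smul_def, ENNReal.smul_def, smul_eq_mul,
    smul_eq_mul, mul_left_comm]
  rw [ENNReal.rpow_natCast] at this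
  gcongr

/-- A set which is locally contained in sets with a hereditary property can be partitioned into
countably many measurable sets with this property. -/
lemma exists_measurable_partition_of_local {X : Type*} [TopologicalSpace X]
    [SecondCountableTopology X] [MeasurableSpace X] [OpensMeasurableSpace X] {s : Set X}
    (hs : MeasurableSet s) {P : Set X → Prop}
    (hP : ∀ x ∈ s, ∃ U ∈ 𝓝 x, ∀ t ⊆ U ∩ s, MeasurableSet t → P t) (h0 : P ∅) :
    ∃ t : ℕ → Set X, (∀ i, MeasurableSet (t i)) ∧ Pairwise (Function.onFun Disjoint t) ∧
      ⋃ i, t i = s ∧ ∀ i, P (t i) := by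
  choose! U hU hUP using hP
  obtain ⟨c, hcs, hc, hcov⟩ := TopologicalSpace.countable_cover_nhdsWithin
    (f := fun x => interior (U x)) (s := s)
    (fun x hx => mem_nhdsWithin_of_mem_nhds (interior_mem_nhds.mpr (hU x hx)))
  rcases c.eq_empty_or_nonempty with rfl | hne
  · have hs0 : s = ∅ := by simpa using hcov
    exact ⟨fun _ => ∅, by simp, by intro i j _; simp [Function.onFun], by simp [hs0], fun _ => h0⟩
  obtain ⟨e, he⟩ := hc.exists_eq_range hne
  set V : ℕ → Set X := fun i => interior (U (e i)) ∩ s with hV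
  have hVm : ∀ i, MeasurableSet (V i) := fun i => isOpen_interior.measurableSet.inter hs
  refine ⟨disjointed V, fun i => MeasurableSet.disjointed hVm i, disjoint_disjointed V, ?_, ?_⟩
  · rw [iUnion_disjointed]
    refine subset_antisymm (iUnion_subset fun i => inter_subset_right) fun x hx => ?_
    obtain ⟨y, hy, hxy⟩ := mem_iUnion₂.mp (hcov hx)
    rw [he] at hy
    obtain ⟨i, rfl⟩ := hy
    exact mem_iUnion.mpr ⟨i, hxy, hx⟩
  · intro i
    have hei : e i ∈ s := hcs (he ▸ mem_range_self i)
    refine hUP _ hei _ ((disjointed_subset V i).trans ?_) (MeasurableSet.disjointed hVm i)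
    exact inter_subset_inter_left _ interior_subset

/-- The Gram determinant is polynomial in the entries of `A`. Hence the volume factor is continuous
everywhere, and smooth at injective maps, where the radicand is positive. -/
lemma normDet_eq_sqrt {m n : ℕ} (A : E m →L[ℝ] E n) :
    (A : E m →ₗ[ℝ] E n).normDet = √((A.adjoint ∘L A).det) := by
  rw [← A.normDet_sq]
  exact (Real.sqrt_sq (LinearMap.normDet_nonneg _)).symm

lemma contDiff_det (m : ℕ) : ContDiff ℝ ∞ (fun A : E m →L[ℝ] E m => A.det) := by
  have h : (fun A : E m →L[ℝ] E m => A.det) = fun A : E m →L[ℝ] E m =>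
      ∑ σ : Equiv.Perm (Fin m), ((Equiv.Perm.sign σ : ℤ) : ℝ) *
        ∏ i, ⟪EuclideanSpace.basisFun (Fin m) ℝ (σ i), A (EuclideanSpace.basisFun (Fin m) ℝ i)⟫ := by
    ext A
    rw [ContinuousLinearMap.det,
      ← LinearMap.det_toMatrix (EuclideanSpace.basisFun (Fin m) ℝ).toBasis, Matrix.det_apply']
    simp [LinearMap.toMatrix_apply, EuclideanSpace.inner_single_left]
  rw [h]
  refine ContDiff.sum fun σ _ => contDiff_const.mul (contDiff_prod fun i _ => ?_)
  exact contDiff_const.inner ℝ (contDiff_id.clm_apply contDiff_const)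

lemma contDiff_adjoint_comp_self (m n : ℕ) :
    ContDiff ℝ ∞ (fun A : E m →L[ℝ] E n => A.adjoint ∘L A) := by
  refine ContDiff.clm_comp ?_ contDiff_id
  exact (ContinuousLinearMap.adjoint (𝕜 := ℝ) (E := E m) (F := E n)).toContinuousLinearEquiv.contDiff

lemma continuous_normDet (m n : ℕ) :
    Continuous (fun A : E m →L[ℝ] E n => (A : E m →ₗ[ℝ] E n).normDet) := by
  simp only [normDet_eq_sqrt]
  exact Real.continuous_sqrt.comp
    (((contDiff_det m).comp (contDiff_adjoint_comp_self m n)).continuous)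

lemma normDet_pos {m n : ℕ} {A : E m →L[ℝ] E n} (hA : Function.Injective A) :
    0 < (A : E m →ₗ[ℝ] E n).normDet :=
  lt_of_le_of_ne (LinearMap.normDet_nonneg _)
    (Ne.symm (((A : E m →ₗ[ℝ] E n).normDet_ne_zero_tfae.out 4 0 rfl rfl).mp hA))

lemma det_adjoint_comp_self_pos {m n : ℕ} {A : E m →L[ℝ] E n} (hA : Function.Injective A) :
    0 < (A.adjoint ∘L A).det := by
  rw [← A.normDet_sq]
  exact pow_pos (normDet_pos hA) 2

lemma contDiffAt_normDet {m n : ℕ} {A : E m →L[ℝ] E n} (hA : Function.Injective A) :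
    ContDiffAt ℝ ∞ (fun A : E m →L[ℝ] E n => (A : E m →ₗ[ℝ] E n).normDet) A := by
  simp only [normDet_eq_sqrt]
  exact (((contDiff_det m).comp (contDiff_adjoint_comp_self m n)).contDiffAt).sqrt
    (det_adjoint_comp_self_pos hA).ne'

lemma euclideanHausdorffMeasure_linear_image {m n : ℕ} (A : E m →L[ℝ] E n) (s : Set (E m)) :
    Measure.euclideanHausdorffMeasure m (A '' s) =
      ENNReal.ofReal (A : E m →ₗ[ℝ] E n).normDet * volume s := by
  have := (A : E m →ₗ[ℝ] E n).euclideanHausdorffMeasure_image_eq_normDet_mul_volume s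
  rwa [finrank_euclideanSpace_fin] at this

/-- Near a point where `f` is an immersion, `f` compares with its differential. -/
lemma eventually_dist_le_of_hasStrictFDerivAt {m n : ℕ} {f : E m → E n} {A : E m →L[ℝ] E n}
    {x : E m} (hf : HasStrictFDerivAt f A x) (hA : Function.Injective A) {a : ℝ≥0} (ha : 1 < a) :
    ∃ U ∈ 𝓝 x, ∀ y ∈ U, ∀ z ∈ U,
      dist (f y) (f z) ≤ a * dist (A y) (A z) ∧ dist (A y) (A z) ≤ a * dist (f y) (f z) := by
  obtain ⟨K, hK, hAK⟩ := LinearMap.exists_antilipschitzWith (A : E m →ₗ[ℝ] E n)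
    (LinearMap.ker_eq_bot.mpr hA)
  have ha' : (1 : ℝ) < a := by exact_mod_cast ha
  have ha0 : (0 : ℝ) < a := by linarith
  have hK0 : (0 : ℝ) < K := by exact_mod_cast hK
  -- With this `c` the linearization error is at most `(a - 1)/a` times `‖A y - A z‖`. Both bounds
  -- follow, since `1 + (a - 1)/a ≤ a` and `1 - (a - 1)/a = 1/a`.
  set c : ℝ≥0 := K⁻¹ * ((a - 1) / a) with hc
  have hcR : (c : ℝ) = (K : ℝ)⁻¹ * ((a - 1) / a) := by
    rw [hc]; push_cast [NNReal.coe_sub ha.le]; ring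
  have hc0 : 0 < c := by
    rw [← NNReal.coe_pos, hcR]
    have : (0 : ℝ) < a - 1 := by linarith
    positivity
  obtain ⟨U, hU, hfU⟩ := hf.approximates_deriv_on_nhds (c := c) (Or.inr hc0)
  refine ⟨U, hU, fun y hy z hz => ?_⟩
  have h1 := hfU y hy z hz
  have h2 : ‖y - z‖ ≤ K * ‖A y - A z‖ := by
    simpa [dist_eq_norm] using hAK.le_mul_dist y z
  have h3 : ‖f y - f z - (A y - A z)‖ ≤ (a - 1) / a * ‖A y - A z‖ := by
    rw [← map_sub]
    calc _ ≤ c * ‖y - z‖ := h1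
      _ ≤ c * (K * ‖A y - A z‖) := by gcongr
      _ = _ := by rw [hcR, map_sub]; field_simp
  rw [dist_eq_norm, dist_eq_norm]
  have h4 := norm_sub_norm_le (f y - f z) (A y - A z)
  have h5 := norm_sub_norm_le (A y - A z) (f y - f z)
  rw [norm_sub_rev (A y - A z) (f y - f z)] at h5
  have hN := norm_nonneg (A y - A z)
  constructor
  · have h6 : ((a : ℝ) - 1) / a ≤ a - 1 := div_le_self (by linarith) ha'.le
    have : ((a : ℝ) - 1) / a * ‖A y - A z‖ ≤ (a - 1) * ‖A y - A z‖ := by gcongr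
    linarith
  · have h7 : ((a : ℝ) - 1) / a = 1 - 1 / a := by field_simp
    rw [h7] at h3
    have h8 : (1 / (a : ℝ)) * ‖A y - A z‖ ≤ ‖f y - f z‖ := by linarith
    rw [one_div, inv_mul_le_iff₀ ha0] at h8
    exact h8

variable {m n : ℕ} {f : E m → E n} {O s : Set (E m)}

/-- Replacing `f` by its differential at `x` costs `a ^ m` in Hausdorff measure, and replacing the
volume factor at `y` by that at `x` costs one more factor `a`; for the linear map the formula is
known. -/
lemma euclideanHausdorffMeasure_image_local (hO : IsOpen O) (hf : ContDiffOn ℝ 1 f O) {x : E m}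
    (hx : x ∈ O) (hinj : Function.Injective (fderiv ℝ f x)) {a : ℝ≥0} (ha : 1 < a) :
    ∃ U ∈ 𝓝 x, ∀ t ⊆ U, MeasurableSet t →
      Measure.euclideanHausdorffMeasure m (f '' t) ≤ (a : ℝ≥0∞) ^ (m + 1) *
        ∫⁻ y in t, ENNReal.ofReal (fderiv ℝ f y : E m →ₗ[ℝ] E n).normDet ∧
      ∫⁻ y in t, ENNReal.ofReal (fderiv ℝ f y : E m →ₗ[ℝ] E n).normDet ≤
        (a : ℝ≥0∞) ^ (m + 1) * Measure.euclideanHausdorffMeasure m (f '' t) := by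
  have hfx : ContDiffAt ℝ 1 f x := hf.contDiffAt (hO.mem_nhds hx)
  obtain ⟨U, hU, hUf⟩ := eventually_dist_le_of_hasStrictFDerivAt
    (hfx.hasStrictFDerivAt one_ne_zero) hinj ha
  have ha' : (1 : ℝ) < a := by exact_mod_cast ha
  have hcont : ContinuousAt (fun y => (fderiv ℝ f y : E m →ₗ[ℝ] E n).normDet) x :=
    (continuous_normDet m n).continuousAt.comp
      ((hf.continuousOn_fderiv_of_isOpen hO le_rfl).continuousAt (hO.mem_nhds hx))
  have hpos := normDet_pos hinj
  set J := fun y => (fderiv ℝ f y : E m →ₗ[ℝ] E n).normDet with hJ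
  have e1 : ∀ᶠ y in 𝓝 x, J y < a * J x :=
    hcont.eventually (gt_mem_nhds (by nlinarith [hpos]))
  have e2 : ∀ᶠ y in 𝓝 x, J x < a * J y :=
    (hcont.const_mul (a : ℝ)).eventually (lt_mem_nhds (by nlinarith [hpos]))
  refine ⟨U ∩ {y | J y < a * J x ∧ J x < a * J y}, inter_mem hU (e1.and e2), fun t ht htm => ?_⟩
  have hle1 : ∀ y ∈ t, ENNReal.ofReal (J y) ≤ a * ENNReal.ofReal (J x) := fun y hy => by
    rw [← ENNReal.ofReal_coe_nnreal, ← ENNReal.ofReal_mul a.coe_nonneg]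
    exact ENNReal.ofReal_le_ofReal (ht hy).2.1.le
  have hle2 : ∀ y ∈ t, ENNReal.ofReal (J x) ≤ a * ENNReal.ofReal (J y) := fun y hy => by
    rw [← ENNReal.ofReal_coe_nnreal, ← ENNReal.ofReal_mul a.coe_nonneg]
    exact ENNReal.ofReal_le_ofReal (ht hy).2.2.le
  have hA := euclideanHausdorffMeasure_linear_image (fderiv ℝ f x) t
  have i1 : ENNReal.ofReal (J x) * volume t ≤ a * ∫⁻ y in t, ENNReal.ofReal (J y) := by
    rw [← setLIntegral_const, ← lintegral_const_mul' _ _ ENNReal.coe_ne_top]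
    exact setLIntegral_mono' htm hle2
  have i2 : ∫⁻ y in t, ENNReal.ofReal (J y) ≤ a * (ENNReal.ofReal (J x) * volume t) := by
    rw [← mul_assoc, ← setLIntegral_const]
    exact setLIntegral_mono' htm hle1
  constructor
  · calc _ ≤ (a : ℝ≥0∞) ^ m * Measure.euclideanHausdorffMeasure m (fderiv ℝ f x '' t) :=
          euclideanHausdorffMeasure_image_le_of_dist_le m
            fun y hy z hz => (hUf y (ht hy).1 z (ht hz).1).1
      _ ≤ (a : ℝ≥0∞) ^ m * (a * ∫⁻ y in t, ENNReal.ofReal (J y)) := by rw [hA]; gcongr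
      _ = _ := by rw [pow_succ, mul_assoc]
  · calc _ ≤ a * (ENNReal.ofReal (J x) * volume t) := i2
      _ ≤ a * ((a : ℝ≥0∞) ^ m * Measure.euclideanHausdorffMeasure m (f '' t)) := by
          rw [← hA]
          gcongr
          exact euclideanHausdorffMeasure_image_le_of_dist_le m
            fun y hy z hz => (hUf y (ht hy).1 z (ht hz).1).2
      _ = _ := by rw [pow_succ]; ring

/-- The area formula: the surface measure of the image of an injective immersion. -/
theorem euclideanHausdorffMeasure_image_eq (hO : IsOpen O) (hf : ContDiffOn ℝ 1 f O)
    (hinj : ∀ x ∈ s, Function.Injective (fderiv ℝ f x)) (hs : MeasurableSet s) (hsO : s ⊆ O)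
    (hfs : InjOn f s) :
    Measure.euclideanHausdorffMeasure m (f '' s) =
      ∫⁻ y in s, ENNReal.ofReal (fderiv ℝ f y : E m →ₗ[ℝ] E n).normDet := by
  set J := fun y => ENNReal.ofReal (fderiv ℝ f y : E m →ₗ[ℝ] E n).normDet with hJ
  have key : ∀ a : ℝ≥0, 1 < a →
      Measure.euclideanHausdorffMeasure m (f '' s) ≤ (a : ℝ≥0∞) ^ (m + 1) * ∫⁻ y in s, J y ∧
      ∫⁻ y in s, J y ≤ (a : ℝ≥0∞) ^ (m + 1) * Measure.euclideanHausdorffMeasure m (f '' s) := by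
    intro a ha
    -- Both local inequalities are stable under countable disjoint unions: `f` is injective on `s`,
    -- so the images of the pieces are disjoint too. Afterwards `a` tends to `1`.
    obtain ⟨t, htm, htd, rfl, htP⟩ := exists_measurable_partition_of_local hs
      (P := fun t => Measure.euclideanHausdorffMeasure m (f '' t) ≤
        (a : ℝ≥0∞) ^ (m + 1) * ∫⁻ y in t, J y ∧
        ∫⁻ y in t, J y ≤ (a : ℝ≥0∞) ^ (m + 1) * Measure.euclideanHausdorffMeasure m (f '' t))
      (fun x hx => by
        obtain ⟨U, hU, h⟩ :=
          euclideanHausdorffMeasure_image_local hO hf (hsO hx) (hinj x hx) ha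
        exact ⟨U, hU, fun t ht => h t (ht.trans inter_subset_left)⟩) (by simp)
    have hsum : ∫⁻ y in ⋃ i, t i, J y = ∑' i, ∫⁻ y in t i, J y := lintegral_iUnion htm htd _
    have himg : Measure.euclideanHausdorffMeasure m (f '' ⋃ i, t i) =
        ∑' i, Measure.euclideanHausdorffMeasure m (f '' t i) := by
      rw [image_iUnion]
      refine measure_iUnion (fun i j hij => ?_) fun i => ?_
      · exact Set.disjoint_image_image fun x hx y hy hxy => Set.disjoint_left.mp (htd hij) hx
          (by rwa [hfs (mem_iUnion_of_mem i hx) (mem_iUnion_of_mem j hy) hxy])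
      · exact (htm i).image_of_continuousOn_injOn
          (hf.continuousOn.mono ((subset_iUnion t i).trans hsO)) (hfs.mono (subset_iUnion t i))
    rw [hsum, himg, ← ENNReal.tsum_mul_left, ← ENNReal.tsum_mul_left]
    exact ⟨ENNReal.tsum_le_tsum fun i => (htP i).1, ENNReal.tsum_le_tsum fun i => (htP i).2⟩
  have hlim : ∀ b : ℝ≥0∞, Tendsto (fun a : ℝ≥0 => (a : ℝ≥0∞) ^ (m + 1) * b) (𝓝[>] 1) (𝓝 b) := by
    intro b
    have h1 : Tendsto (fun a : ℝ≥0 => (a : ℝ≥0∞) ^ (m + 1)) (𝓝[>] 1) (𝓝 1) := by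
      have : Tendsto (fun a : ℝ≥0 => ((a ^ (m + 1) : ℝ≥0) : ℝ≥0∞)) (𝓝 1) (𝓝 ((1 ^ (m + 1) : ℝ≥0))) :=
        ENNReal.tendsto_coe.mpr ((continuous_pow (m + 1)).tendsto 1)
      simpa using this.mono_left nhdsWithin_le_nhds
    simpa using ENNReal.Tendsto.mul_const h1 (Or.inl one_ne_zero)
  have hev : ∀ᶠ a : ℝ≥0 in 𝓝[>] 1, 1 < a := eventually_mem_nhdsWithin
  exact le_antisymm (ge_of_tendsto (hlim _) (hev.mono fun a ha => (key a ha).1))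
    (ge_of_tendsto (hlim _) (hev.mono fun a ha => (key a ha).2))

/-- The area formula on the sets `s ∩ f ⁻¹' t`, read as an equality of measures; integrals of
arbitrary functions then transform by pushforward. -/
lemma map_withDensity_normDet_eq (hO : IsOpen O) (hf : ContDiffOn ℝ 1 f O)
    (hinj : ∀ x ∈ s, Function.Injective (fderiv ℝ f x)) (hs : MeasurableSet s) (hsO : s ⊆ O)
    (hfs : InjOn f s) :
    ((volume.restrict s).withDensity
      fun y => ENNReal.ofReal (fderiv ℝ f y : E m →ₗ[ℝ] E n).normDet).map f =
      (Measure.euclideanHausdorffMeasure m).restrict (f '' s) := by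
  have hfc : ContinuousOn f s := hf.continuousOn.mono hsO
  have hfm : AEMeasurable f ((volume.restrict s).withDensity
      fun y => ENNReal.ofReal (fderiv ℝ f y : E m →ₗ[ℝ] E n).normDet) :=
    (hfc.aemeasurable hs).mono_ac (withDensity_absolutelyContinuous _ _)
  ext t ht
  have hmeas : MeasurableSet (s ∩ f ⁻¹' t) := by
    have h1 : Measurable (s.domRestrict f) :=
      (continuousOn_iff_continuous_domRestrict.mp hfc).measurable
    have h2 := (MeasurableSet.subtype_image hs (h1 ht))
    convert h2 using 1
    ext x; simp [and_comm]
  rw [Measure.map_apply_of_aemeasurable hfm ht, Measure.restrict_apply ht, withDensity_apply']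
  rw [Measure.restrict_restrict₀' hs.nullMeasurableSet, inter_comm, inter_comm t,
    ← image_inter_preimage]
  exact (euclideanHausdorffMeasure_image_eq hO hf (fun x hx => hinj x hx.1) hmeas
    (inter_subset_left.trans hsO) (hfs.mono inter_subset_left)).symm

/-- The area formula for integrals over the image of an injective immersion. -/
theorem setIntegral_image_eq (hO : IsOpen O) (hf : ContDiffOn ℝ 1 f O)
    (hinj : ∀ x ∈ s, Function.Injective (fderiv ℝ f x)) (hs : MeasurableSet s) (hsO : s ⊆ O)
    (hfs : InjOn f s) {g : E n → ℝ}
    (hg : AEStronglyMeasurable g ((Measure.euclideanHausdorffMeasure m).restrict (f '' s))) :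
    ∫ y in f '' s, g y ∂(Measure.euclideanHausdorffMeasure m) =
      ∫ x in s, (fderiv ℝ f x : E m →ₗ[ℝ] E n).normDet * g (f x) := by
  have hfc : ContinuousOn f s := hf.continuousOn.mono hsO
  have hfm : AEMeasurable f ((volume.restrict s).withDensity
      fun y => ENNReal.ofReal (fderiv ℝ f y : E m →ₗ[ℝ] E n).normDet) :=
    (hfc.aemeasurable hs).mono_ac (withDensity_absolutelyContinuous _ _)
  have hJm : AEMeasurable (fun y => ENNReal.ofReal (fderiv ℝ f y : E m →ₗ[ℝ] E n).normDet)
      (volume.restrict s) := by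
    refine ContinuousOn.aemeasurable ?_ hs
    exact (ENNReal.continuous_ofReal.comp (continuous_normDet m n)).comp_continuousOn
      ((hf.continuousOn_fderiv_of_isOpen hO le_rfl).mono hsO)
  have hmap := map_withDensity_normDet_eq hO hf hinj hs hsO hfs
  rw [← hmap] at hg ⊢
  rw [integral_map hfm hg, integral_withDensity_eq_integral_toReal_smul₀ hJm
    (Eventually.of_forall fun _ => ENNReal.ofReal_lt_top)]
  simp [ENNReal.toReal_ofReal (LinearMap.normDet_nonneg _)]

end AreaFormula

end Superform

namespace Superform

/-! ### The differential of the volume factor -/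

section NormDetDeriv

lemma fderiv_det_one {m : ℕ} (X : E m →L[ℝ] E m) :
    fderiv ℝ (fun A : E m →L[ℝ] E m => A.det) 1 X = LinearMap.trace ℝ (E m) X := by
  have h1 : HasDerivAt (fun t : ℝ => ((1 : E m →L[ℝ] E m) + t • X).det)
      (fderiv ℝ (fun A : E m →L[ℝ] E m => A.det) 1 X) 0 := by
    have hd : HasFDerivAt (fun A : E m →L[ℝ] E m => A.det)
        (fderiv ℝ (fun A : E m →L[ℝ] E m => A.det) 1) ((1 : E m →L[ℝ] E m) + (0 : ℝ) • X) := by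
      have h0 : (1 : E m →L[ℝ] E m) + (0 : ℝ) • X = 1 := by ext; simp
      rw [h0]
      exact ((contDiff_det m).differentiable (by simp) _).hasFDerivAt
    have hc : HasDerivAt (fun t : ℝ => (1 : E m →L[ℝ] E m) + t • X) X 0 := by
      simpa using ((hasDerivAt_id (0 : ℝ)).smul_const X).const_add (1 : E m →L[ℝ] E m)
    exact hd.comp_hasDerivAt (0 : ℝ) hc
  set b := (EuclideanSpace.basisFun (Fin m) ℝ).toBasis
  have h2 : (fun t : ℝ => ((1 : E m →L[ℝ] E m) + t • X).det) =
      fun t : ℝ => (1 + t • LinearMap.toMatrix b b (X : E m →ₗ[ℝ] E m)).det := by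
    ext t
    rw [ContinuousLinearMap.det, ← LinearMap.det_toMatrix b]
    congr 1
    rw [ContinuousLinearMap.toLinearMap_add, ContinuousLinearMap.toLinearMap_smul, map_add,
      map_smul]
    congr 1
    exact LinearMap.toMatrix_id b
  have h3 : HasDerivAt
      (fun t : ℝ => (1 + t • LinearMap.toMatrix b b (X : E m →ₗ[ℝ] E m)).det)
      (LinearMap.trace ℝ (E m) X) 0 := by
    set N := LinearMap.toMatrix b b (X : E m →ₗ[ℝ] E m)
    rw [LinearMap.trace_eq_matrix_trace ℝ b]
    have h4 : (fun t : ℝ => (1 + t • N).det) = fun t : ℝ => 1 + N.trace * t +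
        (Matrix.det (1 + (Polynomial.X : Polynomial ℝ) • N.map Polynomial.C)).divX.divX.eval t
          * t ^ 2 := by
      ext t
      exact Matrix.det_one_add_smul t N
    rw [h4]
    have h5 := (((hasDerivAt_id (0 : ℝ)).const_mul N.trace).const_add 1).add
      (((Matrix.det (1 + (Polynomial.X : Polynomial ℝ) • N.map Polynomial.C)).divX.divX.hasDerivAt
        0).mul (hasDerivAt_pow 2 (0 : ℝ)))
    have h6 : N.trace * 1 + ((Matrix.det (1 + (Polynomial.X : Polynomial ℝ) •
        N.map Polynomial.C)).divX.divX.derivative.eval 0 * (0 : ℝ) ^ 2 +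
        (Matrix.det (1 + (Polynomial.X : Polynomial ℝ) • N.map Polynomial.C)).divX.divX.eval 0 *
          (((2 : ℕ) : ℝ) * (0 : ℝ) ^ (2 - 1))) = N.trace := by simp
    exact HasDerivAt.congr_deriv h5 h6
  rw [← h2] at h3
  exact h1.unique h3

/-- Multiplicativity of the determinant reduces the derivative at `C` to the one at the identity;
`C` need not be invertible because the direction already has the form `C ∘ X`. -/
lemma fderiv_det {m : ℕ} {C : E m →L[ℝ] E m} {X : E m →L[ℝ] E m} :
    fderiv ℝ (fun A : E m →L[ℝ] E m => A.det) C (C ∘L X) = C.det * LinearMap.trace ℝ (E m) X := by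
  have hC : (fun A : E m →L[ℝ] E m => (C ∘L A).det) = fun A => C.det * A.det := by
    ext A
    simp [ContinuousLinearMap.det]
  have hd := ((contDiff_det m).differentiable (by simp))
  have h1 : HasFDerivAt (fun A : E m →L[ℝ] E m => (C ∘L A).det)
      ((fderiv ℝ (fun A : E m →L[ℝ] E m => A.det) C).comp
        ((ContinuousLinearMap.compL ℝ (E m) (E m) (E m)) C)) 1 := by
    have : HasFDerivAt (fun A : E m →L[ℝ] E m => A.det)
        (fderiv ℝ (fun A : E m →L[ℝ] E m => A.det) C)
        ((ContinuousLinearMap.compL ℝ (E m) (E m) (E m)) C 1) := by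
      have : (ContinuousLinearMap.compL ℝ (E m) (E m) (E m)) C 1 = C := by ext; simp
      rw [this]; exact (hd C).hasFDerivAt
    exact this.comp _ ((ContinuousLinearMap.compL ℝ (E m) (E m) (E m)) C).hasFDerivAt
  have h2 : HasFDerivAt (fun A : E m →L[ℝ] E m => C.det * A.det)
      (C.det • fderiv ℝ (fun A : E m →L[ℝ] E m => A.det) 1) 1 :=
    (hd 1).hasFDerivAt.const_mul _
  rw [hC] at h1
  have h3 := congrArg (fun L => L X) (h1.unique h2)
  simpa [fderiv_det_one] using h3

lemma trace_adjoint {m : ℕ} (X : E m →L[ℝ] E m) :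
    LinearMap.trace ℝ (E m) (X.adjoint : E m →L[ℝ] E m) = LinearMap.trace ℝ (E m) X := by
  rw [LinearMap.trace_eq_sum_inner _ (EuclideanSpace.basisFun (Fin m) ℝ),
    LinearMap.trace_eq_sum_inner _ (EuclideanSpace.basisFun (Fin m) ℝ)]
  refine Finset.sum_congr rfl fun i _ => ?_
  rw [ContinuousLinearMap.coe_coe, ContinuousLinearMap.coe_coe,
    ContinuousLinearMap.adjoint_inner_right, real_inner_comm]

lemma fderiv_adjoint_comp_self {m n : ℕ} (A B : E m →L[ℝ] E n) :
    fderiv ℝ (fun A : E m →L[ℝ] E n => A.adjoint ∘L A) A B =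
    A.adjoint ∘L B + B.adjoint ∘L A := by
  let adj : (E m →L[ℝ] E n) →L[ℝ] (E n →L[ℝ] E m) :=
    { toFun := fun A => A.adjoint
      map_add' := map_add _
      map_smul' := by intro c A; simp
      cont := (ContinuousLinearMap.adjoint (𝕜 := ℝ) (E := E m) (F := E n)).continuous }
  have ha : HasFDerivAt (fun A : E m →L[ℝ] E n => A.adjoint) adj A := adj.hasFDerivAt
  rw [show fderiv ℝ (fun A : E m →L[ℝ] E n => A.adjoint ∘L A) A = _ from
    (ha.clm_comp (hasFDerivAt_id A)).fderiv]
  ext1 x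
  simp [adj]

/-- The differential of the volume factor at an injective map `A`, expressed through the
pseudoinverse `Q` of `A`. -/
lemma fderiv_normDet {m n : ℕ} {A : E m →L[ℝ] E n} {Q : E n →L[ℝ] E m}
    (hQA : Q ∘L A = ContinuousLinearMap.id ℝ (E m)) (hAQ : (A ∘L Q).adjoint = A ∘L Q)
    (B : E m →L[ℝ] E n) :
    fderiv ℝ (fun A : E m →L[ℝ] E n => (A : E m →ₗ[ℝ] E n).normDet) A B =
      (A : E m →ₗ[ℝ] E n).normDet * LinearMap.trace ℝ (E m) (Q ∘L B : E m →L[ℝ] E m) := by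
  have hA : Function.Injective A := by
    intro x y hxy
    have := congrArg Q hxy
    simpa [← ContinuousLinearMap.comp_apply, hQA] using this
  set C := A.adjoint ∘L A with hC
  have hdet : 0 < C.det := det_adjoint_comp_self_pos hA
  -- `A Q` is self-adjoint and `A Q A = A`, so `A* (A Q) = (A Q A)* = A*`. This yields `A* B = C (Q
  -- B)` and, by taking adjoints, `B* A = (Q B)* C`.
  have hCA : A.adjoint ∘L A ∘L Q = A.adjoint := by
    rw [← hAQ, ← ContinuousLinearMap.adjoint_comp, ContinuousLinearMap.comp_assoc, hQA]
    simp
  have h1 : HasFDerivAt (fun A : E m →L[ℝ] E n => A.adjoint ∘L A)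
      (fderiv ℝ (fun A : E m →L[ℝ] E n => A.adjoint ∘L A) A) A :=
    ((contDiff_adjoint_comp_self m n).differentiable (by simp) A).hasFDerivAt
  have h2 := fderiv_adjoint_comp_self A B
  have h3 : fderiv ℝ (fun A : E m →L[ℝ] E m => A.det) C (A.adjoint ∘L B + B.adjoint ∘L A) =
      2 * (C.det * LinearMap.trace ℝ (E m) (Q ∘L B : E m →L[ℝ] E m)) := by
    have e1 : A.adjoint ∘L B = C ∘L (Q ∘L B) := by
      conv_lhs => rw [← hCA]
      simp [hC, ContinuousLinearMap.comp_assoc]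
    have hCs : C.adjoint = C := by simp [hC, ContinuousLinearMap.adjoint_comp]
    have e2 : B.adjoint ∘L A = (Q ∘L B).adjoint ∘L C := by
      conv_lhs => rw [← ContinuousLinearMap.adjoint_adjoint A, ← ContinuousLinearMap.adjoint_comp,
        e1, ContinuousLinearMap.adjoint_comp, hCs]
    -- `D` is the inverse of `C`. It brings `(Q B)* C` into the form `C X` required by `fderiv_det`;
    -- cyclicity of the trace removes it again. Both summands contribute the same trace, and the
    -- resulting `2` cancels against the derivative of the square root.
    set D : E m →L[ℝ] E m := ((C.toContinuousLinearEquivOfDetNeZero hdet.ne').symm :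
      E m →L[ℝ] E m) with hD
    have hCD : C ∘L D = ContinuousLinearMap.id ℝ (E m) := by
      ext1 x
      exact (C.toContinuousLinearEquivOfDetNeZero hdet.ne').apply_symm_apply x
    have e3 : (Q ∘L B).adjoint ∘L C = C ∘L (D ∘L ((Q ∘L B).adjoint ∘L C)) := by
      rw [← ContinuousLinearMap.comp_assoc C D, hCD, ContinuousLinearMap.id_comp]
    have e4 : LinearMap.trace ℝ (E m) (D ∘L ((Q ∘L B).adjoint ∘L C) : E m →L[ℝ] E m) =
        LinearMap.trace ℝ (E m) (Q ∘L B : E m →L[ℝ] E m) := by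
      rw [ContinuousLinearMap.toLinearMap_comp, ← Module.End.mul_eq_comp, LinearMap.trace_mul_comm,
        Module.End.mul_eq_comp, ← ContinuousLinearMap.toLinearMap_comp,
        ContinuousLinearMap.comp_assoc, hCD,
        ContinuousLinearMap.comp_id, trace_adjoint]
    rw [map_add, e2, e3, e1, fderiv_det, fderiv_det, e4]
    ring
  have h4 : HasFDerivAt (fun A : E m →L[ℝ] E n => (A.adjoint ∘L A).det)
      ((fderiv ℝ (fun A : E m →L[ℝ] E m => A.det) C).comp
        (fderiv ℝ (fun A : E m →L[ℝ] E n => A.adjoint ∘L A) A)) A :=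
    HasFDerivAt.comp (g := fun A : E m →L[ℝ] E m => A.det) A
      ((contDiff_det m).differentiable (by simp) C).hasFDerivAt h1
  have h5 := h4.sqrt hdet.ne'
  have h6 : (fun A : E m →L[ℝ] E n => (A : E m →ₗ[ℝ] E n).normDet) =
      fun A => √((A.adjoint ∘L A).det) := by
    ext A; exact normDet_eq_sqrt A
  rw [h6, h5.fderiv, normDet_eq_sqrt]
  simp only [_root_.smul_apply, ContinuousLinearMap.comp_apply, h2, smul_eq_mul]
  rw [h3]
  have hs : √C.det ≠ 0 := (Real.sqrt_pos.mpr hdet).ne'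
  have hss : √C.det * √C.det = C.det := Real.mul_self_sqrt hdet.le
  rw [← hC]
  calc _ = √C.det * √C.det * LinearMap.trace ℝ (E m) (Q ∘L B : E m →L[ℝ] E m) / √C.det := by
        rw [hss]; field_simp
    _ = _ := by field_simp


end NormDetDeriv

end Superform

namespace Superform

/-! ### Orthonormal frames -/

section Frames

variable {n p : ℕ}

/-- An orthonormal family extends to an orthonormal basis by the standard basis of the orthogonal
complement. -/
lemma exists_adapted_basis {N : Fin p → E n} (hN : Orthonormal ℝ N) :
    ∃ b : OrthonormalBasis
      (Fin (Module.finrank ℝ (Submodule.span ℝ (range N))ᗮ) ⊕ Fin p) ℝ (E n),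
      (∀ i, b (Sum.inl i) = stdOrthonormalBasis ℝ (Submodule.span ℝ (range N))ᗮ i) ∧
      ∀ j, b (Sum.inr j) = N j := by
  set T := (Submodule.span ℝ (range N))ᗮ with hT
  set e := stdOrthonormalBasis ℝ T with he
  have horth : ∀ i j, ⟪(e i : E n), N j⟫ = 0 := fun i j =>
    Submodule.inner_left_of_mem_orthogonal (Submodule.subset_span (mem_range_self j)) (e i).2
  have hon : Orthonormal ℝ (Sum.elim (fun i => (e i : E n)) N) := by
    constructor
    · rintro (i | j)
      · exact e.orthonormal.1 i
      · exact hN.1 j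
    · rintro (i | i) (j | j) hij
      · simpa using e.orthonormal.2 (i := i) (j := j) (by simpa using hij)
      · exact horth i j
      · simpa [real_inner_comm] using horth j i
      · exact hN.2 (by simpa using hij)
  have hcard : Fintype.card (Fin (Module.finrank ℝ T) ⊕ Fin p) = Module.finrank ℝ (E n) := by
    have h1 : Module.finrank ℝ (Submodule.span ℝ (range N)) = p := by
      simpa using finrank_span_eq_card hN.linearIndependent
    have h2 := (Submodule.span ℝ (range N)).finrank_add_finrank_orthogonal
    simp only [Fintype.card_sum, Fintype.card_fin]
    rw [hT]
    omega
  have hsp : ⊤ ≤ Submodule.span ℝ (range (Sum.elim (fun i => (e i : E n)) N)) :=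
    (hon.linearIndependent.span_eq_top_of_card_eq_finrank' hcard).ge
  refine ⟨OrthonormalBasis.mk hon hsp, fun i => ?_, fun j => ?_⟩ <;>
    simp [OrthonormalBasis.coe_mk]

/-- The sum of a bilinear form over an orthonormal family only depends on the span of the family. -/
lemma sum_bilin_eq_of_span_eq {F : Type*} [AddCommGroup F] [Module ℝ F] {ι κ : Type*} [Fintype ι]
    [Fintype κ] {N : ι → E n} {N' : κ → E n}
    (hN : Orthonormal ℝ N) (hN' : Orthonormal ℝ N')
    (h : Submodule.span ℝ (range N) = Submodule.span ℝ (range N')) (b : E n →ₗ[ℝ] E n →ₗ[ℝ] F) :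
    ∑ j, b (N j) (N j) = ∑ k, b (N' k) (N' k) := by
  classical
  have key : ∀ {ι : Type _} [Fintype ι] {N : ι → E n}, Orthonormal ℝ N → ∀ v ∈ Submodule.span ℝ (range N),
      v = ∑ j, ⟪N j, v⟫ • N j := by
    intro ι _ N hN v hv
    obtain ⟨c, rfl⟩ := (Submodule.mem_span_range_iff_exists_fun ℝ).mp hv
    exact Finset.sum_congr rfl fun j _ => by rw [hN.inner_right_fintype c j]
  have e1 : ∀ k, N' k = ∑ j, ⟪N j, N' k⟫ • N j := fun k => key hN _ (by
    rw [h]; exact Submodule.subset_span (mem_range_self k))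
  have key' : ∀ v ∈ Submodule.span ℝ (range N'), v = ∑ j, ⟪N' j, v⟫ • N' j := by
    intro v hv
    obtain ⟨c, rfl⟩ := (Submodule.mem_span_range_iff_exists_fun ℝ).mp hv
    exact Finset.sum_congr rfl fun j _ => by rw [hN'.inner_right_fintype c j]
  have e2 : ∀ j, N j = ∑ k, ⟪N' k, N j⟫ • N' k := fun j => key' _ (by
    rw [← h]; exact Submodule.subset_span (mem_range_self j))
  -- Expanding the second argument in `N'` here, and the first argument in `N` in `e4`, leads to the
  -- same double sum.
  have e3 : ∀ j, b (N j) (N j) = ∑ k, ⟪N j, N' k⟫ • b (N j) (N' k) := by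
    intro j
    conv_lhs => rw [e2 j]
    conv_rhs => rw [e2 j]
    simp only [← e2 j]
    conv_lhs => arg 2; rw [e2 j]
    rw [map_sum]
    refine Finset.sum_congr rfl fun k _ => ?_
    rw [map_smul, real_inner_comm]
  have e4 : ∀ k, b (N' k) (N' k) = ∑ j, ⟪N j, N' k⟫ • b (N j) (N' k) := by
    intro k
    have := congrArg (fun v => b v (N' k)) (e1 k)
    simpa [LinearMap.sum_apply] using this
  simp only [e3, e4]
  exact Finset.sum_comm

/-- The trace over the orthogonal complement of an orthonormal family. -/
noncomputable def tanTrace (N : Fin p → E n) (L : E n →L[ℝ] E n) : ℝ :=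
  LinearMap.trace ℝ (E n) L - ∑ j, ⟪L (N j), N j⟫

/-- The chosen basis of the orthogonal complement need not depend continuously on `N`; the full
trace minus the normal part does. The sum form serves to compare with `meanCurvatureCoeff` and to
use that only tangent directions enter. -/
lemma tanTrace_eq_sum {N : Fin p → E n} (hN : Orthonormal ℝ N) (L : E n →L[ℝ] E n) :
    tanTrace N L = ∑ i, ⟪L (stdOrthonormalBasis ℝ (Submodule.span ℝ (range N))ᗮ i : E n),
      (stdOrthonormalBasis ℝ (Submodule.span ℝ (range N))ᗮ i : E n)⟫ := by
  obtain ⟨b, hb1, hb2⟩ := exists_adapted_basis hN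
  rw [tanTrace, LinearMap.trace_eq_sum_inner _ b, Fintype.sum_sum_type]
  simp [hb1, hb2, real_inner_comm]

lemma tanTrace_congr {N N' : Fin p → E n} (hN : Orthonormal ℝ N) (hN' : Orthonormal ℝ N')
    (h : Submodule.span ℝ (range N) = Submodule.span ℝ (range N')) (L : E n →L[ℝ] E n) :
    tanTrace N L = tanTrace N' L := by
  rw [tanTrace, tanTrace]
  congr 1
  exact sum_bilin_eq_of_span_eq hN hN' h
    ((innerₗ (E n)) ∘ₗ (L : E n →ₗ[ℝ] E n))

/-- The orthogonal projection onto the complement of an orthonormal family. -/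
noncomputable def tanProj (N : Fin p → E n) : E n →L[ℝ] E n :=
  ContinuousLinearMap.id ℝ (E n) - ∑ j, (innerSL ℝ (N j)).smulRight (N j)

lemma tanProj_apply (N : Fin p → E n) (v : E n) : tanProj N v = v - ∑ j, ⟪N j, v⟫ • N j := by
  simp [tanProj]

lemma tanProj_of_orthogonal {N : Fin p → E n} {v : E n} (hv : ∀ j, ⟪N j, v⟫ = 0) :
    tanProj N v = v := by
  simp [tanProj_apply, hv]

lemma inner_tanProj {N : Fin p → E n} (hN : Orthonormal ℝ N) (j : Fin p) (v : E n) :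
    ⟪N j, tanProj N v⟫ = 0 := by
  rw [tanProj_apply, inner_sub_right, hN.inner_right_fintype, sub_self]

lemma adjoint_tanProj (N : Fin p → E n) : (tanProj N).adjoint = tanProj N := by
  symm
  rw [ContinuousLinearMap.eq_adjoint_iff]
  intro x y
  simp only [tanProj_apply, inner_sub_left, inner_sub_right, sum_inner, inner_sum, inner_smul_left,
    inner_smul_right, RCLike.conj_to_real]
  congr 1
  exact Finset.sum_congr rfl fun j _ => by rw [real_inner_comm x (N j)]; ring

lemma trace_comp_tanProj (N : Fin p → E n) (L : E n →L[ℝ] E n) :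
    LinearMap.trace ℝ (E n) (L ∘L tanProj N : E n →L[ℝ] E n) = tanTrace N L := by
  have : ((L ∘L tanProj N : E n →L[ℝ] E n) : E n →ₗ[ℝ] E n) =
      (L : E n →ₗ[ℝ] E n) - ∑ j, LinearMap.smulRight (innerₗ (E n) (N j)) (L (N j)) := by
    ext1 x
    simp [tanProj_apply, LinearMap.sum_apply]
  rw [this, map_sub, map_sum, tanTrace]
  congr 1
  refine Finset.sum_congr rfl fun j _ => ?_
  rw [LinearMap.trace_smulRight]
  simp [real_inner_comm]

end Frames

/-! ### Orthonormal defining functions -/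

section Defining

variable {n : ℕ}

lemma contDiffOn_gradient {f : E n → ℝ} {U : Set (E n)} (hU : IsOpen U)
    (hf : ContDiffOn ℝ ∞ f U) : ContDiffOn ℝ ∞ (∇ f) U :=
  (InnerProductSpace.toDual ℝ (E n)).symm.toContinuousLinearEquiv.contDiff.comp_contDiffOn
    (hf.fderiv_of_isOpen hU (by simp))

/-- Gram–Schmidt for defining functions instead of vectors. The coefficients are functions, but
their derivatives are multiplied by functions vanishing on `M`, so on `M` the gradients undergo
ordinary Gram–Schmidt. The change of functions is triangular with nonvanishing diagonal, so the
common zero set is kept. The equality of spans is carried through the induction to show that the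
next vector is nonzero. -/
lemma exists_orthonormal_gradients (M : Set (E n)) (x : E n) :
    ∀ (p : ℕ) (ρ : Fin p → E n → ℝ) (U : Set (E n)), IsOpen U → x ∈ U → x ∈ M →
      (∀ j, ContDiffOn ℝ ∞ (ρ j) U) → (∀ y ∈ M ∩ U, ∀ j, ρ j y = 0) →
      (∀ y ∈ M ∩ U, LinearIndependent ℝ (fun j => ∇ (ρ j) y)) →
      ∃ (ρ' : Fin p → E n → ℝ) (U' : Set (E n)), IsOpen U' ∧ x ∈ U' ∧ U' ⊆ U ∧
        (∀ j, ContDiffOn ℝ ∞ (ρ' j) U') ∧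
        (∀ y ∈ U', (∀ j, ρ j y = 0) ↔ ∀ j, ρ' j y = 0) ∧
        (∀ y ∈ M ∩ U', Orthonormal ℝ (fun j => ∇ (ρ' j) y)) ∧
        ∀ y ∈ M ∩ U', Submodule.span ℝ (range fun j => ∇ (ρ' j) y) =
          Submodule.span ℝ (range fun j => ∇ (ρ j) y) := by
  intro p
  induction p with
  | zero =>
    intro ρ U hU hxU hxM hρ hρ0 hli
    refine ⟨ρ, U, hU, hxU, subset_rfl, hρ, fun y _ => Iff.rfl, fun y _ => ?_, fun y _ => rfl⟩
    exact ⟨fun j => j.elim0, fun j => j.elim0⟩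
  | succ p ih =>
    intro ρ U hU hxU hxM hρ hρ0 hli
    obtain ⟨σ, U₁, hU₁, hxU₁, hU₁U, hσ, hσ0, hσon, hσsp⟩ :=
      ih (fun j => ρ j.castSucc) U hU hxU hxM (fun j => hρ _) (fun y hy j => hρ0 y hy _)
        (fun y hy => (hli y hy).comp _ (Fin.castSucc_injective p))
    set q := ρ (Fin.last p) with hq
    have hqU : ContDiffOn ℝ ∞ q U₁ := (hρ _).mono hU₁U
    set c : Fin p → E n → ℝ := fun i y => ⟪∇ (σ i) y, ∇ q y⟫ with hc
    have hcU : ∀ i, ContDiffOn ℝ ∞ (c i) U₁ := fun i =>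
      (contDiffOn_gradient hU₁ (hσ i)).inner ℝ (contDiffOn_gradient hU₁ hqU)
    set v : E n → E n := fun y => ∇ q y - ∑ i, c i y • ∇ (σ i) y with hv
    have hvU : ContDiffOn ℝ ∞ v U₁ := (contDiffOn_gradient hU₁ hqU).sub
      (ContDiffOn.sum fun i _ => (hcU i).smul (contDiffOn_gradient hU₁ (hσ i)))
    have hvne : ∀ y ∈ M ∩ U₁, v y ≠ 0 := by
      intro y hy h0
      have h1 : ∇ q y ∈ Submodule.span ℝ (range fun j => ∇ (σ j) y) := by
        rw [sub_eq_zero.mp h0]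
        exact Submodule.sum_mem _ fun i _ => Submodule.smul_mem _ _
          (Submodule.subset_span (mem_range_self i))
      rw [hσsp y hy] at h1
      have h2 := (linearIndependent_finSucc'.mp (hli y ⟨hy.1, hU₁U hy.2⟩)).2
      exact h2 h1
    set U₂ := U₁ ∩ v ⁻¹' {0}ᶜ with hU₂
    have hU₂o : IsOpen U₂ := hvU.continuousOn.isOpen_inter_preimage hU₁ isOpen_compl_singleton
    have hU₂U₁ : U₂ ⊆ U₁ := inter_subset_left
    set l : E n → ℝ := fun y => ‖v y‖⁻¹ with hl
    have hlU : ContDiffOn ℝ ∞ l U₂ :=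
      ((hvU.mono hU₂U₁).norm ℝ fun y hy => hy.2).inv fun y hy => norm_ne_zero_iff.mpr hy.2
    set r : E n → ℝ := fun y => q y - ∑ i, c i y * σ i y with hr
    have hrU : ContDiffOn ℝ ∞ r U₁ := hqU.sub (ContDiffOn.sum fun i _ => (hcU i).mul (hσ i))
    set τ : E n → ℝ := fun y => l y * r y with hτ
    have hτU : ContDiffOn ℝ ∞ τ U₂ := hlU.mul (hrU.mono hU₂U₁)
    have hσz : ∀ y ∈ M ∩ U₁, ∀ j, σ j y = 0 := fun y hy =>
      (hσ0 y hy.2).mp fun j => hρ0 y ⟨hy.1, hU₁U hy.2⟩ _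
    have hgrad : ∀ y ∈ M ∩ U₂, ∇ τ y = l y • v y := by
      intro y hy
      have hy1 : y ∈ M ∩ U₁ := ⟨hy.1, hU₂U₁ hy.2⟩
      have hr0 : r y = 0 := by
        simp [hr, hσz y hy1, hq, hρ0 y ⟨hy.1, hU₁U hy1.2⟩]
      have dq := (hqU.contDiffAt (hU₁.mem_nhds hy1.2)).differentiableAt (by simp)
      have dσ := fun i => ((hσ i).contDiffAt (hU₁.mem_nhds hy1.2)).differentiableAt (by simp)
      have dc := fun i => ((hcU i).contDiffAt (hU₁.mem_nhds hy1.2)).differentiableAt (by simp)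
      have dl := (hlU.contDiffAt (hU₂o.mem_nhds hy.2)).differentiableAt (by simp)
      -- The terms containing the derivatives of `c i` drop out because `σ i y = 0`.
      have dr : HasFDerivAt r (fderiv ℝ q y - ∑ i, c i y • fderiv ℝ (σ i) y) y := by
        refine dq.hasFDerivAt.sub ?_
        refine HasFDerivAt.fun_sum fun i _ => ?_
        have := (dc i).hasFDerivAt.mul (dσ i).hasFDerivAt
        rwa [hσz y hy1 i, zero_smul, add_zero] at this
      have dτ := dl.hasFDerivAt.mul dr
      rw [hr0, zero_smul, add_zero] at dτ
      rw [gradient, show fderiv ℝ τ y = _ from dτ.fderiv]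
      simp [hv, gradient, map_sum]
    have hnrm : ∀ y ∈ M ∩ U₂, ‖∇ τ y‖ = 1 := by
      intro y hy
      rw [hgrad y hy, norm_smul, hl, norm_inv, norm_norm,
        inv_mul_cancel₀ (norm_ne_zero_iff.mpr hy.2.2)]
    have horth : ∀ y ∈ M ∩ U₂, ∀ i, ⟪∇ (σ i) y, ∇ τ y⟫ = 0 := by
      intro y hy i
      rw [hgrad y hy, inner_smul_right, hv, inner_sub_right,
        (hσon y ⟨hy.1, hU₂U₁ hy.2⟩).inner_right_fintype, sub_self, mul_zero]
    refine ⟨Fin.snoc σ τ, U₂, hU₂o, ⟨hxU₁, hvne x ⟨hxM, hxU₁⟩⟩, hU₂U₁.trans hU₁U, ?_, ?_, ?_, ?_⟩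
    · intro j
      refine Fin.lastCases ?_ (fun i => ?_) j
      · simpa using hτU
      · simpa using (hσ i).mono hU₂U₁
    · intro y hy
      rw [Fin.forall_fin_succ', Fin.forall_fin_succ', hσ0 y (hU₂U₁ hy)]
      simp only [Fin.snoc_castSucc, Fin.snoc_last]
      refine and_congr_right fun h0 => ?_
      have hl0 : l y ≠ 0 := inv_ne_zero (norm_ne_zero_iff.mpr hy.2)
      simp [hτ, hr, h0, hl0, hq]
    · intro y hy
      have hon := hσon y ⟨hy.1, hU₂U₁ hy.2⟩
      constructor
      · intro j
        refine Fin.lastCases ?_ (fun i => ?_) j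
        · simpa using hnrm y hy
        · simpa using hon.1 i
      · intro i j
        refine Fin.lastCases ?_ (fun i' => ?_) i <;> refine Fin.lastCases ?_ (fun j' => ?_) j
        · simp
        · intro _
          simpa only [Fin.snoc_last, Fin.snoc_castSucc, real_inner_comm] using horth y hy j'
        · intro _
          simpa using horth y hy i'
        · intro hij
          simpa using hon.2 (i := i') (j := j') (by simpa using hij)
    · intro y hy
      have hy1 : y ∈ M ∩ U₁ := ⟨hy.1, hU₂U₁ hy.2⟩
      have e1 : (fun j => ∇ ((Fin.snoc σ τ : Fin (p + 1) → E n → ℝ) j) y) =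
          Fin.snoc (fun j => ∇ (σ j) y) (∇ τ y) := by
        ext1 j
        refine Fin.lastCases ?_ (fun i => ?_) j <;> simp
      have e2 : (fun j => ∇ (ρ j) y) =
          Fin.snoc (fun j : Fin p => ∇ (ρ j.castSucc) y) (∇ q y) := by
        ext1 j
        refine Fin.lastCases ?_ (fun i => ?_) j <;> simp [hq]
      have hrange : ∀ (f : Fin p → E n) (a : E n),
          range (Fin.snoc f a : Fin (p + 1) → E n) = insert a (range f) := by
        intro f a
        ext z
        simp [eq_comm]
      rw [e1, e2, hrange, hrange, Submodule.span_insert, Submodule.span_insert, hσsp y hy1,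
        hgrad y hy]
      have hl0 : l y ≠ 0 := inv_ne_zero (norm_ne_zero_iff.mpr hy.2.2)
      rw [Submodule.span_singleton_smul_eq hl0.isUnit]
      set S := Submodule.span ℝ (range fun j : Fin p => ∇ (ρ j.castSucc) y) with hS
      have hd : ∑ i, c i y • ∇ (σ i) y ∈ S := by
        rw [hS, ← hσsp y hy1]
        exact Submodule.sum_mem _ fun i _ => Submodule.smul_mem _ _
          (Submodule.subset_span (mem_range_self i))
      apply le_antisymm
      · refine sup_le ((Submodule.span_singleton_le_iff_mem _ _).mpr ?_) le_sup_right
        exact Submodule.sub_mem _ (Submodule.mem_sup_left (Submodule.mem_span_singleton_self _))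
          (Submodule.mem_sup_right hd)
      · refine sup_le ((Submodule.span_singleton_le_iff_mem _ _).mpr ?_) le_sup_right
        have : ∇ q y = v y + ∑ i, c i y • ∇ (σ i) y := by simp [hv]
        rw [this]
        exact Submodule.add_mem _ (Submodule.mem_sup_left (Submodule.mem_span_singleton_self _))
          (Submodule.mem_sup_right hd)

variable {m : ℕ} {M : Set (E n)} {x : E n}

lemma IsClosedSubmanifold.exists_isOrthonormalDefining (hM : IsClosedSubmanifold m M)
    (hx : x ∈ M) : ∃ ρ : Fin (n - m) → E n → ℝ, IsOrthonormalDefining M x ρ := by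
  obtain ⟨U, ρ, hU, hxU, hρ, hMU, hli⟩ := hM.exists_defining x hx
  have hz : ∀ y ∈ M ∩ U, ∀ j, ρ j y = 0 := fun y hy => by
    rw [hMU] at hy
    exact hy.2
  obtain ⟨ρ', U', hU', hxU', hU'U, hρ', h0, hon, -⟩ :=
    exists_orthonormal_gradients M x (n - m) ρ U hU hxU hx hρ hz hli
  refine ⟨ρ', U', hU', hxU', hρ', ?_, hon⟩
  ext y
  constructor
  · rintro ⟨hyM, hyU⟩
    exact ⟨hyU, (h0 y hyU).mp (hz y ⟨hyM, hU'U hyU⟩)⟩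
  · rintro ⟨hyU, hy⟩
    have : y ∈ M ∩ U := by
      rw [hMU]
      exact ⟨hU'U hyU, (h0 y hyU).mpr hy⟩
    exact ⟨this.1, hyU⟩

/-- The definition of a submanifold only provides independent gradients; existence after
orthonormalization is what makes the choice in `definingFun` meaningful. -/
lemma IsClosedSubmanifold.isOrthonormalDefining_definingFun (hM : IsClosedSubmanifold m M)
    (hx : x ∈ M) : IsOrthonormalDefining M x (definingFun (n - m) M x) :=
  Classical.epsilon_spec (hM.exists_isOrthonormalDefining hx)

lemma IsClosedSubmanifold.orthonormal_conormal (hM : IsClosedSubmanifold m M) (hx : x ∈ M) :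
    Orthonormal ℝ (conormal m M x) := by
  obtain ⟨U, -, hxU, -, -, h⟩ := hM.isOrthonormalDefining_definingFun hx
  exact h x ⟨hx, hxU⟩

end Defining

end Superform

namespace Superform

/-! ### Local parametrizations -/

section LocalParam

variable {n m : ℕ} {M W : Set (E n)} {O : Set (E m)} {φ : E m → E n} {π : E n →L[ℝ] E m}

/-- `φ : O → M ∩ W` is a parametrization of class `C²` whose inverse is the restriction of the
linear map `π`. -/
structure IsLocalParam (M W : Set (E n)) (O : Set (E m)) (φ : E m → E n) (π : E n →L[ℝ] E m) :
    Prop where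
  isOpen_target : IsOpen W
  isOpen_source : IsOpen O
  contDiffOn : ContDiffOn ℝ 2 φ O
  map_mem : ∀ u ∈ O, φ u ∈ M ∩ W
  left_inv : ∀ u ∈ O, π (φ u) = u
  map_inv_mem : ∀ y ∈ M ∩ W, π y ∈ O
  right_inv : ∀ y ∈ M ∩ W, φ (π y) = y

/-- The inverse function theorem is applied to `y ↦ (π y, ρ y)`, where `π` is the orthogonal
projection onto the tangent space at `x` in orthonormal coordinates. A vector killed by its
differential is tangent, as the `dρ_j` vanish on it, and has zero tangential projection. The
parametrization is the slice `ρ = 0` of the local inverse, a graph over the tangent space; this is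
why its inverse is linear. -/
lemma IsClosedSubmanifold.exists_isLocalParam (hM : IsClosedSubmanifold m M) {x : E n}
    (hx : x ∈ M) : ∃ (W : Set (E n)) (O : Set (E m)) (φ : E m → E n) (π : E n →L[ℝ] E m),
      x ∈ W ∧ IsLocalParam M W O φ π := by
  obtain ⟨ρ, U, hU, hxU, hρ, hMU, hon⟩ := hM.exists_isOrthonormalDefining hx
  set N : Fin (n - m) → E n := fun j => ∇ (ρ j) x with hN
  have hNon : Orthonormal ℝ N := hon x ⟨hx, hxU⟩
  set T := (Submodule.span ℝ (range N))ᗮ with hT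
  have hfin : Module.finrank ℝ T = m := by
    have h1 : Module.finrank ℝ (Submodule.span ℝ (range N)) = n - m := by
      simpa using finrank_span_eq_card hNon.linearIndependent
    have h2 := (Submodule.span ℝ (range N)).finrank_add_finrank_orthogonal
    have h3 := hM.dim_le
    simp only [finrank_euclideanSpace_fin] at h2
    rw [hT]; omega
  let iso : T ≃ₗᵢ[ℝ] E m := ((stdOrthonormalBasis ℝ T).reindex (finCongr hfin)).repr
  let π : E n →L[ℝ] E m :=
    (iso.toContinuousLinearEquiv : T →L[ℝ] E m) ∘L T.orthogonalProjectionOnto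
  let Ψ : E n → E m × (Fin (n - m) → ℝ) := fun y => (π y, fun j => ρ j y)
  let Ψ' : E n →L[ℝ] E m × (Fin (n - m) → ℝ) :=
    π.prod (ContinuousLinearMap.pi fun j => fderiv ℝ (ρ j) x)
  have hρx : ∀ j, ContDiffAt ℝ ∞ (ρ j) x := fun j => (hρ j).contDiffAt (hU.mem_nhds hxU)
  have hΨs : ContDiffAt ℝ 2 Ψ x :=
    π.contDiff.contDiffAt.prodMk (contDiffAt_pi.mpr fun j => (hρx j).of_le (by norm_cast))
  have hΨd : HasFDerivAt Ψ Ψ' x :=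
    π.hasFDerivAt.prodMk (hasFDerivAt_pi.mpr fun j =>
      ((hρx j).differentiableAt (by simp)).hasFDerivAt)
  have hinj : Function.Injective Ψ' := by
    rw [← ContinuousLinearMap.coe_coe, ← LinearMap.ker_eq_bot, LinearMap.ker_eq_bot']
    intro v hv
    have hv1 : π v = 0 := congrArg Prod.fst hv
    have hv2 : ∀ j, ⟪N j, v⟫ = 0 := fun j => by
      have := congrFun (congrArg Prod.snd hv) j
      rw [hN, inner_gradient_left]
      exact this
    have hvT : v ∈ T := by
      rw [hT, Submodule.mem_orthogonal]
      intro w hw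
      induction hw using Submodule.span_induction with
      | mem w hw => obtain ⟨j, rfl⟩ := hw; exact hv2 j
      | zero => simp
      | add a b _ _ ha hb => rw [inner_add_left, ha, hb, add_zero]
      | smul c a _ ha => rw [inner_smul_left, ha, mul_zero]
    have h3 : T.orthogonalProjectionOnto v = 0 := iso.map_eq_zero_iff.mp hv1
    have h4 := Submodule.orthogonalProjectionOnto_mem_subspace_eq_self (K := T) ⟨v, hvT⟩
    rw [h3] at h4
    exact (congrArg Subtype.val h4).symm
  have hdim : Module.finrank ℝ (E n) = Module.finrank ℝ (E m × (Fin (n - m) → ℝ)) := by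
    have := hM.dim_le
    simp
    omega
  let Ψe : E n ≃L[ℝ] E m × (Fin (n - m) → ℝ) :=
    (LinearEquiv.ofInjectiveOfFinrankEq (Ψ' : E n →ₗ[ℝ] _) hinj hdim).toContinuousLinearEquiv
  have hΨe : HasFDerivAt Ψ (Ψe : E n →L[ℝ] E m × (Fin (n - m) → ℝ)) x := by
    have : (Ψe : E n →L[ℝ] E m × (Fin (n - m) → ℝ)) = Ψ' := by
      ext1 v
      rfl
    rw [this]
    exact hΨd
  set e := hΨs.toOpenPartialHomeomorph Ψ hΨe two_ne_zero with he
  have hxs : x ∈ e.source := hΨs.mem_toOpenPartialHomeomorph_source hΨe two_ne_zero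
  have heΨ : ∀ y, e y = Ψ y := fun y => rfl
  have hΨx : Ψ x = (π x, 0) := by
    have : x ∈ M ∩ U := ⟨hx, hxU⟩
    rw [hMU] at this
    exact Prod.ext rfl (funext this.2)
  let φ : E m → E n := fun u => e.symm (u, 0)
  have hι : Continuous fun u : E m => (u, (0 : Fin (n - m) → ℝ)) := by fun_prop
  have hφx : ContDiffAt ℝ 2 φ (π x) := by
    have h1 : ContDiffAt ℝ 2 e.symm (π x, 0) := by
      rw [← hΨx]; exact hΨs.to_localInverse hΨe two_ne_zero
    exact h1.comp (π x) (contDiff_id.prodMk contDiff_const).contDiffAt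
  have hxt : (π x, (0 : Fin (n - m) → ℝ)) ∈ e.target := by
    rw [← hΨx]; exact e.map_source hxs
  have hsymm : e.symm (π x, 0) = x := by
    rw [← hΨx]; exact e.left_inv hxs
  have ev1 : ∀ᶠ u in 𝓝 (π x), (u, (0 : Fin (n - m) → ℝ)) ∈ e.target :=
    hι.continuousAt.eventually (e.open_target.mem_nhds hxt)
  have ev2 : ∀ᶠ u in 𝓝 (π x), φ u ∈ U :=
    hφx.continuousAt.eventually (hU.mem_nhds (by change e.symm (π x, 0) ∈ U; rwa [hsymm]))
  have ev3 : ∀ᶠ u in 𝓝 (π x), ContDiffAt ℝ 2 φ u := hφx.eventually (by simp)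
  obtain ⟨O, hOev, hO, hxO⟩ := eventually_nhds_iff.mp (ev1.and (ev2.and ev3))
  have hright : ∀ u ∈ O, Ψ (φ u) = (u, 0) := fun u hu => e.right_inv (hOev u hu).1
  -- Intersecting with `π ⁻¹' O` ensures that `π` sends `M ∩ W` back into the shrunken domain `O`.
  refine ⟨e.source ∩ U ∩ π ⁻¹' O, O, φ, π, ⟨⟨hxs, hxU⟩, hxO⟩,
    ⟨(e.open_source.inter hU).inter (hO.preimage π.continuous), hO,
      fun u hu => (hOev u hu).2.2.contDiffWithinAt, ?_, ?_, ?_, ?_⟩⟩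
  · intro u hu
    have h1 := hright u hu
    have h2 : φ u ∈ M ∩ U := by
      rw [hMU]
      exact ⟨(hOev u hu).2.1, fun j => congrFun (congrArg Prod.snd h1) j⟩
    refine ⟨h2.1, ⟨e.map_target (hOev u hu).1, h2.2⟩, ?_⟩
    rw [mem_preimage, show π (φ u) = u from congrArg Prod.fst h1]
    exact hu
  · intro u hu
    exact congrArg Prod.fst (hright u hu)
  · rintro y ⟨-, -, hy⟩
    exact hy
  · rintro y ⟨hyM, ⟨hys, hyU⟩, hyO⟩
    have h0 : y ∈ M ∩ U := ⟨hyM, hyU⟩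
    rw [hMU] at h0
    have h1 : e y = (π y, 0) := Prod.ext rfl (funext h0.2)
    change e.symm (π y, 0) = y
    rw [← h1]
    exact e.left_inv hys

namespace IsLocalParam

variable (h : IsLocalParam M W O φ π)
include h

lemma contDiffAt {u : E m} (hu : u ∈ O) : ContDiffAt ℝ 2 φ u :=
  h.contDiffOn.contDiffAt (h.isOpen_source.mem_nhds hu)

lemma hasFDerivAt {u : E m} (hu : u ∈ O) : HasFDerivAt φ (fderiv ℝ φ u) u :=
  ((h.contDiffAt hu).differentiableAt (by simp)).hasFDerivAt

lemma comp_fderiv {u : E m} (hu : u ∈ O) :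
    π ∘L fderiv ℝ φ u = ContinuousLinearMap.id ℝ (E m) := by
  have h1 : HasFDerivAt (fun v => π (φ v)) (π ∘L fderiv ℝ φ u) u :=
    π.hasFDerivAt.comp u (h.hasFDerivAt hu)
  have h2 : HasFDerivAt (fun v => π (φ v)) (ContinuousLinearMap.id ℝ (E m)) u :=
    (hasFDerivAt_id u).congr_of_eventuallyEq
      ((h.isOpen_source.eventually_mem hu).mono fun v hv => h.left_inv v hv)
  exact h1.unique h2

lemma fderiv_injective {u : E m} (hu : u ∈ O) : Function.Injective (fderiv ℝ φ u) := by
  intro v w hvw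
  have := congrArg π hvw
  simpa [← ContinuousLinearMap.comp_apply, h.comp_fderiv hu] using this

lemma injOn : InjOn φ O := fun u hu v hv huv => by
  rw [← h.left_inv u hu, huv, h.left_inv v hv]

lemma image_eq : φ '' O = M ∩ W := by
  ext y
  constructor
  · rintro ⟨u, hu, rfl⟩
    exact h.map_mem u hu
  · intro hy
    exact ⟨π y, h.map_inv_mem y hy, h.right_inv y hy⟩

lemma inner_gradient_fderiv {u : E m} (hu : u ∈ O) {f : E n → ℝ}
    (hf : DifferentiableAt ℝ f (φ u)) (hf0 : ∀ᶠ y in 𝓝 (φ u), y ∈ M → f y = 0) (v : E m) :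
    ⟪∇ f (φ u), fderiv ℝ φ u v⟫ = 0 := by
  have h1 : HasFDerivAt (fun w => f (φ w)) (fderiv ℝ f (φ u) ∘L fderiv ℝ φ u) u :=
    hf.hasFDerivAt.comp u (h.hasFDerivAt hu)
  have h2 : HasFDerivAt (fun w => f (φ w)) (0 : E m →L[ℝ] ℝ) u := by
    refine (hasFDerivAt_const (0 : ℝ) u).congr_of_eventuallyEq ?_
    filter_upwards [(h.contDiffAt hu).continuousAt.eventually hf0, h.isOpen_source.eventually_mem hu]
      with w hw hwO
    exact hw (h.map_mem w hwO).1
  rw [inner_gradient_left]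
  exact congrArg (fun L => L v) (h1.unique h2)

/-- The range of the differential of a parametrization is the tangent space. -/
lemma range_fderiv {u : E m} (hu : u ∈ O) (hmn : m ≤ n) {N : Fin (n - m) → E n}
    (hN : LinearIndependent ℝ N) (hNφ : ∀ j v, ⟪N j, fderiv ℝ φ u v⟫ = 0) :
    LinearMap.range (fderiv ℝ φ u : E m →ₗ[ℝ] E n) = (Submodule.span ℝ (range N))ᗮ := by
  apply Submodule.eq_of_le_of_finrank_eq
  · rintro _ ⟨v, rfl⟩
    rw [Submodule.mem_orthogonal]
    intro w hw
    induction hw using Submodule.span_induction with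
    | mem w hw => obtain ⟨j, rfl⟩ := hw; exact hNφ j v
    | zero => simp
    | add a b _ _ ha hb => rw [inner_add_left, ha, hb, add_zero]
    | smul c a _ ha => rw [inner_smul_left, ha, mul_zero]
  · rw [LinearMap.finrank_range_of_inj (h.fderiv_injective hu)]
    have h1 : Module.finrank ℝ (Submodule.span ℝ (range N)) = n - m := by
      simpa using finrank_span_eq_card hN
    have h2 := (Submodule.span ℝ (range N)).finrank_add_finrank_orthogonal
    simp only [finrank_euclideanSpace_fin] at h2 ⊢
    omega

end IsLocalParam

/-- The normal space does not depend on the choice of the defining functions. -/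
lemma IsClosedSubmanifold.span_gradient_eq (hM : IsClosedSubmanifold m M) {y : E n} (hy : y ∈ M)
    {ρ σ : Fin (n - m) → E n → ℝ} (hρ : ∀ j, DifferentiableAt ℝ (ρ j) y)
    (hσ : ∀ j, DifferentiableAt ℝ (σ j) y) (hρ0 : ∀ j, ∀ᶠ z in 𝓝 y, z ∈ M → ρ j z = 0)
    (hσ0 : ∀ j, ∀ᶠ z in 𝓝 y, z ∈ M → σ j z = 0)
    (hρl : LinearIndependent ℝ fun j => ∇ (ρ j) y) (hσl : LinearIndependent ℝ fun j => ∇ (σ j) y) :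
    Submodule.span ℝ (range fun j => ∇ (ρ j) y) = Submodule.span ℝ (range fun j => ∇ (σ j) y) := by
  obtain ⟨W, O, φ, π, hyW, h⟩ := hM.exists_isLocalParam hy
  have hu : π y ∈ O := h.map_inv_mem y ⟨hy, hyW⟩
  have hφ : φ (π y) = y := h.right_inv y ⟨hy, hyW⟩
  have h1 := h.range_fderiv hu hM.dim_le hρl fun j v => by
    have := h.inner_gradient_fderiv hu (f := ρ j) (hφ.symm ▸ hρ j) (hφ.symm ▸ hρ0 j) v
    rwa [hφ] at this
  have h2 := h.range_fderiv hu hM.dim_le hσl fun j v => by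
    have := h.inner_gradient_fderiv hu (f := σ j) (hφ.symm ▸ hσ j) (hφ.symm ▸ hσ0 j) v
    rwa [hφ] at this
  rw [← Submodule.orthogonal_orthogonal (Submodule.span ℝ (range fun j => ∇ (ρ j) y)),
    ← Submodule.orthogonal_orthogonal (Submodule.span ℝ (range fun j => ∇ (σ j) y)), ← h1, ← h2]

/-- A smooth orthonormal frame of the normal bundle of `M` over the open set `U`. -/
structure IsNormalFrame (m : ℕ) (M U : Set (E n)) (N : Fin (n - m) → E n → E n) : Prop where
  isOpen : IsOpen U
  contDiffOn : ∀ j, ContDiffOn ℝ ∞ (N j) U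
  orthonormal : ∀ y ∈ M ∩ U, Orthonormal ℝ fun j => N j y
  span_eq : ∀ y ∈ M ∩ U, Submodule.span ℝ (range fun j => N j y) =
    Submodule.span ℝ (range (conormal m M y))

/-- `conormal` is chosen independently at every point and has no reason to be continuous. The
gradients of one fixed system of defining functions are smooth and span the same normal spaces, so
statements depending only on the normal space can be checked on them. -/
lemma IsOrthonormalDefining.isNormalFrame (hM : IsClosedSubmanifold m M) {x : E n}
    {ρ : Fin (n - m) → E n → ℝ} (hρ : IsOrthonormalDefining M x ρ) :
    ∃ U, x ∈ U ∧ IsNormalFrame m M U fun j => ∇ (ρ j) := by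
  obtain ⟨U, hU, hxU, hρ, hMU, hon⟩ := hρ
  refine ⟨U, hxU, hU, fun j => contDiffOn_gradient hU (hρ j), hon, ?_⟩
  rintro y ⟨hyM, hyU⟩
  obtain ⟨V, hV, hyV, hσ, hMV, hσon⟩ := hM.isOrthonormalDefining_definingFun hyM
  refine hM.span_gradient_eq hyM
    (fun j => ((hρ j).contDiffAt (hU.mem_nhds hyU)).differentiableAt (by simp))
    (fun j => ((hσ j).contDiffAt (hV.mem_nhds hyV)).differentiableAt (by simp)) (fun j => ?_)
    (fun j => ?_) (hon y ⟨hyM, hyU⟩).linearIndependent (hσon y ⟨hyM, hyV⟩).linearIndependent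
  · filter_upwards [hU.mem_nhds hyU] with z hz hzM
    have : z ∈ M ∩ U := ⟨hzM, hz⟩
    rw [hMU] at this
    exact this.2 j
  · filter_upwards [hV.mem_nhds hyV] with z hz hzM
    have : z ∈ M ∩ V := ⟨hzM, hz⟩
    rw [hMV] at this
    exact this.2 j

lemma IsClosedSubmanifold.exists_isNormalFrame (hM : IsClosedSubmanifold m M) {x : E n}
    (hx : x ∈ M) : ∃ U, x ∈ U ∧ IsNormalFrame m M U fun j => ∇ (definingFun (n - m) M x j) :=
  (hM.isOrthonormalDefining_definingFun hx).isNormalFrame hM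

lemma IsClosedSubmanifold.inner_conormal_fderiv (hM : IsClosedSubmanifold m M)
    (h : IsLocalParam M W O φ π) {u : E m} (hu : u ∈ O) (j : Fin (n - m)) (v : E m) :
    ⟪conormal m M (φ u) j, fderiv ℝ φ u v⟫ = 0 := by
  obtain ⟨V, hV, hyV, hσ, hMV, -⟩ := hM.isOrthonormalDefining_definingFun (h.map_mem u hu).1
  refine h.inner_gradient_fderiv hu
    (((hσ j).contDiffAt (hV.mem_nhds hyV)).differentiableAt (by simp)) ?_ v
  filter_upwards [hV.mem_nhds hyV] with z hz hzM
  have : z ∈ M ∩ V := ⟨hzM, hz⟩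
  rw [hMV] at this
  exact this.2 j

lemma IsClosedSubmanifold.range_fderiv (hM : IsClosedSubmanifold m M)
    (h : IsLocalParam M W O φ π) {u : E m} (hu : u ∈ O) :
    LinearMap.range (fderiv ℝ φ u : E m →ₗ[ℝ] E n) = tangentSpace m M (φ u) :=
  h.range_fderiv hu hM.dim_le (hM.orthonormal_conormal (h.map_mem u hu).1).linearIndependent
    (hM.inner_conormal_fderiv h hu)

end LocalParam

end Superform

namespace Superform

/-! ### Tangential derivatives and mean curvature -/

section Tangential

variable {n m : ℕ} {M W : Set (E n)} {O : Set (E m)} {φ : E m → E n} {π : E n →L[ℝ] E m}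

lemma IsLocalParam.fderiv_comp_eq (h : IsLocalParam M W O φ π) {F : Type*} [NormedAddCommGroup F]
    [NormedSpace ℝ F] {f g : E n → F} {u : E m} (hu : u ∈ O)
    (hf : DifferentiableAt ℝ f (φ u)) (hg : DifferentiableAt ℝ g (φ u))
    (hfg : ∀ᶠ y in 𝓝 (φ u), y ∈ M → f y = g y) :
    fderiv ℝ f (φ u) ∘L fderiv ℝ φ u = fderiv ℝ g (φ u) ∘L fderiv ℝ φ u := by
  have h1 : HasFDerivAt (fun w => f (φ w)) (fderiv ℝ f (φ u) ∘L fderiv ℝ φ u) u :=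
    hf.hasFDerivAt.comp u (h.hasFDerivAt hu)
  have h2 : HasFDerivAt (fun w => g (φ w)) (fderiv ℝ g (φ u) ∘L fderiv ℝ φ u) u :=
    hg.hasFDerivAt.comp u (h.hasFDerivAt hu)
  refine h1.unique (h2.congr_of_eventuallyEq ?_)
  filter_upwards [(h.contDiffAt hu).continuousAt.eventually hfg, h.isOpen_source.eventually_mem hu]
    with w hw hwO
  exact hw (h.map_mem w hwO).1

/-- Derivatives in tangent directions only depend on the values on the submanifold. -/
lemma IsClosedSubmanifold.fderiv_apply_eq (hM : IsClosedSubmanifold m M) {x : E n} (hx : x ∈ M)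
    {F : Type*} [NormedAddCommGroup F] [NormedSpace ℝ F] {f g : E n → F}
    (hf : DifferentiableAt ℝ f x) (hg : DifferentiableAt ℝ g x)
    (hfg : ∀ᶠ y in 𝓝 x, y ∈ M → f y = g y) {e : E n} (he : e ∈ tangentSpace m M x) :
    fderiv ℝ f x e = fderiv ℝ g x e := by
  obtain ⟨W, O, φ, π, hxW, h⟩ := hM.exists_isLocalParam hx
  have hu : π x ∈ O := h.map_inv_mem x ⟨hx, hxW⟩
  have hφ : φ (π x) = x := h.right_inv x ⟨hx, hxW⟩
  rw [← hφ, ← hM.range_fderiv h hu] at he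
  obtain ⟨v, rfl⟩ := he
  have h1 := h.fderiv_comp_eq hu (f := f) (g := g) (by rwa [hφ]) (by rwa [hφ]) (by rwa [hφ])
  rw [hφ] at h1
  exact congrArg (fun L => L v) h1

/-- The tangential divergence of a normal field is its scalar product with the mean curvature
vector. -/
lemma IsClosedSubmanifold.tanTrace_fderiv_of_normal (hM : IsClosedSubmanifold m M) {x : E n}
    (hx : x ∈ M) {X : E n → E n} (hX : DifferentiableAt ℝ X x)
    (hXn : ∀ᶠ y in 𝓝 x, y ∈ M → X y ∈ Submodule.span ℝ (range (conormal m M y))) :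
    tanTrace (conormal m M x) (fderiv ℝ X x) = ⟪X x, meanCurvature m M x⟫ := by
  have hNx := hM.orthonormal_conormal hx
  obtain ⟨U, hxU, hU⟩ := hM.exists_isNormalFrame hx
  set N : Fin (n - m) → E n → E n := fun j => ∇ (definingFun (n - m) M x j) with hN
  have hNc : ∀ j, N j x = conormal m M x j := fun j => rfl
  have dN : ∀ j, DifferentiableAt ℝ (N j) x := fun j =>
    ((hU.contDiffOn j).contDiffAt (hU.isOpen.mem_nhds hxU)).differentiableAt (by simp)
  -- `G` agrees with `X` on `M` near `x`, hence has the same tangential derivatives. When `G` is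
  -- differentiated, the derivatives of the coefficients multiply normal vectors and disappear after
  -- pairing with tangent vectors. The frame comes from the defining functions chosen at `x` itself,
  -- so the remaining traces are literally the `meanCurvatureCoeff`.
  set G : E n → E n := fun y => ∑ j, ⟪N j y, X y⟫ • N j y with hG
  have dh : ∀ j, DifferentiableAt ℝ (fun y => ⟪N j y, X y⟫) x := fun j => (dN j).inner ℝ hX
  have hGd : HasFDerivAt G (∑ j, (⟪N j x, X x⟫ • fderiv ℝ (N j) x +
      (fderiv ℝ (fun y => ⟪N j y, X y⟫) x).smulRight (N j x))) x :=
    HasFDerivAt.fun_sum fun j _ => (dh j).hasFDerivAt.smul (dN j).hasFDerivAt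
  have hXG : ∀ᶠ y in 𝓝 x, y ∈ M → X y = G y := by
    filter_upwards [hXn, hU.isOpen.mem_nhds hxU] with y hy hyU hyM
    have hon := hU.orthonormal y ⟨hyM, hyU⟩
    have hmem := hy hyM
    rw [← hU.span_eq y ⟨hyM, hyU⟩] at hmem
    obtain ⟨c, hc⟩ := (Submodule.mem_span_range_iff_exists_fun ℝ).mp hmem
    rw [hG]
    simp only
    rw [← hc]
    exact Finset.sum_congr rfl fun j _ => by rw [hon.inner_right_fintype c j]
  have key : tanTrace (conormal m M x) (fderiv ℝ X x) =
      tanTrace (conormal m M x) (fderiv ℝ G x) := by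
    rw [tanTrace_eq_sum hNx, tanTrace_eq_sum hNx]
    refine Finset.sum_congr rfl fun i _ => ?_
    congr 1
    exact hM.fderiv_apply_eq hx hX hGd.differentiableAt hXG (Subtype.prop _)
  have hperp : ∀ i j, ⟪N j x,
      (stdOrthonormalBasis ℝ (Submodule.span ℝ (range (conormal m M x)))ᗮ i : E n)⟫ = 0 :=
    fun i j => Submodule.inner_right_of_mem_orthogonal
      (Submodule.subset_span (mem_range_self j)) (Subtype.prop _)
  rw [key, tanTrace_eq_sum hNx, hGd.fderiv, meanCurvature, inner_sum]
  simp only [_root_.sum_apply, _root_.add_apply, _root_.smul_apply,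
    ContinuousLinearMap.smulRight_apply, sum_inner, inner_add_left, inner_smul_left, hperp,
    mul_zero, add_zero, RCLike.conj_to_real]
  rw [Finset.sum_comm]
  refine Finset.sum_congr rfl fun j _ => ?_
  rw [inner_smul_right, meanCurvatureCoeff, ← Finset.mul_sum, mul_comm, hNc, real_inner_comm]
  rfl

lemma IsClosedSubmanifold.continuousOn_tanTrace (hM : IsClosedSubmanifold m M)
    {L : E n → E n →L[ℝ] E n} (hL : ContinuousOn L M) :
    ContinuousOn (fun y => tanTrace (conormal m M y) (L y)) M := by
  intro x hx
  obtain ⟨U, hxU, hU⟩ := hM.exists_isNormalFrame hx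
  set N : Fin (n - m) → E n → E n := fun j => ∇ (definingFun (n - m) M x j) with hN
  have h1 : ContinuousWithinAt (fun y => tanTrace (fun j => N j y) (L y)) M x := by
    have hNx : ∀ j, ContinuousWithinAt (N j) M x := fun j =>
      (((hU.contDiffOn j).contDiffAt (hU.isOpen.mem_nhds hxU)).continuousAt).continuousWithinAt
    refine ContinuousWithinAt.sub ?_ (tendsto_finsetSum _ fun j _ =>
      ((hL x hx).clm_apply (hNx j)).inner (hNx j))
    have : Continuous fun A : E n →L[ℝ] E n => LinearMap.trace ℝ (E n) A :=
      LinearMap.continuous_of_finiteDimensional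
        (LinearMap.trace ℝ (E n) ∘ₗ ContinuousLinearMap.coeLM ℝ)
    exact this.continuousAt.comp_continuousWithinAt (hL x hx)
  have heq : ∀ y ∈ M ∩ U, tanTrace (conormal m M y) (L y) = tanTrace (fun j => N j y) (L y) :=
    fun y hy => (tanTrace_congr (hU.orthonormal y hy) (hM.orthonormal_conormal hy.1)
      (hU.span_eq y hy) _).symm
  refine h1.congr_of_eventuallyEq ?_ (heq x ⟨hx, hxU⟩)
  filter_upwards [self_mem_nhdsWithin, mem_nhdsWithin_of_mem_nhds (hU.isOpen.mem_nhds hxU)]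
    with y hyM hyU
  exact heq y ⟨hyM, hyU⟩

lemma IsLocalParam.measurableSet_inter (h : IsLocalParam M W O φ π) (hM : IsClosed M) :
    MeasurableSet (M ∩ W) :=
  hM.measurableSet.inter h.isOpen_target.measurableSet

lemma IsLocalParam.contDiffOn_one (h : IsLocalParam M W O φ π) : ContDiffOn ℝ 1 φ O :=
  h.contDiffOn.of_le (by norm_num)

/-- Near a point of `M` the area formula bounds the measure by the integral of a continuous function
over a compact parameter set. Off `M` closedness provides an open null neighbourhood. -/
lemma IsClosedSubmanifold.isLocallyFiniteMeasure (hM : IsClosedSubmanifold m M) :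
    IsLocallyFiniteMeasure (μHE[m].restrict M) := by
  refine ⟨fun x => ?_⟩
  by_cases hx : x ∈ M
  · obtain ⟨W, O, φ, π, hxW, h⟩ := hM.exists_isLocalParam hx
    have hu : π x ∈ O := h.map_inv_mem x ⟨hx, hxW⟩
    obtain ⟨K, hK, hKu, hKO⟩ := exists_compact_subset h.isOpen_source hu
    refine ⟨W ∩ π ⁻¹' interior K, inter_mem (h.isOpen_target.mem_nhds hxW)
      ((isOpen_interior.preimage π.continuous).mem_nhds hKu), ?_⟩
    rw [Measure.restrict_apply' hM.isClosed.measurableSet]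
    have hsub : W ∩ π ⁻¹' interior K ∩ M ⊆ φ '' K := by
      rintro y ⟨⟨hyW, hyK⟩, hyM⟩
      exact ⟨π y, interior_subset hyK, h.right_inv y ⟨hyM, hyW⟩⟩
    refine (measure_mono hsub).trans_lt ?_
    rw [euclideanHausdorffMeasure_image_eq h.isOpen_source h.contDiffOn_one
      (fun u hu => h.fderiv_injective (hKO hu)) hK.measurableSet hKO (h.injOn.mono hKO)]
    have hc : ContinuousOn (fun u => (fderiv ℝ φ u : E m →ₗ[ℝ] E n).normDet) K :=
      (continuous_normDet m n).comp_continuousOn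
        ((h.contDiffOn_one.continuousOn_fderiv_of_isOpen h.isOpen_source le_rfl).mono hKO)
    exact (hc.integrableOn_compact hK).lintegral_lt_top
  · refine ⟨Mᶜ, hM.isClosed.isOpen_compl.mem_nhds hx, ?_⟩
    rw [Measure.restrict_apply' hM.isClosed.measurableSet]
    simp

lemma IsClosedSubmanifold.locallyIntegrable (hM : IsClosedSubmanifold m M) {F : Type*}
    [NormedAddCommGroup F] {f : E n → F} (hf : ContinuousOn f M) :
    LocallyIntegrable f (μHE[m].restrict M) := by
  have := hM.isLocallyFiniteMeasure
  rw [← locallyIntegrableOn_univ]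
  have h1 : ∀ x, IntegrableAtFilter f (𝓝 x) (μHE[m].restrict M) := by
    intro x
    obtain ⟨K, hK, hxK⟩ := exists_compact_mem_nhds x
    refine ⟨K, hxK, ?_⟩
    rw [IntegrableOn, Measure.restrict_restrict hK.measurableSet]
    have hKM : IsCompact (K ∩ M) := hK.inter_right hM.isClosed
    have hfin : IsFiniteMeasure (μHE[m].restrict (K ∩ M) : Measure (E n)) := by
      rw [← Measure.restrict_restrict hK.measurableSet]
      exact ⟨by rw [Measure.restrict_apply_univ]; exact hK.measure_lt_top⟩
    obtain ⟨C, hC⟩ := hKM.exists_bound_of_continuousOn (hf.mono inter_subset_right)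
    refine Integrable.of_bound ((hf.mono inter_subset_right).aestronglyMeasurable_of_isCompact hKM
      hKM.measurableSet) C ?_
    exact (ae_restrict_mem hKM.measurableSet).mono fun y hy => hC y hy
  exact (locallyIntegrableOn_univ).mpr h1

lemma IsClosedSubmanifold.integrable (hM : IsClosedSubmanifold m M) {F : Type*}
    [NormedAddCommGroup F] {f : E n → F} (hf : ContinuousOn f M)
    (hfc : HasCompactSupport f) : Integrable f (μHE[m].restrict M) := by
  have h := hM.locallyIntegrable hf
  rw [← integrableOn_iff_integrable_of_support_subset (subset_tsupport f)]
  exact h.integrableOn_isCompact hfc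

end Tangential

end Superform

namespace Superform

/-! ### The divergence theorem on a submanifold -/

section Divergence

variable {n m : ℕ} {M W : Set (E n)} {O : Set (E m)} {φ : E m → E n} {π : E n →L[ℝ] E m}

lemma integral_trace_fderiv_eq_zero {G : E m → E m} (hG : ContDiff ℝ 1 G)
    (hGc : HasCompactSupport G) :
    ∫ u, LinearMap.trace ℝ (E m) (fderiv ℝ G u : E m →L[ℝ] E m) = 0 := by
  have hdc : HasCompactSupport (fderiv ℝ G) := hGc.fderiv ℝ
  have hd : Continuous (fderiv ℝ G) := hG.continuous_fderiv one_ne_zero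
  set b := EuclideanSpace.basisFun (Fin m) ℝ
  have hint : ∀ i, Integrable (fun u => ⟪b i, fderiv ℝ G u (b i)⟫) volume := fun i => by
    refine Continuous.integrable_of_hasCompactSupport (by fun_prop) ?_
    exact hdc.comp_left (g := fun A : E m →L[ℝ] E m => ⟪b i, A (b i)⟫) (by simp)
  simp_rw [LinearMap.trace_eq_sum_inner _ b]
  simp only [ContinuousLinearMap.coe_coe]
  rw [integral_finsetSum _ fun i _ => hint i]
  refine Finset.sum_eq_zero fun i _ => ?_
  -- Integration by parts against the constant field `b i`, whose derivative is zero.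
  have h := integral_bilinear_hasFDerivAt_right_eq_neg_left_of_integrable (μ := volume)
    (B := (innerSL ℝ : E m →L[ℝ] E m →L[ℝ] ℝ)) (f := fun _ : E m => b i) (f' := fun _ => 0) (g := G)
    (g' := fderiv ℝ G) (v := b i) (by simp) (hint i) (by
      refine Continuous.integrable_of_hasCompactSupport ?_ ?_
      · exact (continuous_const.inner hG.continuous)
      · exact hGc.comp_left (g := fun v => ⟪b i, v⟫) (by simp))
    (fun u _ => hasFDerivAt_const _ _) (fun u _ => (hG.differentiable one_ne_zero u).hasFDerivAt)
  have h' : ∫ u, ⟪b i, fderiv ℝ G u (b i)⟫ = -∫ u, ⟪(0 : E m), G u⟫ := h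
  rw [h']
  simp

lemma IsClosedSubmanifold.tanProj_comp_fderiv (hM : IsClosedSubmanifold m M)
    (h : IsLocalParam M W O φ π) {u : E m} (hu : u ∈ O) :
    tanProj (conormal m M (φ u)) ∘L fderiv ℝ φ u = fderiv ℝ φ u := by
  ext1 v
  exact tanProj_of_orthogonal fun j => hM.inner_conormal_fderiv h hu j v

/-- `Dφ ∘ π` is the identity on tangent vectors. -/
lemma IsClosedSubmanifold.fderiv_apply_proj (hM : IsClosedSubmanifold m M)
    (h : IsLocalParam M W O φ π) {u : E m} (hu : u ∈ O) {v : E n}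
    (hv : ∀ j, ⟪conormal m M (φ u) j, v⟫ = 0) : fderiv ℝ φ u (π v) = v := by
  have hmem : v ∈ tangentSpace m M (φ u) := by
    rw [tangentSpace, Submodule.mem_orthogonal]
    intro w hw
    induction hw using Submodule.span_induction with
    | mem w hw => obtain ⟨j, rfl⟩ := hw; exact hv j
    | zero => simp
    | add a b _ _ ha hb => rw [inner_add_left, ha, hb, add_zero]
    | smul c a _ ha => rw [inner_smul_left, ha, mul_zero]
  rw [← hM.range_fderiv h hu] at hmem
  obtain ⟨w, rfl⟩ := hmem
  have := congrArg (fun L => L w) (h.comp_fderiv hu)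
  simp only [ContinuousLinearMap.comp_apply, ContinuousLinearMap.id_apply] at this
  rw [ContinuousLinearMap.coe_coe, this]

/-- Together with `tanProj_comp_fderiv` this exhibits `π ∘ tanProj` as the pseudoinverse of `Dφ`
needed in `fderiv_normDet`: a left inverse whose product with `Dφ` in the other order is a
self-adjoint projection. -/
lemma IsClosedSubmanifold.fderiv_comp_proj (hM : IsClosedSubmanifold m M)
    (h : IsLocalParam M W O φ π) {u : E m} (hu : u ∈ O) :
    fderiv ℝ φ u ∘L (π ∘L tanProj (conormal m M (φ u))) = tanProj (conormal m M (φ u)) := by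
  ext1 v
  exact hM.fderiv_apply_proj h hu fun j =>
    inner_tanProj (hM.orthonormal_conormal (h.map_mem u hu).1) j v

/-- The differential of the volume factor along a parametrization. -/
lemma IsClosedSubmanifold.fderiv_normDet_fderiv (hM : IsClosedSubmanifold m M)
    (h : IsLocalParam M W O φ π) {u : E m} (hu : u ∈ O) (B : E m →L[ℝ] E n) :
    fderiv ℝ (fun A : E m →L[ℝ] E n => (A : E m →ₗ[ℝ] E n).normDet) (fderiv ℝ φ u) B =
      (fderiv ℝ φ u : E m →ₗ[ℝ] E n).normDet * LinearMap.trace ℝ (E m)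
        ((π ∘L tanProj (conormal m M (φ u))) ∘L B : E m →L[ℝ] E m) := by
  refine fderiv_normDet ?_ ?_ B
  · rw [ContinuousLinearMap.comp_assoc, hM.tanProj_comp_fderiv h hu, h.comp_fderiv hu]
  · rw [hM.fderiv_comp_proj h hu, adjoint_tanProj]

/-- With `Q` the pseudoinverse of `A = Dφ` and `P = A Q` the tangential projection, cyclicity gives
`tr(Q D A) = tr(D A Q) = tr(D P)`. -/
lemma IsClosedSubmanifold.trace_proj_comp (hM : IsClosedSubmanifold m M)
    (h : IsLocalParam M W O φ π) {u : E m} (hu : u ∈ O) (D : E n →L[ℝ] E n) :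
    LinearMap.trace ℝ (E m)
      ((π ∘L tanProj (conormal m M (φ u))) ∘L (D ∘L fderiv ℝ φ u) : E m →L[ℝ] E m) =
      tanTrace (conormal m M (φ u)) D := by
  rw [← trace_comp_tanProj, ← ContinuousLinearMap.comp_assoc,
    show D ∘L tanProj (conormal m M (φ u)) =
      (D ∘L fderiv ℝ φ u) ∘L (π ∘L tanProj (conormal m M (φ u))) by
      rw [ContinuousLinearMap.comp_assoc, hM.fderiv_comp_proj h hu]]
  exact LinearMap.trace_comp_comm' (D ∘L fderiv ℝ φ u : E m →L[ℝ] E n).toLinearMap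
    (π ∘L tanProj (conormal m M (φ u)) : E n →L[ℝ] E m).toLinearMap

/-- This is the coordinate formula `div_M X = J⁻¹ div(J Y)` for a tangential field with components
`Y = π ∘ X ∘ φ`. Differentiating `X ∘ φ = Dφ(Y)`, using the symmetry of `D²φ` and applying the
pseudoinverse `Q` gives `tr_T DX = div Y + tr(Q D²φ(Y))`. By `fderiv_normDet_fderiv` the last trace
is the logarithmic derivative of `J` along `Y`. -/
lemma IsClosedSubmanifold.trace_fderiv_normDet_smul (hM : IsClosedSubmanifold m M)
    (h : IsLocalParam M W O φ π) {X : E n → E n} (hX : Differentiable ℝ X)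
    (hXt : ∀ y ∈ M ∩ W, ∀ j, ⟪conormal m M y j, X y⟫ = 0) {u : E m} (hu : u ∈ O) :
    LinearMap.trace ℝ (E m) (fderiv ℝ (fun u => (fderiv ℝ φ u : E m →ₗ[ℝ] E n).normDet •
      π (X (φ u))) u : E m →L[ℝ] E m) =
      (fderiv ℝ φ u : E m →ₗ[ℝ] E n).normDet *
        tanTrace (conormal m M (φ u)) (fderiv ℝ X (φ u)) := by
  set A := fderiv ℝ φ u with hA
  set D := fderiv ℝ X (φ u) with hD
  set Q := π ∘L tanProj (conormal m M (φ u)) with hQ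
  set J : ℝ := (A : E m →ₗ[ℝ] E n).normDet with hJ
  set Y : E m → E m := fun u => π (X (φ u)) with hY
  set D2 := fderiv ℝ (fderiv ℝ φ) u with hD2
  have hφ2 : HasFDerivAt (fderiv ℝ φ) D2 u :=
    (((h.contDiffAt hu).fderiv_right (m := 1) (by norm_num)).differentiableAt one_ne_zero).hasFDerivAt
  have hYd : HasFDerivAt Y (π ∘L D ∘L A) u :=
    π.hasFDerivAt.comp u ((hX (φ u)).hasFDerivAt.comp u (h.hasFDerivAt hu))
  have hJd : HasFDerivAt (fun u => (fderiv ℝ φ u : E m →ₗ[ℝ] E n).normDet)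
      (fderiv ℝ (fun A : E m →L[ℝ] E n => (A : E m →ₗ[ℝ] E n).normDet) A ∘L D2) u :=
    HasFDerivAt.comp (g := fun A : E m →L[ℝ] E n => (A : E m →ₗ[ℝ] E n).normDet) u
      ((contDiffAt_normDet (h.fderiv_injective hu)).differentiableAt (by simp)).hasFDerivAt hφ2
  have hXY : HasFDerivAt (fun u => X (φ u)) (A ∘L (π ∘L D ∘L A) + D2.flip (Y u)) u := by
    refine (hφ2.clm_apply hYd).congr_of_eventuallyEq ?_
    filter_upwards [h.isOpen_source.eventually_mem hu] with v hv
    exact (hM.fderiv_apply_proj h hv (hXt _ (h.map_mem v hv))).symm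
  have e1 : D ∘L A = A ∘L (π ∘L D ∘L A) + D2.flip (Y u) :=
    ((hX (φ u)).hasFDerivAt.comp u (h.hasFDerivAt hu)).unique hXY
  have hsymm : D2.flip (Y u) = D2 (Y u) := by
    ext1 v
    exact ((h.contDiffAt hu).isSymmSndFDerivAt (by simp)) v (Y u)
  have hQA : Q ∘L A = ContinuousLinearMap.id ℝ (E m) := by
    rw [hQ, ContinuousLinearMap.comp_assoc, hM.tanProj_comp_fderiv h hu, h.comp_fderiv hu]
  have e2 : Q ∘L (D ∘L A) = π ∘L D ∘L A + Q ∘L D2 (Y u) := by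
    conv_lhs => rw [e1, hsymm]
    rw [ContinuousLinearMap.comp_add, ← ContinuousLinearMap.comp_assoc Q A, hQA,
      ContinuousLinearMap.id_comp]
  have e3 := congrArg (fun L : E m →L[ℝ] E m => LinearMap.trace ℝ (E m) L) e2
  simp only [ContinuousLinearMap.toLinearMap_add, map_add] at e3
  rw [hM.trace_proj_comp h hu D] at e3
  have hGd := hJd.smul hYd
  have h7 : fderiv ℝ (fun u => (fderiv ℝ φ u : E m →ₗ[ℝ] E n).normDet • π (X (φ u))) u = _ :=
    hGd.fderiv
  rw [h7, ContinuousLinearMap.toLinearMap_add, map_add, ContinuousLinearMap.toLinearMap_smul,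
    map_smul, smul_eq_mul, e3, mul_add]
  congr 1
  have h8 : ∀ (l : E m →L[ℝ] ℝ) (w : E m),
      LinearMap.trace ℝ (E m) (l.smulRight w : E m →L[ℝ] E m) = l w := fun l w =>
    LinearMap.trace_smulRight (l : E m →ₗ[ℝ] ℝ) w
  rw [h8, ContinuousLinearMap.comp_apply]
  exact hM.fderiv_normDet_fderiv h hu _

/-- The divergence theorem for tangential vector fields supported in the range of a
parametrization. -/
lemma IsClosedSubmanifold.integral_tanTrace_of_tangential (hM : IsClosedSubmanifold m M)
    (h : IsLocalParam M W O φ π) {X : E n → E n} (hX : ContDiff ℝ 1 X) (hXc : HasCompactSupport X)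
    (hXW : tsupport X ⊆ W) (hXt : ∀ y ∈ M ∩ W, ∀ j, ⟪conormal m M y j, X y⟫ = 0) :
    ∫ y in M, tanTrace (conormal m M y) (fderiv ℝ X y) ∂μHE[m] = 0 := by
  have hdX : ∀ y, y ∉ tsupport X → fderiv ℝ X y = 0 := fun y hy =>
    image_eq_zero_of_notMem_tsupport fun h' => hy (tsupport_fderiv_subset ℝ h')
  have hcont := hM.continuousOn_tanTrace (hX.continuous_fderiv one_ne_zero).continuousOn
  have h1 : ∫ y in M, tanTrace (conormal m M y) (fderiv ℝ X y) ∂μHE[m] =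
      ∫ y in φ '' O, tanTrace (conormal m M y) (fderiv ℝ X y) ∂μHE[m] := by
    rw [h.image_eq]
    refine setIntegral_eq_of_subset_of_forall_sdiff_eq_zero hM.isClosed.measurableSet
      inter_subset_left fun y hy => ?_
    rw [hdX y fun hys => hy.2 ⟨hy.1, hXW hys⟩]
    simp [tanTrace]
  rw [h1, setIntegral_image_eq h.isOpen_source h.contDiffOn_one
    (fun u hu => h.fderiv_injective hu) h.isOpen_source.measurableSet subset_rfl h.injOn
    ((hcont.mono (h.image_eq ▸ inter_subset_left)).aestronglyMeasurable
      (h.image_eq ▸ h.measurableSet_inter hM.isClosed))]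
  set G₀ : E m → E m := fun u => (fderiv ℝ φ u : E m →ₗ[ℝ] E n).normDet • π (X (φ u)) with hG₀
  -- Extension by zero stays `C¹`: `G` vanishes off the compact set `K`, which lies inside the open
  -- set `O`.
  set G : E m → E m := O.indicator G₀ with hG
  set K : Set (E m) := π '' (tsupport X ∩ M) with hK
  have hKc : IsCompact K := (hXc.isCompact.inter_right hM.isClosed).image π.continuous
  have hG0 : ∀ u, u ∉ K → G u = 0 := by
    intro u hu
    by_cases huO : u ∈ O
    · rw [hG, indicator_of_mem huO, hG₀]
      simp only
      have : φ u ∉ tsupport X := fun h' =>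
        hu ⟨φ u, ⟨h', (h.map_mem u huO).1⟩, h.left_inv u huO⟩
      rw [image_eq_zero_of_notMem_tsupport this, map_zero, smul_zero]
    · exact indicator_of_notMem huO _
  have hKO : K ⊆ O := by
    rintro _ ⟨y, hy, rfl⟩
    exact h.map_inv_mem y ⟨hy.2, hXW hy.1⟩
  have hGev : ∀ u ∈ O, G =ᶠ[𝓝 u] G₀ := fun u hu =>
    (h.isOpen_source.eventually_mem hu).mono fun v hv => indicator_of_mem hv _
  have hGzero : ∀ u, u ∉ O → G =ᶠ[𝓝 u] 0 := fun u hu =>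
    (hKc.isClosed.isOpen_compl.eventually_mem fun h' => hu (hKO h')).mono fun v hv => hG0 v hv
  have hGc : HasCompactSupport G := HasCompactSupport.intro hKc hG0
  have hGd : ContDiff ℝ 1 G := by
    rw [contDiff_iff_contDiffAt]
    intro u
    by_cases hu : u ∈ O
    · refine ContDiffAt.congr_of_eventuallyEq ?_ (hGev u hu)
      have hY : ContDiffAt ℝ 1 (fun u => π (X (φ u))) u := π.contDiff.contDiffAt.comp u
        (hX.contDiffAt.comp u ((h.contDiffAt hu).of_le (by norm_num)))
      refine ContDiffAt.smul (f := fun u => (fderiv ℝ φ u : E m →ₗ[ℝ] E n).normDet) ?_ hY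
      exact ContDiffAt.comp (g := fun A : E m →L[ℝ] E n => (A : E m →ₗ[ℝ] E n).normDet) u
        ((contDiffAt_normDet (h.fderiv_injective hu)).of_le (by simp))
        ((h.contDiffAt hu).fderiv_right (m := 1) (by norm_num))
    · exact contDiffAt_const.congr_of_eventuallyEq (hGzero u hu)
  rw [← integral_trace_fderiv_eq_zero hGd hGc,
    ← setIntegral_eq_integral_of_forall_compl_eq_zero (s := O)
      (f := fun u => LinearMap.trace ℝ (E m) (fderiv ℝ G u : E m →L[ℝ] E m))]
  · refine setIntegral_congr_fun h.isOpen_source.measurableSet fun u hu => ?_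
    rw [(hGev u hu).fderiv_eq]
    exact (hM.trace_fderiv_normDet_smul h (hX.differentiable one_ne_zero) hXt hu).symm
  · intro u hu
    rw [(hGzero u hu).fderiv_eq]
    simp

/-- The divergence theorem for vector fields supported in the range of a parametrization. -/
theorem IsClosedSubmanifold.integral_tanTrace (hM : IsClosedSubmanifold m M)
    (h : IsLocalParam M W O φ π) {U : Set (E n)} {N : Fin (n - m) → E n → E n}
    (hN : IsNormalFrame m M U N) {Z : E n → E n} (hZ : ContDiff ℝ 1 Z) (hZc : HasCompactSupport Z)
    (hZW : tsupport Z ⊆ W) (hZU : tsupport Z ⊆ U) :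
    ∫ y in M, tanTrace (conormal m M y) (fderiv ℝ Z y) ∂μHE[m] =
      ∫ y in M, ⟪Z y, meanCurvature m M y⟫ ∂μHE[m] := by
  -- `P` is the normal part of `Z` along `M`, and is globally `C¹` because `Z` is supported in the
  -- domain of the frame. The tangential part `Z - P` has integral zero, and the divergence of `P`
  -- is `⟨P, H⟩ = ⟨Z, H⟩`.
  set P : E n → E n := fun y => ∑ j, ⟪N j y, Z y⟫ • N j y with hP
  have hP0 : ∀ y, Z y = 0 → P y = 0 := fun y hy => by simp [hP, hy]
  have hPsupp : tsupport P ⊆ tsupport Z :=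
    closure_mono fun y hy hZ0 => hy (hP0 y hZ0)
  have hPd : ContDiff ℝ 1 P := by
    rw [contDiff_iff_contDiffAt]
    intro y
    by_cases hy : y ∈ U
    · refine ContDiffAt.sum fun j _ => ?_
      have hNj : ContDiffAt ℝ 1 (N j) y :=
        ((hN.contDiffOn j).contDiffAt (hN.isOpen.mem_nhds hy)).of_le (by simp)
      exact (hNj.inner ℝ hZ.contDiffAt).smul hNj
    · have hy' : y ∉ tsupport Z := fun h' => hy (hZU h')
      refine (contDiffAt_const (c := (0 : E n))).congr_of_eventuallyEq ?_
      filter_upwards [(isClosed_tsupport Z).isOpen_compl.mem_nhds hy'] with z hz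
      exact hP0 z (image_eq_zero_of_notMem_tsupport hz)
  have hPc : HasCompactSupport P := hZc.of_isClosed_subset (isClosed_tsupport P) hPsupp
  set X : E n → E n := fun y => Z y - P y with hX
  have hXsupp : tsupport X ⊆ tsupport Z :=
    closure_mono fun y hy hZ0 => hy (by simp [hX, hZ0, hP0 y hZ0])
  have hXt : ∀ y ∈ M ∩ W, ∀ j, ⟪conormal m M y j, X y⟫ = 0 := by
    intro y hy j
    by_cases hyU : y ∈ U
    · have hon := hN.orthonormal y ⟨hy.1, hyU⟩
      have hk : ∀ k, ⟪N k y, X y⟫ = 0 := fun k => by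
        rw [hX, inner_sub_right, hP, hon.inner_right_fintype, sub_self]
      have hmem : conormal m M y j ∈ Submodule.span ℝ (range fun j => N j y) := by
        rw [hN.span_eq y ⟨hy.1, hyU⟩]
        exact Submodule.subset_span (mem_range_self j)
      obtain ⟨c, hc⟩ := (Submodule.mem_span_range_iff_exists_fun ℝ).mp hmem
      rw [← hc, sum_inner]
      exact Finset.sum_eq_zero fun k _ => by rw [inner_smul_left, hk, mul_zero]
    · have hZ0 : Z y = 0 := image_eq_zero_of_notMem_tsupport fun h' => hyU (hZU h')
      simp [hX, hZ0, hP0 y hZ0]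
  have hXd : ContDiff ℝ 1 X := hZ.sub hPd
  have hXc : HasCompactSupport X := hZc.of_isClosed_subset (isClosed_tsupport X) hXsupp
  have h1 := hM.integral_tanTrace_of_tangential h hXd hXc (hXsupp.trans hZW) hXt
  have hint : ∀ {F : E n → E n}, ContDiff ℝ 1 F → HasCompactSupport F →
      Integrable (fun y => tanTrace (conormal m M y) (fderiv ℝ F y)) (μHE[m].restrict M) := by
    intro F hF hFc
    refine hM.integrable
      (hM.continuousOn_tanTrace (hF.continuous_fderiv one_ne_zero).continuousOn) ?_
    refine (hFc.fderiv ℝ).mono fun y hy h0 => hy ?_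
    simp [h0, tanTrace]
  have h2 : ∀ y, tanTrace (conormal m M y) (fderiv ℝ Z y) =
      tanTrace (conormal m M y) (fderiv ℝ X y) + tanTrace (conormal m M y) (fderiv ℝ P y) := by
    intro y
    have : fderiv ℝ Z y = fderiv ℝ X y + fderiv ℝ P y := by
      rw [hX, fderiv_fun_sub (hZ.differentiable one_ne_zero y) (hPd.differentiable one_ne_zero y)]
      abel
    rw [this]
    simp only [tanTrace, ContinuousLinearMap.toLinearMap_add, map_add, _root_.add_apply,
      inner_add_left, Finset.sum_add_distrib]
    ring
  simp_rw [h2]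
  rw [integral_add (hint hXd hXc) (hint hPd hPc), h1, zero_add]
  refine setIntegral_congr_fun hM.isClosed.measurableSet fun y hy => ?_
  by_cases hyU : y ∈ U
  · rw [hM.tanTrace_fderiv_of_normal hy (hPd.differentiable one_ne_zero y)]
    · have hon := hN.orthonormal y ⟨hy, hyU⟩
      have hHmem : meanCurvature m M y ∈ Submodule.span ℝ (range fun j => N j y) := by
        rw [hN.span_eq y ⟨hy, hyU⟩]
        exact Submodule.sum_mem _ fun j _ => Submodule.smul_mem _ _
          (Submodule.subset_span (mem_range_self j))
      obtain ⟨c, hc⟩ := (Submodule.mem_span_range_iff_exists_fun ℝ).mp hHmem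
      have hk : ∀ k, ⟪X y, N k y⟫ = 0 := fun k => by
        rw [real_inner_comm, hX, inner_sub_right, hP, hon.inner_right_fintype, sub_self]
      have hX0 : ⟪X y, meanCurvature m M y⟫ = 0 := by
        rw [← hc, inner_sum]
        exact Finset.sum_eq_zero fun k _ => by rw [inner_smul_right, hk, mul_zero]
      rw [hX, inner_sub_left, sub_eq_zero] at hX0
      exact hX0.symm
    · filter_upwards [hN.isOpen.mem_nhds hyU] with z hzU hzM
      rw [← hN.span_eq z ⟨hzM, hzU⟩]
      exact Submodule.sum_mem _ fun j _ => Submodule.smul_mem _ _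
        (Submodule.subset_span (mem_range_self j))
  · have hy' : y ∉ tsupport Z := fun h' => hyU (hZU h')
    have hdP : fderiv ℝ P y = 0 :=
      image_eq_zero_of_notMem_tsupport fun h' => hy' (hPsupp (tsupport_fderiv_subset ℝ h'))
    rw [hdP, image_eq_zero_of_notMem_tsupport hy']
    simp [tanTrace]

end Divergence

end Superform

namespace Superform

/-! ### Variation of the surface measure under a linear deformation -/

section Deformation

variable {n m : ℕ} {M W : Set (E n)} {O : Set (E m)} {φ : E m → E n} {π : E n →L[ℝ] E m}

lemma isOpen_normDet_ne_zero (h : IsLocalParam M W O φ π) {X : E n → E n} (hX : ContDiff ℝ 1 X) :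
    ContinuousOn (fun q : ℝ × E m =>
      fderiv ℝ φ q.2 + q.1 • (fderiv ℝ X (φ q.2) ∘L fderiv ℝ φ q.2)) (univ ×ˢ O) ∧
    IsOpen {q : ℝ × E m | q.2 ∈ O ∧ Function.Injective
      (fderiv ℝ φ q.2 + q.1 • (fderiv ℝ X (φ q.2) ∘L fderiv ℝ φ q.2))} := by
  have hdφ : ContinuousOn (fun q : ℝ × E m => fderiv ℝ φ q.2) (univ ×ˢ O) :=
    (h.contDiffOn_one.continuousOn_fderiv_of_isOpen h.isOpen_source le_rfl).comp
      continuousOn_snd fun q hq => hq.2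
  have hdX : ContinuousOn (fun q : ℝ × E m => fderiv ℝ X (φ q.2)) (univ ×ˢ O) :=
    (hX.continuous_fderiv one_ne_zero).comp_continuousOn
      (h.contDiffOn.continuousOn.comp continuousOn_snd fun q hq => hq.2)
  have hL : ContinuousOn (fun q : ℝ × E m =>
      fderiv ℝ φ q.2 + q.1 • (fderiv ℝ X (φ q.2) ∘L fderiv ℝ φ q.2)) (univ ×ˢ O) :=
    hdφ.add (continuousOn_fst.smul (hdX.clm_comp hdφ))
  refine ⟨hL, ?_⟩
  have h1 := ((continuous_normDet m n).comp_continuousOn hL).isOpen_inter_preimage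
    (isOpen_univ.prod h.isOpen_source) (isOpen_compl_singleton (x := (0 : ℝ)))
  convert h1 using 1
  ext q
  simp only [mem_ofPred_eq, mem_inter_iff, mem_prod, mem_univ, true_and, mem_preimage,
    mem_compl_iff, mem_singleton_iff, Function.comp_apply]
  refine and_congr_right fun _ => ?_
  exact ((LinearMap.normDet_ne_zero_tfae _).out 4 0 rfl rfl)

/-- The tube lemma fits `[-δ, δ] × K` into `S`; continuity of `f'` on this compact set gives the
constant bound needed to differentiate under the integral. -/
lemma hasDerivAt_setIntegral_of_continuousOn {f f' : ℝ → E m → ℝ} {S : Set (ℝ × E m)}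
    (hS : IsOpen S) {K : Set (E m)} (hK : IsCompact K) (h0K : ∀ u ∈ K, ((0 : ℝ), u) ∈ S)
    (hf : ContinuousOn (fun q : ℝ × E m => f q.1 q.2) S)
    (hf' : ContinuousOn (fun q : ℝ × E m => f' q.1 q.2) S)
    (hd : ∀ t u, (t, u) ∈ S → HasDerivAt (fun t => f t u) (f' t u) t) :
    HasDerivAt (fun t : ℝ => ∫ u in K, f t u) (∫ u in K, f' 0 u) 0 := by
  have h0K' : ({0} : Set ℝ) ×ˢ K ⊆ S := by
    rintro ⟨t, u⟩ ⟨ht, hu⟩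
    rw [mem_singleton_iff] at ht
    simp only at ht hu
    rw [ht]
    exact h0K u hu
  obtain ⟨I', V', hI', -, h0I', hKV', hIV'⟩ :=
    generalized_tube_lemma isCompact_singleton hK hS h0K'
  obtain ⟨δ, hδ, hδI⟩ := Metric.nhds_basis_closedBall.mem_iff.mp
    (hI'.mem_nhds (h0I' (mem_singleton 0)))
  have hBK : Metric.closedBall (0 : ℝ) δ ×ˢ K ⊆ S := (prod_mono hδI hKV').trans hIV'
  obtain ⟨C, hC⟩ := ((isCompact_closedBall (0 : ℝ) δ).prod hK).exists_bound_of_continuousOn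
    (hf'.mono hBK)
  have hslice : ∀ {k : ℝ → E m → ℝ}, ContinuousOn (fun q : ℝ × E m => k q.1 q.2) S →
      ∀ t ∈ Metric.closedBall (0 : ℝ) δ, ContinuousOn (k t) K := fun {k} hk t ht =>
    hk.comp (f := fun u => (t, u)) (by fun_prop) fun u hu => hBK ⟨ht, hu⟩
  have h0 : (0 : ℝ) ∈ Metric.closedBall (0 : ℝ) δ := Metric.mem_closedBall_self hδ.le
  have hfin : IsFiniteMeasure (volume.restrict K) :=
    ⟨by rw [Measure.restrict_apply_univ]; exact hK.measure_lt_top⟩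
  exact (hasDerivAt_integral_of_dominated_loc_of_deriv_le (μ := volume.restrict K)
    (F := f) (F' := f') (bound := fun _ => C) (x₀ := (0 : ℝ)) (Metric.ball_mem_nhds 0 hδ)
    (by
      filter_upwards [Metric.closedBall_mem_nhds (0 : ℝ) hδ] with t ht
      exact (hslice hf t ht).aestronglyMeasurable hK.measurableSet)
    ((hslice hf 0 h0).integrableOn_compact hK)
    ((hslice hf' 0 h0).aestronglyMeasurable hK.measurableSet)
    ((ae_restrict_mem hK.measurableSet).mono fun u hu t ht =>
      hC (t, u) ⟨Metric.ball_subset_closedBall ht, hu⟩)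
    (integrable_const C)
    ((ae_restrict_mem hK.measurableSet).mono fun u hu t ht =>
      hd t u (hBK ⟨Metric.ball_subset_closedBall ht, hu⟩))).2

/-- The derivative of the transported integral in a parametrization. -/
lemma IsClosedSubmanifold.hasDerivAt_integral_normDet (hM : IsClosedSubmanifold m M)
    (h : IsLocalParam M W O φ π) {X : E n → E n} (hX : ContDiff ℝ 1 X) {g : E n → ℝ}
    (hg : ContDiff ℝ 1 g) {K : Set (E m)} (hK : IsCompact K) (hKO : K ⊆ O) :
    HasDerivAt (fun t : ℝ => ∫ u in K,
      ((fderiv ℝ φ u + t • (fderiv ℝ X (φ u) ∘L fderiv ℝ φ u) : E m →L[ℝ] E n) :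
        E m →ₗ[ℝ] E n).normDet * g (φ u + t • X (φ u)))
      (∫ u in K, (fderiv ℝ φ u : E m →ₗ[ℝ] E n).normDet *
        (fderiv ℝ g (φ u) (X (φ u)) + g (φ u) *
          tanTrace (conormal m M (φ u)) (fderiv ℝ X (φ u)))) 0 := by
  obtain ⟨hL, hS⟩ := isOpen_normDet_ne_zero h hX
  set S := {q : ℝ × E m | q.2 ∈ O ∧ Function.Injective
    (fderiv ℝ φ q.2 + q.1 • (fderiv ℝ X (φ q.2) ∘L fderiv ℝ φ q.2))} with hSdef
  have hL0 : ∀ u, fderiv ℝ φ u + (0 : ℝ) • (fderiv ℝ X (φ u) ∘L fderiv ℝ φ u) = fderiv ℝ φ u :=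
    fun u => by ext1; simp
  have h0K : ∀ u ∈ K, ((0 : ℝ), u) ∈ S := by
    intro u hu
    refine ⟨hKO hu, ?_⟩
    simp only
    rw [hL0]
    exact h.fderiv_injective (hKO hu)
  have hSO : S ⊆ univ ×ˢ O := fun q hq => ⟨mem_univ _, hq.1⟩
  have hLS := hL.mono hSO
  have hφ : ContinuousOn (fun q : ℝ × E m => φ q.2) S :=
    h.contDiffOn.continuousOn.comp continuousOn_snd fun q hq => hq.1
  have hXφ := hX.continuous.comp_continuousOn hφ
  have hP : ContinuousOn (fun q : ℝ × E m => φ q.2 + q.1 • X (φ q.2)) S :=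
    hφ.add (continuousOn_fst.smul hXφ)
  have hdφ : ContinuousOn (fun q : ℝ × E m => fderiv ℝ φ q.2) S :=
    (h.contDiffOn_one.continuousOn_fderiv_of_isOpen h.isOpen_source le_rfl).comp
      continuousOn_snd fun q hq => hq.1
  have hB := ((hX.continuous_fderiv one_ne_zero).comp_continuousOn hφ).clm_comp hdφ
  have hJ := (continuous_normDet m n).comp_continuousOn hLS
  have hgP := hg.continuous.comp_continuousOn hP
  have hdJ : ContinuousOn (fun q : ℝ × E m => fderiv ℝ
      (fun A : E m →L[ℝ] E n => (A : E m →ₗ[ℝ] E n).normDet)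
      (fderiv ℝ φ q.2 + q.1 • (fderiv ℝ X (φ q.2) ∘L fderiv ℝ φ q.2))) S := by
    intro q hq
    have h1 := ((contDiffAt_normDet hq.2).fderiv_right (m := 0) (by simp)).continuousAt
    exact ContinuousAt.comp_continuousWithinAt (f := fun q : ℝ × E m =>
      fderiv ℝ φ q.2 + q.1 • (fderiv ℝ X (φ q.2) ∘L fderiv ℝ φ q.2)) h1 (hLS q hq)
  have key := hasDerivAt_setIntegral_of_continuousOn (f := fun t u =>
      ((fderiv ℝ φ u + t • (fderiv ℝ X (φ u) ∘L fderiv ℝ φ u) : E m →L[ℝ] E n) :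
        E m →ₗ[ℝ] E n).normDet * g (φ u + t • X (φ u)))
    (f' := fun t u => fderiv ℝ (fun A : E m →L[ℝ] E n => (A : E m →ₗ[ℝ] E n).normDet)
        (fderiv ℝ φ u + t • (fderiv ℝ X (φ u) ∘L fderiv ℝ φ u))
        (fderiv ℝ X (φ u) ∘L fderiv ℝ φ u) * g (φ u + t • X (φ u)) +
      ((fderiv ℝ φ u + t • (fderiv ℝ X (φ u) ∘L fderiv ℝ φ u) : E m →L[ℝ] E n) :
        E m →ₗ[ℝ] E n).normDet * fderiv ℝ g (φ u + t • X (φ u)) (X (φ u)))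
    hS hK h0K (hJ.mul hgP)
    (((hdJ.clm_apply hB).mul hgP).add (hJ.mul
      (((hg.continuous_fderiv one_ne_zero).comp_continuousOn hP).clm_apply hXφ)))
    (by
      intro t u hq
      have hLd : HasDerivAt (fun t : ℝ => fderiv ℝ φ u + t • (fderiv ℝ X (φ u) ∘L fderiv ℝ φ u))
          (fderiv ℝ X (φ u) ∘L fderiv ℝ φ u) t := by
        have := ((hasDerivAt_id t).smul_const (fderiv ℝ X (φ u) ∘L fderiv ℝ φ u)).const_add
          (fderiv ℝ φ u)
        rwa [one_smul] at this
      have hPd : HasDerivAt (fun t : ℝ => φ u + t • X (φ u)) (X (φ u)) t := by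
        have := ((hasDerivAt_id t).smul_const (X (φ u))).const_add (φ u)
        rwa [one_smul] at this
      have hJd := ((contDiffAt_normDet hq.2).differentiableAt (by simp)).hasFDerivAt
      have hgd := (hg.differentiable one_ne_zero (φ u + t • X (φ u))).hasFDerivAt
      exact (hJd.comp_hasDerivAt t hLd).mul (hgd.comp_hasDerivAt t hPd))
  convert key using 1
  refine setIntegral_congr_fun hK.measurableSet fun u hu => ?_
  have huO := hKO hu
  simp only [hL0]
  rw [zero_smul, add_zero (φ u), hM.fderiv_normDet_fderiv h huO, hM.trace_proj_comp h huO]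
  ring

/-- The derivative of the integral over the images of a compact piece of a submanifold under
`x ↦ x + t X(x)`. -/
lemma IsClosedSubmanifold.hasDerivAt_setIntegral_image (hM : IsClosedSubmanifold m M)
    (h : IsLocalParam M W O φ π) {X : E n → E n} (hX : ContDiff ℝ 1 X) {g : E n → ℝ}
    (hg : ContDiff ℝ 1 g) {A : Set (E n)} (hA : IsCompact A) (hAM : A ⊆ M ∩ W) {C : ℝ≥0}
    (hXA : LipschitzOnWith C X A) :
    HasDerivAt (fun t : ℝ => ∫ y in (fun x => x + t • X x) '' A, g y ∂μHE[m])
      (∫ y in A, (fderiv ℝ g y (X y) + g y * tanTrace (conormal m M y) (fderiv ℝ X y)) ∂μHE[m])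
      0 := by
  set K : Set (E m) := π '' A with hKdef
  have hK : IsCompact K := hA.image π.continuous
  have hKO : K ⊆ O := by
    rintro _ ⟨y, hy, rfl⟩
    exact h.map_inv_mem y (hAM hy)
  have hφK : φ '' K = A := by
    rw [hKdef, image_image]
    exact (image_congr fun y hy => h.right_inv y (hAM hy)).trans (image_id A)
  have hφA : ∀ u ∈ K, φ u ∈ A := fun u hu => hφK ▸ mem_image_of_mem φ hu
  have hcont : ContinuousOn (fun y => fderiv ℝ g y (X y) + g y *
      tanTrace (conormal m M y) (fderiv ℝ X y)) A := by
    refine ContinuousOn.add ?_ (ContinuousOn.mul hg.continuous.continuousOn ?_)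
    · exact ((hg.continuous_fderiv one_ne_zero).clm_apply hX.continuous).continuousOn
    · exact (hM.continuousOn_tanTrace (hX.continuous_fderiv one_ne_zero).continuousOn).mono
        fun y hy => (hAM hy).1
  have hval : ∫ y in A, (fderiv ℝ g y (X y) + g y *
      tanTrace (conormal m M y) (fderiv ℝ X y)) ∂μHE[m] =
      ∫ u in K, (fderiv ℝ φ u : E m →ₗ[ℝ] E n).normDet * (fderiv ℝ g (φ u) (X (φ u)) + g (φ u) *
          tanTrace (conormal m M (φ u)) (fderiv ℝ X (φ u))) := by
    rw [← hφK] at hcont ⊢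
    exact setIntegral_image_eq h.isOpen_source h.contDiffOn_one
      (fun u hu => h.fderiv_injective (hKO hu)) hK.measurableSet hKO (h.injOn.mono hKO)
      (hcont.aestronglyMeasurable (hφK.symm ▸ hA.measurableSet))
  rw [hval]
  refine (hM.hasDerivAt_integral_normDet h hX hg hK hKO).congr_of_eventuallyEq ?_
  obtain ⟨-, hS⟩ := isOpen_normDet_ne_zero h hX
  have h0K : ∀ u ∈ K, ∀ᶠ q : ℝ × E m in 𝓝 (0, u), Function.Injective
      (fderiv ℝ φ q.2 + q.1 • (fderiv ℝ X (φ q.2) ∘L fderiv ℝ φ q.2)) := by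
    intro u hu
    have hmem : ((0 : ℝ), u) ∈ {q : ℝ × E m | q.2 ∈ O ∧ Function.Injective
        (fderiv ℝ φ q.2 + q.1 • (fderiv ℝ X (φ q.2) ∘L fderiv ℝ φ q.2))} := by
      refine ⟨hKO hu, ?_⟩
      have : fderiv ℝ φ u + (0 : ℝ) • (fderiv ℝ X (φ u) ∘L fderiv ℝ φ u) = fderiv ℝ φ u := by
        ext1; simp
      simp only
      rw [this]
      exact h.fderiv_injective (hKO hu)
    exact (hS.eventually_mem hmem).mono fun q hq => hq.2
  have hinjt := hK.eventually_forall_of_forall_eventually (x₀ := (0 : ℝ))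
    (P := fun (t : ℝ) (u : E m) => Function.Injective
      (fderiv ℝ φ u + t • (fderiv ℝ X (φ u) ∘L fderiv ℝ φ u))) h0K
  -- For such `t` the map `x ↦ x + t X(x)` is a contractive perturbation of the identity on `A`,
  -- hence injective there; `hinjt` provides the immersion property. Both are needed for the area
  -- formula.
  have hsmall : ∀ᶠ t : ℝ in 𝓝 0, |t| * C < 1 := by
    have : Tendsto (fun t : ℝ => |t| * C) (𝓝 0) (𝓝 (|0| * C)) :=
      (continuous_abs.mul continuous_const).tendsto 0
    rw [abs_zero, zero_mul] at this
    exact this.eventually (gt_mem_nhds one_pos)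
  filter_upwards [hinjt, hsmall] with t ht htC
  set f : E m → E n := fun u => φ u + t • X (φ u) with hf
  have himg : (fun x => x + t • X x) '' A = f '' K := by
    rw [← hφK, image_image]
  have hfd : ContDiffOn ℝ 1 f O :=
    h.contDiffOn_one.add ((hX.comp_contDiffOn h.contDiffOn_one).const_smul t)
  have hdf : ∀ u ∈ O, fderiv ℝ f u =
      fderiv ℝ φ u + t • (fderiv ℝ X (φ u) ∘L fderiv ℝ φ u) := fun u hu => by
    have h1 := h.hasFDerivAt hu
    exact (h1.add (((hX.differentiable one_ne_zero (φ u)).hasFDerivAt.comp u h1).const_smul t)).fderiv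
  have hfinj : InjOn f K := by
    intro u hu v hv huv
    have h1 : φ u - φ v = t • (X (φ v) - X (φ u)) := by
      have : φ u + t • X (φ u) = φ v + t • X (φ v) := huv
      rw [smul_sub, sub_eq_sub_iff_add_eq_add, this]
      abel
    have h2 : ‖φ u - φ v‖ ≤ |t| * C * ‖φ u - φ v‖ := by
      conv_lhs => rw [h1, norm_smul, Real.norm_eq_abs, norm_sub_rev]
      rw [mul_assoc]
      gcongr
      exact hXA.norm_sub_le (hφA u hu) (hφA v hv)
    have h3 : ‖φ u - φ v‖ = 0 := by
      by_contra hne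
      have hpos : 0 < ‖φ u - φ v‖ := lt_of_le_of_ne (norm_nonneg _) (Ne.symm hne)
      nlinarith
    exact h.injOn (hKO hu) (hKO hv) (sub_eq_zero.mp (norm_eq_zero.mp h3))
  rw [himg, setIntegral_image_eq h.isOpen_source hfd (fun u hu => by
    rw [hdf u (hKO hu)]; exact ht u hu) hK.measurableSet hKO hfinj
    hg.continuous.aestronglyMeasurable]
  refine setIntegral_congr_fun hK.measurableSet fun u hu => ?_
  simp only
  rw [hdf u (hKO hu)]

end Deformation

end Superform

namespace Superform

/-! ### Short time behaviour of the flow of a time dependent vector field -/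

section Flow

variable {n : ℕ}

/-- A curve whose speed is small while it stays near its starting point stays near it. -/
lemma norm_sub_le_of_norm_deriv_le {G : Type*} [NormedAddCommGroup G] [NormedSpace ℝ G]
    {γ γ' : ℝ → G} {a b C η : ℝ}
    (hγ : ∀ s ∈ uIcc a b, HasDerivWithinAt γ (γ' s) (uIcc a b) s)
    (hC : ∀ s ∈ uIcc a b, ‖γ s - γ a‖ ≤ η → ‖γ' s‖ ≤ C) (hη : 0 < η) (h : C * |b - a| < η) :
    ∀ s ∈ uIcc a b, ‖γ s - γ a‖ ≤ η := by
  -- Reparametrizing by `[0, 1]` treats motion forwards and backwards in time at once.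
  have himg : uIcc a b = (fun τ : ℝ => a + τ • (b - a)) '' Icc (0 : ℝ) 1 := by
    rw [← segment_eq_uIcc, segment_eq_image']
  have hmaps : MapsTo (fun τ : ℝ => a + τ • (b - a)) (Icc (0 : ℝ) 1) (uIcc a b) := fun τ hτ =>
    himg ▸ mem_image_of_mem _ hτ
  have hd : ∀ τ ∈ Icc (0 : ℝ) 1, HasDerivWithinAt (fun τ : ℝ => γ (a + τ • (b - a)) - γ a)
      ((b - a) • γ' (a + τ • (b - a))) (Icc 0 1) τ := by
    intro τ hτ
    have h1 : HasDerivWithinAt (fun τ : ℝ => a + τ • (b - a)) (b - a) (Icc 0 1) τ := by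
      have := ((hasDerivAt_id τ).smul_const (b - a)).const_add a
      rw [one_smul] at this
      exact this.hasDerivWithinAt
    exact ((hγ _ (hmaps hτ)).scomp τ h1 hmaps).sub_const _
  have hη0 : ∀ x : ℝ, HasDerivAt (fun τ : ℝ => η * τ) η x := fun x => by
    simpa using (hasDerivAt_id x).const_mul η
  -- The barrier is `η τ`. Where the curve touches it, the curve is still within `η` of its start,
  -- so the speed is at most `C |b - a| < η`, the slope of the barrier.
  have key := image_norm_le_of_norm_deriv_right_lt_deriv_boundary' (a := (0 : ℝ)) (b := 1)
    (f := fun τ : ℝ => γ (a + τ • (b - a)) - γ a)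
    (f' := fun τ => (b - a) • γ' (a + τ • (b - a))) (B := fun τ => η * τ) (B' := fun _ => η)
    (fun τ hτ => (hd τ hτ).continuousWithinAt)
    (fun τ hτ => (hd τ (Ico_subset_Icc_self hτ)).mono_of_mem_nhdsWithin
      (Icc_mem_nhdsGE_of_mem hτ))
    (by simp) (by fun_prop) (fun x _ => (hη0 x).hasDerivWithinAt)
    (by
      intro τ hτ hτe
      have hτ' := Ico_subset_Icc_self hτ
      rw [norm_smul, Real.norm_eq_abs, mul_comm]
      refine lt_of_le_of_lt (mul_le_mul_of_nonneg_right (hC _ (hmaps hτ') ?_) (abs_nonneg _)) h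
      rw [hτe]
      nlinarith [hτ'.2])
  intro s hs
  rw [himg] at hs
  obtain ⟨τ, hτ, rfl⟩ := hs
  refine (key hτ).trans ?_
  nlinarith [hτ.2]

lemma exists_norm_sub_le_of_continuousOn {G : Type*} [NormedAddCommGroup G] {I : Set ℝ}
    (h0 : (0 : ℝ) ∈ I) {k : ℝ → E n → G}
    (hk : ContinuousOn (fun q : ℝ × E n => k q.1 q.2) (I ×ˢ univ)) {K : Set (E n)}
    (hK : IsCompact K) {ε : ℝ} (hε : 0 < ε) :
    ∃ δ > 0, ∀ t ∈ I, |t| ≤ δ → ∀ z ∈ K, ∀ d : E n, ‖d‖ ≤ δ → ‖k t (z + d) - k 0 z‖ ≤ ε := by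
  have h1 : ∀ z ∈ K, ∀ᶠ q : (ℝ × E n) × E n in 𝓝 ((0, 0), z),
      q.1.1 ∈ I → ‖k q.1.1 (q.2 + q.1.2) - k 0 q.2‖ ≤ ε := by
    intro z _
    have hz : ContinuousWithinAt (fun q : ℝ × E n => k q.1 q.2) (I ×ˢ univ) (0, z) :=
      hk _ ⟨h0, mem_univ _⟩
    have ha : ContinuousWithinAt (fun q : (ℝ × E n) × E n => k q.1.1 (q.2 + q.1.2))
        {q | q.1.1 ∈ I} ((0, 0), z) := by
      refine ContinuousWithinAt.comp (g := fun q : ℝ × E n => k q.1 q.2) (t := I ×ˢ univ)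
        (f := fun q : (ℝ × E n) × E n => (q.1.1, q.2 + q.1.2)) (by simpa using hz)
        (by fun_prop) fun q hq => ⟨hq, mem_univ _⟩
    have hb : ContinuousWithinAt (fun q : (ℝ × E n) × E n => k 0 q.2)
        {q | q.1.1 ∈ I} ((0, 0), z) := by
      refine ContinuousWithinAt.comp (g := fun q : ℝ × E n => k q.1 q.2) (t := I ×ˢ univ)
        (f := fun q : (ℝ × E n) × E n => ((0 : ℝ), q.2)) hz
        (by fun_prop) fun q hq => ⟨h0, mem_univ _⟩
    have hc := (ha.sub hb).norm
    have hlt : ‖k ((0 : ℝ), (0 : E n)).1 (z + 0) - k 0 z‖ < ε := by simpa using hε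
    have := hc.eventually (gt_mem_nhds hlt)
    rw [eventually_nhdsWithin_iff] at this
    exact this.mono fun q hq hqI => (hq hqI).le
  have h2 := hK.eventually_forall_of_forall_eventually (x₀ := ((0 : ℝ), (0 : E n)))
    (P := fun (q : ℝ × E n) z => q.1 ∈ I → ‖k q.1 (z + q.2) - k 0 z‖ ≤ ε) h1
  obtain ⟨δ, hδ, h3⟩ := Metric.nhds_basis_closedBall.eventually_iff.mp h2
  refine ⟨δ, hδ, fun t ht htδ z hz d hd => ?_⟩
  have h4 : (t, d) ∈ Metric.closedBall ((0 : ℝ), (0 : E n)) δ := by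
    rw [mem_closedBall_iff_norm, Prod.norm_def]
    simpa using ⟨htδ, hd⟩
  exact h3 h4 z hz ht

lemma exists_norm_le_of_continuousOn {G : Type*} [NormedAddCommGroup G] {I : Set ℝ}
    (h0 : (0 : ℝ) ∈ I) {k : ℝ → E n → G}
    (hk : ContinuousOn (fun q : ℝ × E n => k q.1 q.2) (I ×ˢ univ)) {K : Set (E n)}
    (hK : IsCompact K) :
    ∃ δ > 0, ∃ C > 0, ∀ t ∈ I, |t| ≤ δ → ∀ z ∈ K, ‖k t z‖ ≤ C := by
  obtain ⟨δ, hδ, h1⟩ := exists_norm_sub_le_of_continuousOn h0 hk hK one_pos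
  have hk0 : ContinuousOn (k 0) K :=
    hk.comp (f := fun z : E n => ((0 : ℝ), z)) (by fun_prop) fun z _ => ⟨h0, mem_univ _⟩
  obtain ⟨C, hC⟩ := hK.exists_bound_of_continuousOn hk0
  refine ⟨δ, hδ, |C| + 1, by positivity, fun t ht htδ z hz => ?_⟩
  have h2 := h1 t ht htδ z hz 0 (by simpa using hδ.le)
  rw [add_zero] at h2
  have h3 := norm_le_norm_add_norm_sub' (k t z) (k 0 z)
  have h4 := hC z hz
  have h5 := le_abs_self C
  linarith

lemma contDiff_of_uncurry {X : ℝ → E n → E n} {I : Set ℝ}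
    (hX : ContDiffOn ℝ ∞ (fun q : ℝ × E n => X q.1 q.2) (I ×ˢ univ)) {t : ℝ} (ht : t ∈ I) :
    ContDiff ℝ ∞ (X t) := by
  rw [← contDiffOn_univ]
  exact hX.comp (f := fun z : E n => (t, z)) (by fun_prop) fun z _ => ⟨ht, mem_univ _⟩

/-- The spatial differential is the joint differential within `I × ℝⁿ` restricted to the second
factor. As `I` is a nontrivial interval, derivatives within this set are unique, also at end points
of `I`. -/
lemma continuousOn_fderiv_of_uncurry {X : ℝ → E n → E n} {I : Set ℝ} (hI : I.OrdConnected)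
    (hI' : I.Nontrivial)
    (hX : ContDiffOn ℝ ∞ (fun q : ℝ × E n => X q.1 q.2) (I ×ˢ univ)) :
    ContinuousOn (fun q : ℝ × E n => fderiv ℝ (X q.1) q.2) (I ×ˢ univ) := by
  have hIc : Convex ℝ I := hI.convex
  have hu : UniqueDiffOn ℝ (I ×ˢ (univ : Set (E n))) :=
    (uniqueDiffOn_convex hIc (hIc.nontrivial_iff_nonempty_interior.1 hI')).prod uniqueDiffOn_univ
  have h1 := hX.continuousOn_fderivWithin hu (by simp)
  refine (h1.clm_comp (continuousOn_const (c := ContinuousLinearMap.inr ℝ ℝ (E n)))).congr ?_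
  rintro ⟨t, z⟩ ht
  have h2 := (hX.differentiableOn (by simp) (t, z) ht).hasFDerivWithinAt
  have h3 : HasFDerivWithinAt (fun y : E n => (t, y)) (ContinuousLinearMap.inr ℝ ℝ (E n)) univ z :=
    (hasFDerivAt_prodMk_right t z).hasFDerivWithinAt
  have h4 := h2.comp (f := fun y : E n => (t, y)) z h3 fun y _ => ⟨ht.1, mem_univ _⟩
  exact (hasFDerivWithinAt_univ.mp h4).fderiv

end Flow

end Superform

/-! ### First order expansion of the flow in time -/

namespace Superform

section Flow

variable {n : ℕ}

/-- `F` is the flow, starting on `M`, of the smooth time dependent vector field `X`. -/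
structure IsFlowOn (I : Set ℝ) (X F : ℝ → E n → E n) (M : Set (E n)) : Prop where
  ordConnected : I.OrdConnected
  nontrivial : I.Nontrivial
  zero_mem : (0 : ℝ) ∈ I
  contDiffOn : ContDiffOn ℝ ∞ (fun q : ℝ × E n => X q.1 q.2) (I ×ˢ univ)
  init : ∀ x ∈ M, F 0 x = x
  hasDerivWithinAt : ∀ x ∈ M, ∀ t ∈ I, HasDerivWithinAt (fun s => F s x) (X t (F t x)) I t

namespace IsFlowOn

variable {I : Set ℝ} {X F : ℝ → E n → E n} {M : Set (E n)}

lemma uIcc_subset (h : IsFlowOn I X F M) {t : ℝ} (ht : t ∈ I) : uIcc 0 t ⊆ I :=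
  h.ordConnected.uIcc_subset h.zero_mem ht

lemma hasDerivWithinAt_uIcc (h : IsFlowOn I X F M) {t : ℝ} (ht : t ∈ I) {x : E n} (hx : x ∈ M)
    {s : ℝ} (hs : s ∈ uIcc 0 t) :
    HasDerivWithinAt (fun s => F s x) (X s (F s x)) (uIcc 0 t) s :=
  (h.hasDerivWithinAt x hx s (h.uIcc_subset ht hs)).mono (h.uIcc_subset ht)

lemma abs_le_of_mem_uIcc {s t : ℝ} (hs : s ∈ uIcc 0 t) : |s| ≤ |t| := by
  simpa using abs_sub_left_of_mem_uIcc hs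

/-- Points of a bounded set move little in a short time. -/
lemma exists_norm_sub_le (h : IsFlowOn I X F M) (x₀ : E n) (R : ℝ) {ε : ℝ} (hε : 0 < ε) :
    ∃ δ > 0, ∀ t ∈ I, |t| ≤ δ → ∀ x ∈ M, x ∈ Metric.closedBall x₀ R → ‖F t x - x‖ ≤ ε := by
  obtain ⟨δ, hδ, C, hC, hb⟩ := exists_norm_le_of_continuousOn h.zero_mem
    h.contDiffOn.continuousOn (isCompact_closedBall x₀ (R + ε))
  refine ⟨min δ (ε / (2 * C)), by positivity, fun t ht htδ x hxM hx => ?_⟩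
  have h1 := norm_sub_le_of_norm_deriv_le (a := 0) (b := t) (η := ε) (C := C)
    (fun s hs => h.hasDerivWithinAt_uIcc ht hxM hs)
    (by
      intro s hs hsε
      refine hb s (h.uIcc_subset ht hs)
        ((abs_le_of_mem_uIcc hs).trans (htδ.trans (min_le_left _ _))) _ ?_
      rw [h.init x hxM] at hsε
      rw [mem_closedBall_iff_norm] at hx ⊢
      have := norm_add_le (F s x - x) (x - x₀)
      rw [sub_add_sub_cancel] at this
      linarith) hε
    (by
      rw [sub_zero]
      have : C * |t| ≤ C * (ε / (2 * C)) := by gcongr; exact htδ.trans (min_le_right _ _)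
      have h2 : C * (ε / (2 * C)) = ε / 2 := by field_simp
      linarith) t right_mem_uIcc
  rwa [h.init x hxM] at h1

/-- Points arriving in a ball in a short time come from the ball of twice the radius. -/
lemma exists_mem_closedBall (h : IsFlowOn I X F M) (x₀ : E n) {r : ℝ} (hr : 0 < r) :
    ∃ δ > 0, ∀ t ∈ I, |t| ≤ δ → ∀ x ∈ M, F t x ∈ Metric.closedBall x₀ r →
      x ∈ Metric.closedBall x₀ (2 * r) := by
  obtain ⟨δ, hδ, C, hC, hb⟩ := exists_norm_le_of_continuousOn h.zero_mem
    h.contDiffOn.continuousOn (isCompact_closedBall x₀ (2 * r))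
  refine ⟨min δ (r / (2 * C)), by positivity, fun t ht htδ x hxM hx => ?_⟩
  -- The trajectory is followed backwards from its end point at time `t`, the only point known to
  -- lie in the small ball.
  have hd : ∀ s ∈ uIcc t 0, HasDerivWithinAt (fun s => F s x) (X s (F s x)) (uIcc t 0) s := by
    intro s hs
    rw [uIcc_comm] at hs ⊢
    exact h.hasDerivWithinAt_uIcc ht hxM hs
  have h1 := norm_sub_le_of_norm_deriv_le (a := t) (b := 0) (η := r) (C := C) hd
    (by
      intro s hs hsε
      rw [uIcc_comm] at hs
      refine hb s (h.uIcc_subset ht hs)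
        ((abs_le_of_mem_uIcc hs).trans (htδ.trans (min_le_left _ _))) _ ?_
      rw [mem_closedBall_iff_norm] at hx ⊢
      have := norm_add_le (F s x - F t x) (F t x - x₀)
      rw [sub_add_sub_cancel] at this
      linarith) hr
    (by
      rw [zero_sub, abs_neg]
      have : C * |t| ≤ C * (r / (2 * C)) := by gcongr; exact htδ.trans (min_le_right _ _)
      have h2 : C * (r / (2 * C)) = r / 2 := by field_simp
      linarith) 0 right_mem_uIcc
  simp only [h.init x hxM] at h1
  rw [mem_closedBall_iff_norm] at hx ⊢
  have := norm_add_le (x - F t x) (F t x - x₀)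
  rw [sub_add_sub_cancel] at this
  linarith

/-- The flow agrees with `x ↦ x + t X₀(x)` up to an error which is small compared to `t`,
together with its Lipschitz constant. -/
lemma exists_expansion (h : IsFlowOn I X F M) (x₀ : E n) (R : ℝ) {ε : ℝ} (hε : 0 < ε) :
    ∃ δ > 0, ∀ t ∈ I, |t| ≤ δ → ∀ x ∈ M, x ∈ Metric.closedBall x₀ R →
      ‖F t x - x - t • X 0 x‖ ≤ ε * |t| ∧ ∀ y ∈ M, y ∈ Metric.closedBall x₀ R →
        ‖F t x - x - t • X 0 x - (F t y - y - t • X 0 y)‖ ≤ ε * |t| * ‖x - y‖ := by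
  have hDX := continuousOn_fderiv_of_uncurry h.ordConnected h.nontrivial h.contDiffOn
  obtain ⟨δ₁, hδ₁, hb₁⟩ := exists_norm_sub_le_of_continuousOn h.zero_mem
    h.contDiffOn.continuousOn (isCompact_closedBall x₀ R) hε
  obtain ⟨δ₂, hδ₂, hb₂⟩ := exists_norm_sub_le_of_continuousOn
    (k := fun t z => fderiv ℝ (X t) z) h.zero_mem hDX
    (isCompact_closedBall x₀ R) (half_pos hε)
  obtain ⟨δ₃, hδ₃, C, hC, hb₃⟩ := exists_norm_le_of_continuousOn
    (k := fun t z => fderiv ℝ (X t) z) h.zero_mem hDX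
    (isCompact_closedBall x₀ (R + 1))
  obtain ⟨δ₄, hδ₄, hb₄⟩ := h.exists_norm_sub_le x₀ R (ε := min 1 (min δ₁ δ₂)) (by positivity)
  -- The bound `1/(2C)` makes `C |t| ≤ 1/2`, so a maximum can be absorbed below; `ε/(4C²)` makes `2
  -- C² |t| ≤ ε/2`, half of the final error.
  refine ⟨min (min δ₁ δ₂) (min (min δ₃ δ₄) (min (1 / (2 * C)) (ε / (4 * C ^ 2)))), by positivity,
    fun t ht htδ x hxM hx => ?_⟩
  simp only [le_min_iff] at htδ hb₄
  obtain ⟨⟨ht₁, ht₂⟩, ⟨ht₃, ht₄⟩, ht₅, ht₆⟩ := htδ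
  have hIs : ∀ {s}, s ∈ uIcc 0 t → s ∈ I := fun hs => h.uIcc_subset ht hs
  have hts : ∀ {s}, s ∈ uIcc 0 t → |s| ≤ |t| := fun hs => abs_le_of_mem_uIcc hs
  have hCt : C * |t| ≤ 1 / 2 := by
    calc C * |t| ≤ C * (1 / (2 * C)) := by gcongr
      _ = 1 / 2 := by field_simp
  have hCt2 : 2 * C ^ 2 * |t| ≤ ε / 2 := by
    calc 2 * C ^ 2 * |t| ≤ 2 * C ^ 2 * (ε / (4 * C ^ 2)) := by gcongr
      _ = ε / 2 := by field_simp; norm_num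
  have hde : ∀ z ∈ M, ∀ s ∈ uIcc 0 t, HasDerivWithinAt (fun s => F s z - z - s • X 0 z)
      (X s (F s z) - X 0 z) (uIcc 0 t) s := by
    intro z hz s hs
    have h1 := ((hasDerivAt_id s).smul_const (X 0 z)).hasDerivWithinAt (s := uIcc 0 t)
    rw [one_smul] at h1
    exact ((h.hasDerivWithinAt_uIcc ht hz hs).sub_const z).sub h1
  have hconv : Convex ℝ (uIcc 0 t) := convex_uIcc 0 t
  have he0 : ∀ z ∈ M, F 0 z - z - (0 : ℝ) • X 0 z = 0 := fun z hz => by simp [h.init z hz]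
  constructor
  · have h1 := hconv.norm_image_sub_le_of_norm_hasDerivWithin_le (C := ε) (hde x hxM)
      (by
        intro s hs
        have h2 := hb₁ s (hIs hs) ((hts hs).trans ht₁) x hx (F s x - x)
          (hb₄ s (hIs hs) ((hts hs).trans ht₄) x hxM hx).2.1
        rwa [add_sub_cancel] at h2) left_mem_uIcc right_mem_uIcc
    simp only [he0 x hxM, sub_zero, Real.norm_eq_abs] at h1
    exact h1
  intro y hyM hy
  have hmem1 : ∀ {z d : E n}, z ∈ Metric.closedBall x₀ R → ‖d‖ ≤ 1 →
      z + d ∈ Metric.closedBall x₀ (R + 1) := by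
    intro z d hz hd
    rw [mem_closedBall_iff_norm] at hz ⊢
    have := norm_add_le (z - x₀) d
    rw [show z + d - x₀ = z - x₀ + d by abel]
    linarith
  have hmem : ∀ z ∈ M, z ∈ Metric.closedBall x₀ R → ∀ s ∈ uIcc 0 t,
      F s z ∈ Metric.closedBall x₀ (R + 1) := by
    intro z hzM hz s hs
    have := hmem1 hz (hb₄ s (hIs hs) ((hts hs).trans ht₄) z hzM hz).1
    rwa [add_sub_cancel] at this
  have hdiff : ∀ {s}, s ∈ uIcc 0 t → Differentiable ℝ (X s) := fun hs =>
    (contDiff_of_uncurry h.contDiffOn (hIs hs)).differentiable (by simp)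
  have hlip : ∀ s ∈ uIcc 0 t, ∀ z ∈ Metric.closedBall x₀ (R + 1),
      ∀ w ∈ Metric.closedBall x₀ (R + 1), ‖X s z - X s w‖ ≤ C * ‖z - w‖ := by
    intro s hs z hz w hw
    exact (convex_closedBall x₀ (R + 1)).norm_image_sub_le_of_norm_fderiv_le
      (fun u _ => hdiff hs u) (fun u hu => hb₃ s (hIs hs) ((hts hs).trans ht₃) u hu) hw hz
  have hdh : ∀ s ∈ uIcc 0 t, HasDerivWithinAt (fun s => F s x - F s y)
      (X s (F s x) - X s (F s y)) (uIcc 0 t) s := fun s hs =>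
    (h.hasDerivWithinAt_uIcc ht hxM hs).sub (h.hasDerivWithinAt_uIcc ht hyM hs)
  have hlipF : ∀ s ∈ uIcc 0 t,
      ‖X s (F s x) - X s (F s y)‖ ≤ C * ‖F s x - F s y‖ := fun s hs =>
    hlip s hs _ (hmem x hxM hx s hs) _ (hmem y hyM hy s hs)
  -- The maximum of `‖F s x - F s y‖` over the time interval replaces Gronwall's inequality: it is
  -- at most `‖x - y‖` plus half of itself, hence at most `2 ‖x - y‖`.
  obtain ⟨s₁, hs₁, hmax⟩ := (isCompact_uIcc (a := (0 : ℝ)) (b := t)).exists_isMaxOn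
    nonempty_uIcc (ContinuousOn.norm fun s hs => (hdh s hs).continuousWithinAt)
  have hmv : ∀ s ∈ uIcc 0 t,
      ‖F s x - F s y - (x - y)‖ ≤ C * ‖F s₁ x - F s₁ y‖ * |t| := by
    intro s hs
    have h1 := hconv.norm_image_sub_le_of_norm_hasDerivWithin_le (C := C * ‖F s₁ x - F s₁ y‖) hdh
      (fun s' hs' => (hlipF s' hs').trans (mul_le_mul_of_nonneg_left (hmax hs') hC.le))
      left_mem_uIcc hs
    simp only [h.init x hxM, h.init y hyM, sub_zero, Real.norm_eq_abs] at h1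
    exact h1.trans (mul_le_mul_of_nonneg_left (hts hs) (by positivity))
  have hmax2 : ‖F s₁ x - F s₁ y‖ ≤ 2 * ‖x - y‖ := by
    have h1 := hmv s₁ hs₁
    have h2 := norm_le_norm_add_norm_sub' (F s₁ x - F s₁ y) (x - y)
    nlinarith [norm_nonneg (F s₁ x - F s₁ y)]
  have hD : ∀ s ∈ uIcc 0 t, ‖F s x - F s y - (x - y)‖ ≤ 2 * C * |t| * ‖x - y‖ := by
    intro s hs
    refine (hmv s hs).trans ?_
    have : C * ‖F s₁ x - F s₁ y‖ * |t| ≤ C * (2 * ‖x - y‖) * |t| := by gcongr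
    linarith
  have hfin := hconv.norm_image_sub_le_of_norm_hasDerivWithin_le (C := ε * ‖x - y‖)
    (fun s hs => (hde x hxM s hs).sub (hde y hyM s hs))
    (by
      intro s hs
      -- Both points are shifted by the same displacement `d`. The map `z ↦ X s (z + d) - X 0 z` has
      -- differential at most `ε/2`; the remaining drift `y + d - F s y` is bounded by `hD` and
      -- costs another `ε/2` through the Lipschitz constant `C`.
      set d := F s x - x with hd
      have hd1 : ‖d‖ ≤ 1 := (hb₄ s (hIs hs) ((hts hs).trans ht₄) x hxM hx).1
      have hd2 : ‖d‖ ≤ δ₂ := (hb₄ s (hIs hs) ((hts hs).trans ht₄) x hxM hx).2.2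
      have hFx : F s x = x + d := by rw [hd]; abel
      have hp := (convex_closedBall x₀ R).norm_image_sub_le_of_norm_hasFDerivWithin_le
        (f := fun z => X s (z + d) - X 0 z)
        (f' := fun z => fderiv ℝ (X s) (z + d) - fderiv ℝ (X 0) z) (C := ε / 2)
        (fun z _ => by
          have h1 := (hdiff hs (z + d)).hasFDerivAt.comp z
            ((hasFDerivAt_id z).add_const d)
          exact (h1.sub (hdiff left_mem_uIcc z).hasFDerivAt).hasFDerivWithinAt)
        (fun z hz => hb₂ s (hIs hs) ((hts hs).trans ht₂) z hz d hd2) hy hx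
      have hq := hlip s hs (y + d) (hmem1 hy hd1) (F s y) (hmem y hyM hy s hs)
      have hyd : y + d - F s y = F s x - F s y - (x - y) := by rw [hFx]; abel
      rw [hyd] at hq
      have hsum : X s (F s x) - X 0 x - (X s (F s y) - X 0 y) =
          (X s (x + d) - X 0 x - (X s (y + d) - X 0 y)) + (X s (y + d) - X s (F s y)) := by
        rw [hFx]; abel
      rw [hsum]
      refine (norm_add_le _ _).trans ((add_le_add hp
        (hq.trans (mul_le_mul_of_nonneg_left (hD s hs) hC.le))).trans ?_)
      nlinarith [norm_nonneg (x - y), mul_le_mul_of_nonneg_right hCt2 (norm_nonneg (x - y))])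
    left_mem_uIcc right_mem_uIcc
  simp only [Pi.sub_apply, he0 x hxM, he0 y hyM, sub_zero, Real.norm_eq_abs] at hfin
  rwa [mul_right_comm] at hfin

end IsFlowOn

end Flow

end Superform

namespace Superform

/-! ### Comparison of integrals over two nearly isometric images of a set -/

section Comparison

variable {n : ℕ}

/-- Integrals are monotone in the measure only for nonnegative functions, so `g` is shifted by its
bound `G`. -/
lemma integral_sub_integral_le_of_le_smul {α : Type*} [MeasurableSpace α] {μ ν : Measure α}
    [IsFiniteMeasure μ] [IsFiniteMeasure ν] {c : ℝ≥0} (hμν : μ ≤ c • ν)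
    {g : α → ℝ} {G : ℝ} (hg : Measurable g) (hG : ∀ x, |g x| ≤ G) :
    (∫ x, g x ∂μ + G * μ.real univ) ≤ c * (∫ x, g x ∂ν + G * ν.real univ) := by
  have hint : ∀ {κ : Measure α} [IsFiniteMeasure κ], Integrable g κ := fun {κ} _ =>
    Integrable.of_bound hg.aestronglyMeasurable G (Eventually.of_forall hG)
  have hadd : ∀ {κ : Measure α} [IsFiniteMeasure κ],
      ∫ x, (g x + G) ∂κ = ∫ x, g x ∂κ + G * κ.real univ := fun {κ} _ => by
    rw [integral_add hint (integrable_const G), integral_const, smul_eq_mul, mul_comm G]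
  rw [← hadd, ← hadd]
  have h1 : ∫ x, (g x + G) ∂μ ≤ ∫ x, (g x + G) ∂(c • ν) :=
    integral_mono_measure hμν
      (Eventually.of_forall fun x => by
        have := (abs_le.mp (hG x)).1
        simp only [Pi.zero_apply]
        linarith)
      (hint.add (integrable_const G))
  rwa [integral_smul_nnreal_measure, NNReal.smul_def, smul_eq_mul] at h1

lemma abs_integral_sub_integral_le {α : Type*} [MeasurableSpace α] {μ ν : Measure α}
    [IsFiniteMeasure μ] [IsFiniteMeasure ν] {c : ℝ≥0} (hc : 1 ≤ c)
    (hμν : μ ≤ c • ν) (hνμ : ν ≤ c • μ) {g : α → ℝ} {G : ℝ} (hg : Measurable g)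
    (hG : ∀ x, |g x| ≤ G) (hG0 : 0 ≤ G) :
    |∫ x, g x ∂μ - ∫ x, g x ∂ν| ≤ 3 * G * (c - 1) * c * ν.real univ := by
  have h1 := integral_sub_integral_le_of_le_smul hμν hg hG
  have h2 := integral_sub_integral_le_of_le_smul hνμ hg hG
  have hm1 : μ.real univ ≤ c * ν.real univ := by
    have := integral_sub_integral_le_of_le_smul hμν (g := fun _ => (0 : ℝ)) (G := 1)
      measurable_const (by simp)
    simpa using this
  have hm2 : ν.real univ ≤ c * μ.real univ := by
    have := integral_sub_integral_le_of_le_smul hνμ (g := fun _ => (0 : ℝ)) (G := 1)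
      measurable_const (by simp)
    simpa using this
  have hb : ∀ {κ : Measure α} [IsFiniteMeasure κ], |∫ x, g x ∂κ| ≤ G * κ.real univ :=
    fun {κ} _ => by
      have := norm_integral_le_of_norm_le_const (μ := κ) (f := g) (C := G)
        (Eventually.of_forall hG)
      simpa using this
  have hbμ := abs_le.mp (hb (κ := μ))
  have hbν := abs_le.mp (hb (κ := ν))
  have hc' : (1 : ℝ) ≤ c := by exact_mod_cast hc
  set a := ∫ x, g x ∂μ
  set b := ∫ x, g x ∂ν
  set u := μ.real univ
  set v := ν.real univ
  have hu : 0 ≤ u := measureReal_nonneg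
  have hv : 0 ≤ v := measureReal_nonneg
  have hGv : 0 ≤ G * v := by positivity
  have hGu : G * u ≤ G * (c * v) := by gcongr
  have hGv' : G * v ≤ G * (c * u) := by gcongr
  rw [abs_le]
  constructor
  · nlinarith [mul_le_mul_of_nonneg_left hbμ.2 (sub_nonneg.mpr hc'),
      mul_le_mul_of_nonneg_left hGu (sub_nonneg.mpr hc'), mul_nonneg (sub_nonneg.mpr hc') hGv]
  · nlinarith [mul_le_mul_of_nonneg_left hbν.2 (sub_nonneg.mpr hc'),
      mul_le_mul_of_nonneg_left hGu (sub_nonneg.mpr hc'), mul_nonneg (sub_nonneg.mpr hc') hGv,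
      mul_nonneg (mul_nonneg (sub_nonneg.mpr hc') (sub_nonneg.mpr hc')) hGv]

/-- Integrals over the images of a compact set under two maps which are close to each other and
have nearly the same metric. -/
lemma abs_setIntegral_image_sub_le (m : ℕ) {A : Set (E n)} (hA : IsCompact A)
    {f₁ f₂ : E n → E n} (hf₁ : ContinuousOn f₁ A) (hf₂ : ContinuousOn f₂ A) {a : ℝ≥0} (ha : 1 ≤ a)
    (h₁₂ : ∀ x ∈ A, ∀ y ∈ A, dist (f₁ x) (f₁ y) ≤ a * dist (f₂ x) (f₂ y))
    (h₂₁ : ∀ x ∈ A, ∀ y ∈ A, dist (f₂ x) (f₂ y) ≤ a * dist (f₁ x) (f₁ y))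
    {η : ℝ} (hη : ∀ x ∈ A, dist (f₁ x) (f₂ x) ≤ η) {g : E n → ℝ} {G : ℝ} {K : ℝ≥0}
    (hG : ∀ x, |g x| ≤ G) (hK : LipschitzWith K g) (hfin : μHE[m] (f₁ '' A) ≠ ⊤) :
    |∫ y in f₂ '' A, g y ∂μHE[m] - ∫ y in f₁ '' A, g y ∂μHE[m]| ≤
      (3 * G * (a ^ m - 1) * a ^ m + K * η) * (μHE[m]).real (f₁ '' A) := by
  have hc₁ : IsCompact (f₁ '' A) := hA.image_of_continuousOn hf₁
  have hc₂ : IsCompact (f₂ '' A) := hA.image_of_continuousOn hf₂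
  have hG0 : 0 ≤ G := (abs_nonneg _).trans (hG 0)
  rcases A.eq_empty_or_nonempty with rfl | hne
  · simp
  have hηn : 0 ≤ η := by
    obtain ⟨x, hx⟩ := hne
    exact dist_nonneg.trans (hη x hx)
  have hinvA : ∀ x ∈ A, Function.invFunOn f₁ A (f₁ x) ∈ A := fun x hx =>
    Function.invFunOn_mem ⟨x, hx, rfl⟩
  have hinv : ∀ x ∈ A, f₁ (Function.invFunOn f₁ A (f₁ x)) = f₁ x := fun x hx =>
    Function.invFunOn_eq ⟨x, hx, rfl⟩
  -- `T` is the transport `f₁ x ↦ f₂ x`, well defined on `f₁ '' A` because `h₂₁` forces `f₂` to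
  -- agree wherever `f₁` does. Pushed forward by `T`, the first measure is comparable to the second
  -- with constant `a ^ m`; replacing `g ∘ T` by `g` costs `K η`.
  set T : E n → E n := fun y => f₂ (Function.invFunOn f₁ A y) with hT
  have hTf : ∀ x ∈ A, T (f₁ x) = f₂ x := by
    intro x hx
    have h1 := h₂₁ _ (hinvA x hx) x hx
    rw [hinv x hx, dist_self, mul_zero] at h1
    exact dist_le_zero.mp h1
  have hTlip : LipschitzOnWith a T (f₁ '' A) := by
    refine LipschitzOnWith.of_dist_le_mul ?_
    rintro _ ⟨x, hx, rfl⟩ _ ⟨y, hy, rfl⟩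
    rw [hTf x hx, hTf y hy]
    exact h₂₁ x hx y hy
  have hTm : AEMeasurable T ((μHE[m]).restrict (f₁ '' A)) :=
    hTlip.continuousOn.aemeasurable hc₁.measurableSet
  set μ₁ := (μHE[m] : Measure (E n)).restrict (f₁ '' A) with hμ₁
  set μ₂ := (μHE[m] : Measure (E n)).restrict (f₂ '' A) with hμ₂
  have hfin₁ : IsFiniteMeasure μ₁ := ⟨by
    rw [hμ₁, Measure.restrict_apply_univ]; exact lt_top_iff_ne_top.mpr hfin⟩
  have hpre : ∀ S : Set (E n), T ⁻¹' S ∩ f₁ '' A = f₁ '' (A ∩ f₂ ⁻¹' S) := by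
    intro S
    ext y
    constructor
    · rintro ⟨hy, x, hx, rfl⟩
      rw [mem_preimage, hTf x hx] at hy
      exact ⟨x, ⟨hx, hy⟩, rfl⟩
    · rintro ⟨x, ⟨hx, hxS⟩, rfl⟩
      exact ⟨by rw [mem_preimage, hTf x hx]; exact hxS, x, hx, rfl⟩
  have hpre₂ : ∀ S : Set (E n), S ∩ f₂ '' A = f₂ '' (A ∩ f₂ ⁻¹' S) := by
    intro S
    rw [image_inter_preimage, inter_comm]
  have hcoe : ((a ^ m : ℝ≥0) : ℝ≥0∞) = (a : ℝ≥0∞) ^ m := by push_cast; rfl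
  have hmap : ∀ S : Set (E n), MeasurableSet S →
      μ₁.map T S = μHE[m] (f₁ '' (A ∩ f₂ ⁻¹' S)) := fun S hS => by
    rw [Measure.map_apply_of_aemeasurable hTm hS, hμ₁,
      Measure.restrict_apply₀' hc₁.measurableSet.nullMeasurableSet, hpre]
  have hle₁ : μ₁.map T ≤ (a ^ m) • μ₂ := by
    refine Measure.le_iff.mpr fun S hS => ?_
    rw [hmap S hS, Measure.smul_apply, hμ₂, Measure.restrict_apply hS, hpre₂, ENNReal.smul_def,
      hcoe, smul_eq_mul]
    exact euclideanHausdorffMeasure_image_le_of_dist_le m fun x hx y hy => h₁₂ x hx.1 y hy.1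
  have hle₂ : μ₂ ≤ (a ^ m) • μ₁.map T := by
    refine Measure.le_iff.mpr fun S hS => ?_
    rw [Measure.smul_apply, hmap S hS, hμ₂, Measure.restrict_apply hS, hpre₂, ENNReal.smul_def,
      hcoe, smul_eq_mul]
    exact euclideanHausdorffMeasure_image_le_of_dist_le m fun x hx y hy => h₂₁ x hx.1 y hy.1
  have hfinT : IsFiniteMeasure (μ₁.map T) := inferInstance
  have hfin₂ : IsFiniteMeasure μ₂ := isFiniteMeasure_of_le _ hle₂
  have hmass : (μ₁.map T).real univ = (μHE[m]).real (f₁ '' A) := by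
    rw [measureReal_def, Measure.map_apply_of_aemeasurable hTm MeasurableSet.univ, preimage_univ,
      hμ₁, Measure.restrict_apply_univ, measureReal_def]
  have h1 := abs_integral_sub_integral_le (one_le_pow₀ ha) hle₂ hle₁
    hK.continuous.measurable hG hG0
  rw [hmass, integral_map hTm hK.continuous.aestronglyMeasurable] at h1
  push_cast at h1
  have hi₁ : Integrable (fun y => g (T y)) μ₁ :=
    Integrable.of_bound (hK.continuous.measurable.comp_aemeasurable hTm).aestronglyMeasurable G
      (Eventually.of_forall fun x => hG _)
  have hi₂ : Integrable g μ₁ :=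
    Integrable.of_bound hK.continuous.aestronglyMeasurable G (Eventually.of_forall hG)
  have h2 : |∫ y, g (T y) ∂μ₁ - ∫ y, g y ∂μ₁| ≤ K * η * (μHE[m]).real (f₁ '' A) := by
    rw [← integral_sub hi₁ hi₂]
    have h3 := norm_setIntegral_le_of_norm_le_const (μ := (μHE[m] : Measure (E n)))
      (s := f₁ '' A) (f := fun y => g (T y) - g y) (C := K * η) (lt_top_iff_ne_top.mpr hfin)
      (by
        rintro _ ⟨x, hx, rfl⟩
        rw [hTf x hx, ← dist_eq_norm, dist_comm]
        exact (hK.dist_le_mul _ _).trans (mul_le_mul_of_nonneg_left (hη x hx) K.2))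
    exact h3
  calc _ ≤ _ := abs_sub_le _ (∫ y, g (T y) ∂μ₁) _
    _ ≤ _ := add_le_add h1 h2
    _ = _ := by ring

end Comparison

end Superform

/-! ### Differentiating integrals along the flow -/

namespace Superform

section FlowIntegral

variable {n : ℕ}

/-- The chord of a convex function over `[0, 1]`. It makes the error `a ^ m - 1` linear in `ε |t|`.
-/
lemma one_add_pow_le {x : ℝ} (hx : 0 ≤ x) (hx1 : x ≤ 1) (m : ℕ) :
    (1 + x) ^ m ≤ 1 + (2 ^ m - 1) * x := by
  induction m with
  | zero => simp
  | succ k ih =>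
    have h2 : (1 : ℝ) ≤ 2 ^ k := one_le_pow₀ one_le_two
    calc (1 + x) ^ (k + 1) = (1 + x) ^ k * (1 + x) := pow_succ _ _
      _ ≤ (1 + (2 ^ k - 1) * x) * (1 + x) := by gcongr
      _ ≤ 1 + (2 ^ (k + 1) - 1) * x := by
        rw [pow_succ]
        nlinarith [mul_nonneg (mul_nonneg (sub_nonneg.mpr h2) hx) (sub_nonneg.mpr hx1)]

namespace IsFlowOn

variable {I : Set ℝ} {X F : ℝ → E n → E n} {M : Set (E n)}

/-- Along a flow, integrals over the image of a compact set change to first order as under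
`x ↦ x + t X₀(x)`. -/
lemma exists_abs_setIntegral_sub_le (h : IsFlowOn I X F M) (m : ℕ) (hM : IsClosed M) (x₀ : E n)
    (R : ℝ) {g : E n → ℝ} {G : ℝ} {K : ℝ≥0} (hG : ∀ x, |g x| ≤ G) (hK : LipschitzWith K g)
    (hfin : μHE[m] (M ∩ Metric.closedBall x₀ R) ≠ ⊤) {ε : ℝ} (hε : 0 < ε) :
    ∃ δ > 0, ∀ t ∈ I, |t| ≤ δ →
      |∫ y in F t '' (M ∩ Metric.closedBall x₀ R), g y ∂μHE[m] -
        ∫ y in (fun x => x + t • X 0 x) '' (M ∩ Metric.closedBall x₀ R), g y ∂μHE[m]| ≤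
      (12 * G * 2 ^ m * 2 ^ m + K) * (2 ^ m * (μHE[m]).real (M ∩ Metric.closedBall x₀ R)) * ε *
        |t| := by
  set A := M ∩ Metric.closedBall x₀ R with hA
  have hAc : IsCompact A := (isCompact_closedBall x₀ R).inter_left hM
  have hX0 : ContDiff ℝ ∞ (X 0) := contDiff_of_uncurry h.contDiffOn h.zero_mem
  have hG0 : 0 ≤ G := (abs_nonneg _).trans (hG 0)
  obtain ⟨C, hC⟩ := (isCompact_closedBall x₀ R).exists_bound_of_continuousOn
    (hX0.continuous_fderiv (by simp)).continuousOn
  have hXlip : ∀ x ∈ A, ∀ y ∈ A, ‖X 0 x - X 0 y‖ ≤ (|C| + 1) * ‖x - y‖ := fun x hx y hy =>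
    ((convex_closedBall x₀ R).norm_image_sub_le_of_norm_fderiv_le
      (fun u _ => hX0.differentiable (by simp) u) hC hy.2 hx.2).trans
      (mul_le_mul_of_nonneg_right (by linarith [le_abs_self C]) (norm_nonneg _))
  obtain ⟨δ, hδ, hexp⟩ := h.exists_expansion x₀ R hε
  refine ⟨min δ (min (1 / (2 * (|C| + 1))) (1 / (4 * ε))), by positivity, fun t ht htδ => ?_⟩
  simp only [le_min_iff] at htδ
  obtain ⟨ht₁, ht₂, ht₃⟩ := htδ
  have hCt : |t| * (|C| + 1) ≤ 1 / 2 := by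
    calc |t| * (|C| + 1) ≤ 1 / (2 * (|C| + 1)) * (|C| + 1) := by gcongr
      _ = 1 / 2 := by field_simp
  have hεt : 4 * (ε * |t|) ≤ 1 := by
    calc 4 * (ε * |t|) ≤ 4 * (ε * (1 / (4 * ε))) := by gcongr
      _ = 1 := by field_simp
  set s := ε * |t| with hs
  have hs0 : 0 ≤ s := by positivity
  set f₁ : E n → E n := fun x => x + t • X 0 x with hf₁
  have hd₁ : ∀ x ∈ A, ∀ y ∈ A, ‖f₁ x - f₁ y - (x - y)‖ ≤ 1 / 2 * ‖x - y‖ := by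
    intro x hx y hy
    have h1 : f₁ x - f₁ y - (x - y) = t • (X 0 x - X 0 y) := by
      simp only [hf₁, smul_sub]; abel
    rw [h1, norm_smul, Real.norm_eq_abs]
    calc |t| * ‖X 0 x - X 0 y‖ ≤ |t| * ((|C| + 1) * ‖x - y‖) := by gcongr; exact hXlip x hx y hy
      _ = |t| * (|C| + 1) * ‖x - y‖ := by ring
      _ ≤ _ := by gcongr
  have hd₂ : ∀ x ∈ A, ∀ y ∈ A, ‖F t x - F t y - (f₁ x - f₁ y)‖ ≤ s * ‖x - y‖ := by
    intro x hx y hy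
    have h1 := (hexp t ht ht₁ x hx.1 hx.2).2 y hy.1 hy.2
    rwa [show F t x - x - t • X 0 x - (F t y - y - t • X 0 y) = F t x - F t y - (f₁ x - f₁ y) by
      simp only [hf₁]; abel] at h1
  have hlow : ∀ x ∈ A, ∀ y ∈ A, ‖x - y‖ ≤ 2 * ‖f₁ x - f₁ y‖ := by
    intro x hx y hy
    have h1 := norm_le_norm_add_norm_sub (f₁ x - f₁ y) (x - y)
    have h2 := hd₁ x hx y hy
    linarith
  have hup : ∀ x ∈ A, ∀ y ∈ A, ‖f₁ x - f₁ y‖ ≤ 2 * ‖x - y‖ := by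
    intro x hx y hy
    have h1 := norm_le_norm_add_norm_sub' (f₁ x - f₁ y) (x - y)
    have h2 := hd₁ x hx y hy
    linarith [norm_nonneg (x - y)]
  -- Since `f₁` shrinks distances at most by a factor `2`, `F t` differs from `f₁` by at most `2 s`
  -- times the distance of the images under `f₁`. Both `1 + 2 s` and `1 / (1 - 2 s)` are at most `1
  -- + 4 s` when `4 s ≤ 1`.
  set a : ℝ≥0 := ⟨1 + 4 * s, by positivity⟩ with ha
  have ha' : (a : ℝ) = 1 + 4 * s := rfl
  have h₂₁ : ∀ x ∈ A, ∀ y ∈ A, dist (F t x) (F t y) ≤ a * dist (f₁ x) (f₁ y) := by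
    intro x hx y hy
    rw [dist_eq_norm, dist_eq_norm, ha']
    have h1 := norm_le_norm_add_norm_sub' (F t x - F t y) (f₁ x - f₁ y)
    have h2 := hd₂ x hx y hy
    have h3 := mul_le_mul_of_nonneg_left (hlow x hx y hy) hs0
    nlinarith [norm_nonneg (f₁ x - f₁ y)]
  have h₁₂ : ∀ x ∈ A, ∀ y ∈ A, dist (f₁ x) (f₁ y) ≤ a * dist (F t x) (F t y) := by
    intro x hx y hy
    rw [dist_eq_norm, dist_eq_norm, ha']
    have h1 := norm_le_norm_add_norm_sub (F t x - F t y) (f₁ x - f₁ y)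
    have h2 := hd₂ x hx y hy
    have h3 := mul_le_mul_of_nonneg_left (hlow x hx y hy) hs0
    have h4 : (1 - 2 * s) * ‖f₁ x - f₁ y‖ ≤ ‖F t x - F t y‖ := by linarith
    have h5 := mul_le_mul_of_nonneg_left h4 (show 0 ≤ 1 + 4 * s by positivity)
    nlinarith [norm_nonneg (f₁ x - f₁ y), mul_nonneg hs0 (norm_nonneg (f₁ x - f₁ y)),
      mul_le_mul_of_nonneg_right hεt (mul_nonneg hs0 (norm_nonneg (f₁ x - f₁ y)))]
  have hf₁c : ContinuousOn f₁ A := by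
    have := hX0.continuous
    exact (continuous_id.add (this.const_smul t)).continuousOn
  have hFc : ContinuousOn (F t) A := by
    have : LipschitzOnWith (a * 2) (F t) A := LipschitzOnWith.of_dist_le_mul fun x hx y hy => by
      refine (h₂₁ x hx y hy).trans ?_
      push_cast
      rw [mul_assoc]
      gcongr
      rw [dist_eq_norm, dist_eq_norm]
      exact hup x hx y hy
    exact this.continuousOn
  have hη : ∀ x ∈ A, dist (f₁ x) (F t x) ≤ s := by
    intro x hx
    have h1 := (hexp t ht ht₁ x hx.1 hx.2).1
    rw [dist_comm, dist_eq_norm]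
    rwa [show F t x - x - t • X 0 x = F t x - f₁ x by simp only [hf₁]; abel] at h1
  have hmeas : μHE[m] (f₁ '' A) ≤ ((2 : ℝ≥0) : ℝ≥0∞) ^ m * μHE[m] A := by
    have := euclideanHausdorffMeasure_image_le_of_dist_le (a := 2) (f := f₁) (g := id) (s := A) m
      (fun x hx y hy => by
        rw [dist_eq_norm, dist_eq_norm]
        exact hup x hx y hy)
    rwa [image_id] at this
  have hfin2 : ((2 : ℝ≥0) : ℝ≥0∞) ^ m * μHE[m] A ≠ ⊤ :=
    ENNReal.mul_ne_top (ENNReal.pow_ne_top ENNReal.coe_ne_top) hfin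
  have hreal : (μHE[m]).real (f₁ '' A) ≤ 2 ^ m * (μHE[m]).real A := by
    have := ENNReal.toReal_mono hfin2 hmeas
    rwa [ENNReal.toReal_mul, ENNReal.toReal_pow] at this
  have hone : (1 : ℝ≥0) ≤ a := by
    rw [← NNReal.coe_le_coe, ha', NNReal.coe_one]
    linarith
  have hmain := abs_setIntegral_image_sub_le m hAc hf₁c hFc hone h₁₂ h₂₁ hη hG hK
    (ne_top_of_le_ne_top hfin2 hmeas)
  refine hmain.trans ?_
  rw [ha']
  have hpow := one_add_pow_le (x := 4 * s) (by positivity) hεt m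
  have hpow2 : (1 + 4 * s) ^ m ≤ 2 ^ m := pow_le_pow_left₀ (by positivity) (by linarith) m
  have hpow1 : (1 + 4 * s) ^ m - 1 ≤ 2 ^ m * (4 * s) := by linarith [mul_nonneg zero_le_four hs0]
  have hone' : (1 : ℝ) ≤ (1 + 4 * s) ^ m := one_le_pow₀ (by linarith)
  calc (3 * G * ((1 + 4 * s) ^ m - 1) * (1 + 4 * s) ^ m + K * s) * (μHE[m]).real (f₁ '' A)
      ≤ (3 * G * (2 ^ m * (4 * s)) * 2 ^ m + K * s) * (2 ^ m * (μHE[m]).real A) := by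
        gcongr
    _ = _ := by rw [hs]; ring

/-- The derivative at `t = 0` of integrals over the images of a closed set under a flow. -/
lemma hasDerivWithinAt_setIntegral (h : IsFlowOn I X F M) {m : ℕ} (hM : IsClosed M)
    (hMt : ∀ t ∈ I, MeasurableSet (F t '' M)) {x₀ : E n} {r : ℝ} (hr : 0 < r) {g : E n → ℝ}
    (hg : ContDiff ℝ 1 g) (hgr : tsupport g ⊆ Metric.closedBall x₀ r)
    (hfin : μHE[m] (M ∩ Metric.closedBall x₀ (2 * r)) ≠ ⊤) {D : ℝ}
    (hD : HasDerivAt (fun t : ℝ => ∫ y in (fun x => x + t • X 0 x) ''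
      (M ∩ Metric.closedBall x₀ (2 * r)), g y ∂μHE[m]) D 0) :
    HasDerivWithinAt (fun t => ∫ y in F t '' M, g y ∂μHE[m]) D I 0 := by
  have hgc : HasCompactSupport g :=
    (isCompact_closedBall x₀ r).of_isClosed_subset (isClosed_tsupport g) hgr
  obtain ⟨K, hK⟩ := hg.lipschitzWith_of_hasCompactSupport hgc one_ne_zero
  obtain ⟨G, hG⟩ := hgc.exists_bound_of_continuous hg.continuous
  have hG0 : 0 ≤ G := (norm_nonneg _).trans (hG 0)
  set A := M ∩ Metric.closedBall x₀ (2 * r) with hA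
  have hF0 : F 0 '' A = A := by
    rw [image_congr fun x hx => h.init x hx.1, image_id']
  have hΦ0 : (fun x => x + (0 : ℝ) • X 0 x) '' A = A := by simp
  -- The difference is at most `B ε |t|` for every `ε` once `t` is small, that is, `o(t)`. Hence
  -- both integrals have the same derivative at `0`.
  have hdiff : HasDerivWithinAt (fun t => ∫ y in F t '' A, g y ∂μHE[m] -
      ∫ y in (fun x => x + t • X 0 x) '' A, g y ∂μHE[m]) 0 I 0 := by
    rw [hasDerivWithinAt_iff_isLittleO, Asymptotics.isLittleO_iff]
    intro c hc
    set B := (12 * G * 2 ^ m * 2 ^ m + K) * (2 ^ m * (μHE[m]).real A) with hB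
    have hB0 : 0 ≤ B := by positivity
    obtain ⟨δ, hδ, h1⟩ := h.exists_abs_setIntegral_sub_le m hM x₀ (2 * r) hG hK hfin
      (ε := c / (B + 1)) (by positivity)
    filter_upwards [self_mem_nhdsWithin,
      mem_nhdsWithin_of_mem_nhds (Metric.closedBall_mem_nhds (0 : ℝ) hδ)] with t ht htδ
    rw [hF0, hΦ0, sub_self, sub_zero, smul_zero, sub_zero, sub_zero]
    refine (h1 t ht (by simpa using htδ)).trans ?_
    rw [Real.norm_eq_abs]
    refine mul_le_mul_of_nonneg_right ?_ (abs_nonneg t)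
    rw [← hB, mul_div_assoc', div_le_iff₀ (by positivity)]
    nlinarith
  have hsum := hdiff.add hD.hasDerivWithinAt
  rw [zero_add] at hsum
  obtain ⟨δ, hδ, hback⟩ := h.exists_mem_closedBall x₀ hr
  -- Points reaching the support of `g` in a short time start in the ball of radius `2 r`, so the
  -- rest of `M` does not contribute.
  have hev : ∀ t ∈ I, |t| ≤ δ → ∫ y in F t '' M, g y ∂μHE[m] = ∫ y in F t '' A, g y ∂μHE[m] := by
    intro t ht htδ
    refine setIntegral_eq_of_subset_of_forall_sdiff_eq_zero (hMt t ht)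
      (image_mono inter_subset_left) ?_
    rintro _ ⟨⟨x, hx, rfl⟩, hxA⟩
    by_contra hne
    have h1 := hgr (subset_tsupport g (Function.mem_support.mpr hne))
    exact hxA ⟨x, ⟨hx, hback t ht htδ x hx h1⟩, rfl⟩
  refine (hsum.congr_of_eventuallyEq ?_ ?_)
  · filter_upwards [self_mem_nhdsWithin,
      mem_nhdsWithin_of_mem_nhds (Metric.closedBall_mem_nhds (0 : ℝ) hδ)] with t ht htδ
    rw [hev t ht (by simpa using htδ)]
    simp
  · rw [hev 0 h.zero_mem (by simpa using hδ.le)]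
    simp

end IsFlowOn

end FlowIntegral

end Superform
open scoped Manifold

namespace Superform

/-! ### The evolution of surface integrals under the mean curvature flow -/

section Evolution

variable {n m : ℕ}

lemma MovesByMeanCurvature.exists_isFlowOn {I : Set ℝ} (hI : I.OrdConnected)
    (hI' : I.Nontrivial) (h0 : (0 : ℝ) ∈ I) {M : ℝ → Set (E n)}
    (hflow : MovesByMeanCurvature m I M) :
    ∃ X F : ℝ → E n → E n, IsFlowOn I X F (M 0) ∧ (∀ t ∈ I, F t '' M 0 = M t) ∧
      ∀ x ∈ M 0, X 0 x = -meanCurvature m (M 0) x := by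
  obtain ⟨V, F, hV, hVM, hF0, hF, hFM⟩ := hflow
  exact ⟨fun t x => -V t x, F, ⟨hI, hI', h0, hV.neg, hF0, hF⟩, hFM, fun x hx =>
    congrArg Neg.neg (hVM 0 h0 x hx)⟩

lemma IsClosedSubmanifold.measure_inter_ne_top {M : Set (E n)} (hM : IsClosedSubmanifold m M)
    {K : Set (E n)} (hK : IsCompact K) : μHE[m] (M ∩ K) ≠ ⊤ := by
  have := hM.isLocallyFiniteMeasure
  have h1 := hK.measure_lt_top (μ := μHE[m].restrict M)
  rw [Measure.restrict_apply hK.measurableSet, inter_comm] at h1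
  exact h1.ne

lemma contDiff_gradient {f : E n → ℝ} (hf : ContDiff ℝ ∞ f) : ContDiff ℝ ∞ (∇ f) :=
  contDiffOn_univ.mp (contDiffOn_gradient isOpen_univ hf.contDiffOn)

lemma tsupport_gradient_subset (f : E n → ℝ) : tsupport (∇ f) ⊆ tsupport f := by
  refine closure_minimal (fun y hy => ?_) (isClosed_tsupport f)
  by_contra h
  refine hy ?_
  rw [gradient, image_eq_zero_of_notMem_tsupport fun h' => h (tsupport_fderiv_subset ℝ h'),
    map_zero]

lemma tanTrace_sum {p : ℕ} {ι : Type*} (s : Finset ι) (N : Fin p → E n)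
    (L : ι → E n →L[ℝ] E n) : tanTrace N (∑ i ∈ s, L i) = ∑ i ∈ s, tanTrace N (L i) := by
  simp only [tanTrace]
  rw [Finset.sum_sub_distrib, Finset.sum_comm]
  congr 1
  · simp
  · simp [sum_inner]

lemma tanTrace_zero {p : ℕ} (N : Fin p → E n) : tanTrace N (0 : E n →L[ℝ] E n) = 0 := by
  simp [tanTrace]

variable {I : Set ℝ} {M : ℝ → Set (E n)}

/-- The evolution of the integral of a function with small support. -/
lemma exists_hasDerivWithinAt_setIntegral (hI : I.OrdConnected) (hI' : I.Nontrivial)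
    (h0 : (0 : ℝ) ∈ I) (hM : ∀ t ∈ I, IsClosedSubmanifold m (M t))
    (hflow : MovesByMeanCurvature m I M) (x₀ : E n) :
    ∃ r > 0, ∀ g : E n → ℝ, ContDiff ℝ ∞ g → tsupport g ⊆ Metric.closedBall x₀ r →
      HasDerivWithinAt (fun t => ∫ y in M t, g y ∂μHE[m])
        (-(∫ y in M 0, ‖meanCurvature m (M 0) y‖ ^ 2 * g y ∂μHE[m]) -
          ∫ y in M 0, tanTrace (conormal m (M 0) y) (fderiv ℝ (∇ g) y) ∂μHE[m]) I 0 := by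
  obtain ⟨X, F, hF, hFM, hXH⟩ := hflow.exists_isFlowOn hI hI' h0
  have hM0 := hM 0 h0
  have hX : ContDiff ℝ ∞ (X 0) := contDiff_of_uncurry hF.contDiffOn h0
  have hMt : ∀ t ∈ I, MeasurableSet (F t '' M 0) := fun t ht => by
    rw [hFM t ht]; exact (hM t ht).isClosed.measurableSet
  have hcongr : ∀ {g : E n → ℝ} {D : ℝ},
      HasDerivWithinAt (fun t => ∫ y in F t '' M 0, g y ∂μHE[m]) D I 0 →
      HasDerivWithinAt (fun t => ∫ y in M t, g y ∂μHE[m]) D I 0 := fun {g D} h =>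
    h.congr (fun t ht => by rw [hFM t ht]) (by rw [hFM 0 h0])
  by_cases hx : x₀ ∈ M 0
  · obtain ⟨W, O, φ, π, hxW, hW⟩ := hM0.exists_isLocalParam hx
    obtain ⟨U, hxU, hU⟩ := hM0.exists_isNormalFrame hx
    obtain ⟨R, hR, hRWU⟩ := Metric.nhds_basis_closedBall.mem_iff.mp
      ((hW.isOpen_target.inter hU.isOpen).mem_nhds ⟨hxW, hxU⟩)
    -- The radius is halved because the flow argument works on the ball of twice the radius, which
    -- must still lie in `W ∩ U`.
    refine ⟨R / 2, half_pos hR, fun g hg hgr => hcongr ?_⟩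
    have h2 : 2 * (R / 2) = R := by ring
    have hgc : HasCompactSupport g :=
      (isCompact_closedBall x₀ (R / 2)).of_isClosed_subset (isClosed_tsupport g) hgr
    have hgR : tsupport g ⊆ Metric.closedBall x₀ R :=
      hgr.trans (Metric.closedBall_subset_closedBall (by linarith))
    have hAc : IsCompact (M 0 ∩ Metric.closedBall x₀ R) :=
      (isCompact_closedBall x₀ R).inter_left hM0.isClosed
    obtain ⟨C, hC⟩ := (isCompact_closedBall x₀ R).exists_bound_of_continuousOn
      (hX.continuous_fderiv (by simp)).continuousOn
    have hXlip : LipschitzOnWith (Real.toNNReal C) (X 0) (M 0 ∩ Metric.closedBall x₀ R) :=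
      LipschitzOnWith.of_dist_le_mul fun x hx y hy => by
        rw [dist_eq_norm, dist_eq_norm]
        exact (convex_closedBall x₀ R).norm_image_sub_le_of_norm_fderiv_le
          (fun u _ => hX.differentiable (by simp) u)
          (fun u hu => (hC u hu).trans (Real.le_coe_toNNReal C)) hy.2 hx.2
    have hD := hM0.hasDerivAt_setIntegral_image hW (hX.of_le (by simp)) (g := g)
      (hg.of_le (by simp)) hAc (fun y hy => ⟨hy.1, (hRWU hy.2).1⟩) hXlip
    have hmain := hF.hasDerivWithinAt_setIntegral (m := m) hM0.isClosed hMt (half_pos hR)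
      (hg.of_le (by simp)) hgr (hM0.measure_inter_ne_top (isCompact_closedBall _ _)) (by rw [h2]; exact hD)
    convert hmain using 1
    have hg0 : ∀ y, y ∉ Metric.closedBall x₀ R → g y = 0 ∧ fderiv ℝ g y = 0 := fun y hy =>
      ⟨image_eq_zero_of_notMem_tsupport fun h => hy (hgR h),
        image_eq_zero_of_notMem_tsupport fun h => hy (hgR (tsupport_fderiv_subset ℝ h))⟩
    -- The velocity equals `-H` on `M`, hence is normal, and its tangential divergence is `⟨-H, H⟩`.
    have hXtr : ∀ y ∈ M 0, tanTrace (conormal m (M 0) y) (fderiv ℝ (X 0) y) =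
        -‖meanCurvature m (M 0) y‖ ^ 2 := by
      intro y hy
      rw [hM0.tanTrace_fderiv_of_normal hy (hX.differentiable (by simp) y), hXH y hy,
        inner_neg_left, real_inner_self_eq_norm_sq]
      refine Eventually.of_forall fun z hz => ?_
      rw [hXH z hz, meanCurvature]
      exact Submodule.neg_mem _ (Submodule.sum_mem _ fun j _ =>
        Submodule.smul_mem _ _ (Submodule.subset_span (mem_range_self j)))
    have hdiv := hM0.integral_tanTrace hW hU ((contDiff_gradient hg).of_le (by simp))
      (hgc.of_isClosed_subset (isClosed_tsupport _) (tsupport_gradient_subset g))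
      ((tsupport_gradient_subset g).trans (hgR.trans fun y hy => (hRWU hy).1))
      ((tsupport_gradient_subset g).trans (hgR.trans fun y hy => (hRWU hy).2))
    have hgrad : ∀ y v, ⟪∇ g y, v⟫ = fderiv ℝ g y v := fun y v => by
      rw [gradient, InnerProductSpace.toDual_symm_apply]
    rw [hdiv, ← setIntegral_eq_of_subset_of_forall_sdiff_eq_zero hM0.isClosed.measurableSet
      (inter_subset_left (t := Metric.closedBall x₀ R)) (fun y hy => by
        have hy' : y ∉ Metric.closedBall x₀ R := fun h => hy.2 ⟨hy.1, h⟩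
        rw [(hg0 y hy').1, (hg0 y hy').2]; simp)]
    have hi₁ : Integrable (fun y => -(‖X 0 y‖ ^ 2 * g y)) (μHE[m].restrict (M 0)) := by
      refine hM0.integrable ((hX.continuous.norm.pow 2).mul hg.continuous).neg.continuousOn ?_
      exact hgc.mono fun y hy h => hy (by simp [h])
    have hi₂ : Integrable (fun y => fderiv ℝ g y (X 0 y)) (μHE[m].restrict (M 0)) := by
      refine hM0.integrable
        ((hg.continuous_fderiv (by simp)).clm_apply hX.continuous).continuousOn ?_
      exact (hgc.fderiv ℝ).mono fun y hy h => hy (by simp [h])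
    have e₁ : -(∫ y in M 0, ‖meanCurvature m (M 0) y‖ ^ 2 * g y ∂μHE[m]) =
        ∫ y in M 0, -(‖X 0 y‖ ^ 2 * g y) ∂μHE[m] := by
      rw [integral_neg]
      congr 1
      refine setIntegral_congr_fun hM0.isClosed.measurableSet fun y hy => ?_
      simp only [hXH y hy, norm_neg]
    have e₂ : -(∫ y in M 0, ⟪∇ g y, meanCurvature m (M 0) y⟫ ∂μHE[m]) =
        ∫ y in M 0, fderiv ℝ g y (X 0 y) ∂μHE[m] := by
      rw [← integral_neg]
      refine setIntegral_congr_fun hM0.isClosed.measurableSet fun y hy => ?_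
      simp only [hXH y hy, hgrad, map_neg]
    rw [sub_eq_add_neg, e₁, e₂, ← integral_add hi₁ hi₂]
    refine setIntegral_congr_fun hM0.isClosed.measurableSet fun y hy => ?_
    rw [hXtr y hy, hXH y hy, norm_neg]
    ring
  -- Away from `M 0` both sides vanish: for a short time nothing flows into the support of `g`.
  · obtain ⟨R, hR, hRM⟩ := Metric.nhds_basis_closedBall.mem_iff.mp
      (hM0.isClosed.isOpen_compl.mem_nhds hx)
    refine ⟨R / 2, half_pos hR, fun g hg hgr => hcongr ?_⟩
    have h2 : 2 * (R / 2) = R := by ring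
    have hempty : M 0 ∩ Metric.closedBall x₀ R = ∅ := by
      exact eq_empty_of_forall_notMem fun y hy => hRM hy.2 hy.1
    have hnot : ∀ y ∈ M 0, y ∉ tsupport g := fun y hy h =>
      hRM (Metric.closedBall_subset_closedBall (by linarith) (hgr h)) hy
    have hz : ∀ y ∈ M 0, g y = 0 ∧ fderiv ℝ (∇ g) y = 0 := fun y hy =>
      ⟨image_eq_zero_of_notMem_tsupport (hnot y hy), image_eq_zero_of_notMem_tsupport fun h =>
        hnot y hy (tsupport_gradient_subset g (tsupport_fderiv_subset ℝ h))⟩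
    have hmain := hF.hasDerivWithinAt_setIntegral (m := m) (D := 0) hM0.isClosed hMt (half_pos hR)
      (hg.of_le (by simp)) hgr (by rw [h2, hempty]; simp)
      (by rw [h2, hempty]; simpa using hasDerivAt_const (0 : ℝ) (0 : ℝ))
    convert hmain using 1
    rw [setIntegral_eq_zero_of_forall_eq_zero fun y hy => by rw [(hz y hy).1, mul_zero],
      setIntegral_eq_zero_of_forall_eq_zero fun y hy => by rw [(hz y hy).2, tanTrace_zero]]
    simp

lemma exists_finite_decomposition {g : E n → ℝ} (hg : ContDiff ℝ ∞ g) (hgc : HasCompactSupport g)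
    {r : E n → ℝ} (hr : ∀ x, 0 < r x) :
    ∃ (s : Finset (E n)) (G : s → E n → ℝ), (∀ i, ContDiff ℝ ∞ (G i)) ∧
      (∀ i, HasCompactSupport (G i)) ∧
      (∀ i : s, tsupport (G i) ⊆ Metric.closedBall (i : E n) (r i)) ∧
      ∀ y, g y = ∑ i, G i y := by
  obtain ⟨s, hs⟩ := hgc.elim_finite_subcover (fun x : E n => Metric.ball x (r x))
    (fun x => Metric.isOpen_ball) fun x _ => mem_iUnion.mpr ⟨x, Metric.mem_ball_self (hr x)⟩
  obtain ⟨f, hf⟩ := SmoothPartitionOfUnity.exists_isSubordinate 𝓘(ℝ, E n)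
    (isClosed_tsupport g) (fun i : s => Metric.ball (i : E n) (r i))
    (fun i => Metric.isOpen_ball) (by simpa [iUnion_subtype] using hs)
  refine ⟨s, fun i y => f i y * g y, fun i => (f i).contMDiff.contDiff.mul hg,
    fun i => hgc.mul_left,
    fun i => tsupport_mul_subset_left.trans ((hf i).trans Metric.ball_subset_closedBall), ?_⟩
  intro y
  rw [← Finset.sum_mul]
  by_cases hy : y ∈ tsupport g
  · have := f.sum_eq_one hy
    rw [finsum_eq_sum_of_fintype] at this
    rw [this, one_mul]
  · rw [image_eq_zero_of_notMem_tsupport hy, mul_zero]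

lemma fderiv_gradient_sum {ι : Type*} [Fintype ι] {g : E n → ℝ} {G : ι → E n → ℝ}
    (hG : ∀ i, ContDiff ℝ ∞ (G i)) (hsum : ∀ y, g y = ∑ i, G i y) (y : E n) :
    fderiv ℝ (∇ g) y = ∑ i, fderiv ℝ (∇ (G i)) y := by
  have h1 : ∇ g = fun y => ∑ i, ∇ (G i) y := by
    funext z
    simp only [gradient]
    rw [← map_sum]
    congr 1
    rw [show g = fun y => ∑ i, G i y from funext hsum]
    exact fderiv_fun_sum fun i _ => (hG i).differentiable (by simp) z
  rw [h1]
  exact fderiv_fun_sum fun i _ => (contDiff_gradient (hG i)).differentiable (by simp) y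

/-- The evolution of the integral of a test function under the mean curvature flow. -/
theorem hasDerivWithinAt_setIntegral_of_movesByMeanCurvature (hI : I.OrdConnected)
    (hI' : I.Nontrivial) (h0 : (0 : ℝ) ∈ I) (hM : ∀ t ∈ I, IsClosedSubmanifold m (M t))
    (hflow : MovesByMeanCurvature m I M) {g : E n → ℝ} (hg : ContDiff ℝ ∞ g)
    (hgc : HasCompactSupport g) :
    HasDerivWithinAt (fun t => ∫ y in M t, g y ∂μHE[m])
      (-(∫ y in M 0, ‖meanCurvature m (M 0) y‖ ^ 2 * g y ∂μHE[m]) -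
        ∫ y in M 0, tanTrace (conormal m (M 0) y) (fderiv ℝ (∇ g) y) ∂μHE[m]) I 0 := by
  have hM0 := hM 0 h0
  choose r hr hloc using exists_hasDerivWithinAt_setIntegral hI hI' h0 hM hflow
  obtain ⟨s, G, hGs, hGc, hGb, hsum⟩ := exists_finite_decomposition hg hgc hr
  obtain ⟨X, F, hF, -, hXH⟩ := hflow.exists_isFlowOn hI hI' h0
  have hX : ContDiff ℝ ∞ (X 0) := contDiff_of_uncurry hF.contDiffOn h0
  -- Continuity of `|H|²` comes from the smooth ambient field that restricts to `-H` on `M 0`.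
  have hHc : ContinuousOn (fun y => ‖meanCurvature m (M 0) y‖ ^ 2) (M 0) :=
    (hX.continuous.norm.pow 2).continuousOn.congr fun y hy => by
      simp only [Pi.pow_apply, hXH y hy, norm_neg]
  have hi₁ : ∀ i, Integrable (fun y => ‖meanCurvature m (M 0) y‖ ^ 2 * G i y)
      (μHE[m].restrict (M 0)) := fun i =>
    hM0.integrable (hHc.mul (hGs i).continuous.continuousOn)
      ((hGc i).mono fun y hy h => hy (by simp only [h, mul_zero]))
  have hi₂ : ∀ i, Integrable (fun y => tanTrace (conormal m (M 0) y) (fderiv ℝ (∇ (G i)) y))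
      (μHE[m].restrict (M 0)) := fun i =>
    hM0.integrable (hM0.continuousOn_tanTrace
      ((contDiff_gradient (hGs i)).continuous_fderiv (by simp)).continuousOn)
      ((HasCompactSupport.fderiv ℝ ((hGc i).of_isClosed_subset (isClosed_tsupport _)
        (tsupport_gradient_subset (G i)))).mono fun y hy h => hy (by simp only [h, tanTrace_zero]))
  have e₁ : ∫ y in M 0, ‖meanCurvature m (M 0) y‖ ^ 2 * g y ∂μHE[m] =
      ∑ i, ∫ y in M 0, ‖meanCurvature m (M 0) y‖ ^ 2 * G i y ∂μHE[m] := by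
    rw [← integral_finsetSum _ fun i _ => hi₁ i]
    refine integral_congr_ae (Eventually.of_forall fun y => ?_)
    simp only
    rw [hsum y, Finset.mul_sum]
  have e₂ : ∫ y in M 0, tanTrace (conormal m (M 0) y) (fderiv ℝ (∇ g) y) ∂μHE[m] =
      ∑ i, ∫ y in M 0, tanTrace (conormal m (M 0) y) (fderiv ℝ (∇ (G i)) y) ∂μHE[m] := by
    rw [← integral_finsetSum _ fun i _ => hi₂ i]
    refine integral_congr_ae (Eventually.of_forall fun y => ?_)
    simp only
    rw [fderiv_gradient_sum hGs hsum y, tanTrace_sum]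
  rw [e₁, e₂, ← Finset.sum_neg_distrib, ← Finset.sum_sub_distrib]
  have e₀ : ∀ t ∈ I, ∫ y in M t, g y ∂μHE[m] = ∑ i, ∫ y in M t, G i y ∂μHE[m] := by
    intro t ht
    rw [← integral_finsetSum _ fun i _ => (hM t ht).integrable
      (hGs i).continuous.continuousOn (hGc i)]
    exact integral_congr_ae (Eventually.of_forall hsum)
  exact (HasDerivWithinAt.fun_sum fun (i : s) _ => hloc (i : E n) (G i) (hGs i) (hGb i)).congr e₀ (e₀ 0 h0)

end Evolution

end Superform

namespace Superform

/-! ### Powers of sums of commuting elements of square zero -/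

section SquareZero

variable {A : Type*} [Ring A]

lemma add_pow_succ_of_mul_self_eq_zero {x y : A} (h : Commute x y) (hy : y * y = 0) (k : ℕ) :
    (x + y) ^ (k + 1) = x ^ (k + 1) + (k + 1) • (x ^ k * y) := by
  induction k with
  | zero => simp
  | succ k ih =>
    have h1 : x ^ k * y * x = x ^ (k + 1) * y := by
      rw [mul_assoc, ← h.eq, ← mul_assoc, ← pow_succ]
    have h2 : x ^ k * y * y = 0 := by rw [mul_assoc, hy, mul_zero]
    rw [pow_succ, ih, add_mul, mul_add, mul_add, smul_mul_assoc, smul_mul_assoc, h1, h2,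
      smul_zero, add_zero, ← pow_succ, add_assoc, add_comm (x ^ (k + 1) * y), ← succ_nsmul]

lemma mul_add_pow_of_mul_eq_zero {q y z : A} (h : Commute y z) (hq : q * y = 0) (k : ℕ) :
    q * (y + z) ^ k = q * z ^ k := by
  induction k with
  | zero => simp
  | succ k ih =>
    have h1 : q * z ^ k * y = 0 := by
      rw [mul_assoc, ← (h.pow_right k).eq, ← mul_assoc, hq, zero_mul]
    rw [pow_succ, ← mul_assoc, ih, mul_add, h1, zero_add, mul_assoc, ← pow_succ]

variable {ι : Type*} {a : ι → A}

/-- Pigeonhole: a product of more commuting factors than there are generators repeats one of them.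
-/
lemma sum_pow_eq_zero_of_card_lt (hc : ∀ i j, Commute (a i) (a j)) (h2 : ∀ i, a i * a i = 0)
    (s : Finset ι) {k : ℕ} (hk : s.card < k) : (∑ i ∈ s, a i) ^ k = 0 := by
  classical
  induction s using Finset.induction_on generalizing k with
  | empty =>
    rw [Finset.sum_empty, zero_pow (by simpa using hk.ne')]
  | insert i s hi ih =>
    rw [Finset.card_insert_of_notMem hi] at hk
    obtain ⟨l, rfl⟩ : ∃ l, k = l + 1 := ⟨k - 1, by omega⟩
    rw [Finset.sum_insert hi, add_comm, add_pow_succ_of_mul_self_eq_zero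
      (Commute.sum_left _ _ _ fun j _ => hc j i) (h2 i), ih (by omega), ih (by omega)]
    simp

/-- Next to `q` the generators in `t` may be dropped, leaving fewer than `k` of them. -/
lemma mul_sum_pow_eq_zero (hc : ∀ i j, Commute (a i) (a j)) (h2 : ∀ i, a i * a i = 0)
    (s t : Finset ι) (hts : t ⊆ s) {q : A} (hq : ∀ i ∈ t, q * a i = 0) {k : ℕ}
    (hk : s.card < k + t.card) : q * (∑ i ∈ s, a i) ^ k = 0 := by
  classical
  rw [← Finset.sum_sdiff hts, add_comm, mul_add_pow_of_mul_eq_zero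
    (Commute.sum_left _ _ _ fun i _ => Commute.sum_right _ _ _ fun j _ => hc i j)
    (by rw [Finset.mul_sum]; exact Finset.sum_eq_zero hq),
    sum_pow_eq_zero_of_card_lt hc h2 _ (by
      have := Finset.card_sdiff_add_card_eq_card hts
      omega), mul_zero]

lemma succ_nsmul_mul_sum_pow (hc : ∀ i j, Commute (a i) (a j)) (h2 : ∀ i, a i * a i = 0)
    (s : Finset ι) {i : ι} (hi : i ∈ s) {k : ℕ} (hk : s.card = k + 1) :
    (k + 1) • (a i * (∑ j ∈ s, a j) ^ k) = (∑ j ∈ s, a j) ^ (k + 1) := by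
  classical
  have hcomm : Commute (∑ j ∈ s.erase i, a j) (a i) := Commute.sum_left _ _ _ fun j _ => hc j i
  rw [← Finset.add_sum_erase s a hi, mul_add_pow_of_mul_eq_zero hcomm.symm (h2 i),
    add_comm (a i), add_pow_succ_of_mul_self_eq_zero hcomm (h2 i),
    sum_pow_eq_zero_of_card_lt hc h2 _ (k := k + 1)
      (by rw [Finset.card_erase_of_mem hi]; omega), zero_add, (hcomm.pow_left k).eq]

lemma sum_pow_eq_factorial_nsmul_prod {p : ℕ} {a : Fin p → A} (hc : ∀ i j, Commute (a i) (a j))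
    (h2 : ∀ i, a i * a i = 0) : (∑ i, a i) ^ p = p.factorial • (List.ofFn a).prod := by
  induction p with
  | zero => simp
  | succ p ih =>
    have hcomm : Commute (∑ i : Fin p, a i.succ) (a 0) :=
      Commute.sum_left _ _ _ fun j _ => hc _ _
    rw [Fin.sum_univ_succ, add_comm, add_pow_succ_of_mul_self_eq_zero hcomm (h2 0),
      sum_pow_eq_zero_of_card_lt (a := fun i : Fin p => a i.succ) (fun i j => hc _ _)
        (fun i => h2 _) _ (by simp), zero_add, (hcomm.pow_left p).eq,
      ih (a := fun i : Fin p => a i.succ) (fun i j => hc _ _) (fun i => h2 _), List.ofFn_succ,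
      List.prod_cons, mul_smul_comm, smul_smul, Nat.factorial_succ]

lemma add_pow_eq_choose_nsmul {x y : A} (h : Commute x y) {p k : ℕ} (hx : x ^ (p + 1) = 0)
    (hy : y ^ (k + 1) = 0) : (x + y) ^ (p + k) = (p + k).choose p • (x ^ p * y ^ k) := by
  rw [h.add_pow, Finset.sum_eq_single p]
  · rw [Nat.add_sub_cancel_left, nsmul_eq_mul, Nat.cast_comm]
  · intro i hi hip
    rw [Finset.mem_range] at hi
    rcases lt_or_gt_of_ne hip with h' | h'
    · rw [pow_eq_zero_of_le (show k + 1 ≤ p + k - i by omega) hy, mul_zero, zero_mul]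
    · rw [pow_eq_zero_of_le (show p + 1 ≤ i by omega) hx, zero_mul, zero_mul]
  · intro h'
    exact absurd (Finset.mem_range.mpr (by omega)) h'

end SquareZero

/-! ### The algebra of the forms `v ∧ w^#` -/

section Pair

variable {n : ℕ}

/-- The `(1,1)`-form `v ∧ w^#`, as a bilinear function. -/
noncomputable def pair : E n →ₗ[ℝ] E n →ₗ[ℝ] SuperAlg n :=
  LinearMap.mk₂ ℝ (fun v w => form v * formSharp w)
    (fun v v' w => by
      simp only [form]
      rw [← add_mul, ← map_add, Prod.mk_add_mk, add_zero])
    (fun c v w => by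
      simp only [form]
      rw [← smul_mul_assoc, ← map_smul, Prod.smul_mk, smul_zero])
    (fun v w w' => by
      simp only [formSharp]
      rw [← mul_add, ← map_add, Prod.mk_add_mk, add_zero])
    (fun c v w => by
      simp only [formSharp]
      rw [← mul_smul_comm, ← map_smul, Prod.smul_mk, smul_zero])

lemma pair_apply (v w : E n) : pair v w = form v * formSharp w := rfl

lemma commute_ι_mul_ι (x y z : E n × E n) :
    Commute (ExteriorAlgebra.ι ℝ x * ExteriorAlgebra.ι ℝ y) (ExteriorAlgebra.ι ℝ z) := by
  have h : ∀ x y : E n × E n, ExteriorAlgebra.ι ℝ x * ExteriorAlgebra.ι ℝ y =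
      -(ExteriorAlgebra.ι ℝ y * ExteriorAlgebra.ι ℝ x) := fun x y =>
    eq_neg_of_add_eq_zero_left (ExteriorAlgebra.ι_add_mul_swap x y)
  rw [Commute, SemiconjBy, mul_assoc, h y z, mul_neg, ← mul_assoc, h x z, neg_mul, neg_neg,
    mul_assoc]

lemma commute_pair_form (v w u : E n) : Commute (pair v w) (form u) := commute_ι_mul_ι _ _ _

lemma commute_pair_formSharp (v w u : E n) : Commute (pair v w) (formSharp u) :=
  commute_ι_mul_ι _ _ _

lemma commute_pair (v w v' w' : E n) : Commute (pair v w) (pair v' w') :=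
  (commute_pair_form v w v').mul_right (commute_pair_formSharp v w w')

lemma pair_mul_pair_left (v w w' : E n) : pair v w * pair v w' = 0 := by
  rw [pair_apply v w', ← mul_assoc, (commute_pair_form v w v).eq, pair_apply, ← mul_assoc, form,
    ExteriorAlgebra.ι_sq_zero, zero_mul, zero_mul]

lemma pair_mul_pair_right (v v' w : E n) : pair v w * pair v' w = 0 := by
  rw [pair_apply v' w, ← mul_assoc, (commute_pair_form v w v').eq, pair_apply, mul_assoc,
    mul_assoc, formSharp, ExteriorAlgebra.ι_sq_zero, mul_zero, mul_zero]

lemma prod_form_mul_formSharp {p : ℕ} (v : Fin p → E n) (w : E n) :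
    (List.ofFn fun j => form (v j)).prod * formSharp w =
      (-1 : ℝ) ^ p • (formSharp w * (List.ofFn fun j => form (v j)).prod) := by
  induction p with
  | zero => simp
  | succ p ih =>
    have h : form (v 0) * formSharp w = -(formSharp w * form (v 0)) :=
      eq_neg_of_add_eq_zero_left (ExteriorAlgebra.ι_add_mul_swap _ _)
    rw [List.ofFn_succ, List.prod_cons, mul_assoc, ih, mul_smul_comm, ← mul_assoc, h, neg_mul,
      pow_succ, mul_neg_one, neg_smul, smul_neg, mul_assoc]

/-- The sign `c_p` is what interleaving costs: moving each `v_j^#` back next to `v_j` past the later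
forms takes `p(p-1)/2` transpositions in all. -/
lemma prod_form_mul_prod_formSharp {p : ℕ} (v : Fin p → E n) :
    (-1 : ℝ) ^ (p * (p - 1) / 2) • ((List.ofFn fun j => form (v j)).prod *
      (List.ofFn fun j => formSharp (v j)).prod) =
    (List.ofFn fun j => pair (v j) (v j)).prod := by
  induction p with
  | zero => simp
  | succ p ih =>
    rw [List.ofFn_succ, List.ofFn_succ, List.ofFn_succ, List.prod_cons, List.prod_cons,
      List.prod_cons, ← ih, Nat.triangle_succ, pair_apply, mul_assoc (form (v 0)),
      ← mul_assoc _ (formSharp (v 0)), prod_form_mul_formSharp, smul_mul_assoc, mul_smul_comm,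
      mul_smul_comm, smul_smul, pow_add, mul_assoc, ← pow_add, ← two_mul, pow_mul]
    simp [mul_assoc]

/-- As a power of `∑ n_j ∧ n_j^#` the normal form visibly depends only on the normal space, and the
calculus of square-zero elements applies. -/
lemma normalSuperform_eq (m : ℕ) (M : Set (E n)) (x : E n) :
    normalSuperform m M x = ((n - m).factorial : ℝ)⁻¹ •
      (∑ j, pair (conormal m M x j) (conormal m M x j)) ^ (n - m) := by
  rw [normalSuperform, prod_form_mul_prod_formSharp,
    sum_pow_eq_factorial_nsmul_prod (fun i j => commute_pair _ _ _ _)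
      (fun i => pair_mul_pair_left _ _ _), ← Nat.cast_smul_eq_nsmul ℝ, smul_smul,
    inv_mul_cancel₀ (by positivity), one_smul]

lemma beta_eq_sum {ι : Type*} [Fintype ι] (b : OrthonormalBasis ι ℝ (E n)) :
    beta n = ∑ i, pair (b i) (b i) := by
  have h := sum_bilin_eq_of_span_eq (EuclideanSpace.basisFun (Fin n) ℝ).orthonormal b.orthonormal
    (by rw [← OrthonormalBasis.coe_toBasis, ← OrthonormalBasis.coe_toBasis, Module.Basis.span_eq,
      Module.Basis.span_eq]) pair
  rw [← h, beta]
  simp [pair_apply, dx, dxi]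

end Pair

end Superform

/-! ### Contraction of the normal form with powers of `β` -/

namespace Superform

section NormalForm

variable {n p : ℕ} {N : Fin p → E n}

/-- The form `∑ nⱼ ∧ nⱼ^#` of a family of covectors. -/
noncomputable def frameForm (N : Fin p → E n) : SuperAlg n := ∑ j, pair (N j) (N j)

lemma commute_pair_frameForm (v w : E n) : Commute (pair v w) (frameForm N) :=
  Commute.sum_right _ _ _ fun _ _ => commute_pair _ _ _ _

lemma frameForm_pow_succ : frameForm N ^ (p + 1) = 0 :=
  sum_pow_eq_zero_of_card_lt (fun _ _ => commute_pair _ _ _ _) (fun _ => pair_mul_pair_left _ _ _)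
    _ (by simp)

lemma pair_mul_frameForm_pow_left (j : Fin p) (w : E n) : pair (N j) w * frameForm N ^ p = 0 :=
  mul_sum_pow_eq_zero (fun _ _ => commute_pair _ _ _ _) (fun _ => pair_mul_pair_left _ _ _)
    _ {j} (Finset.subset_univ _)
    (fun i hi => by rw [Finset.mem_singleton.mp hi]; exact pair_mul_pair_left _ _ _) (by simp)

lemma pair_mul_frameForm_pow_right (v : E n) (j : Fin p) : pair v (N j) * frameForm N ^ p = 0 :=
  mul_sum_pow_eq_zero (fun _ _ => commute_pair _ _ _ _) (fun _ => pair_mul_pair_left _ _ _)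
    _ {j} (Finset.subset_univ _)
    (fun i hi => by rw [Finset.mem_singleton.mp hi]; exact pair_mul_pair_right _ _ _) (by simp)

variable {d : ℕ} {b : OrthonormalBasis (Fin d ⊕ Fin p) ℝ (E n)}

lemma beta_eq_add_frameForm (hb : ∀ j, b (Sum.inr j) = N j) :
    beta n = frameForm N + frameForm fun i => b (Sum.inl i) := by
  rw [beta_eq_sum b, Fintype.sum_sum_type, add_comm]
  simp only [hb, frameForm]

lemma commute_frameForm {q : ℕ} {N' : Fin q → E n} : Commute (frameForm N) (frameForm N') :=
  Commute.sum_left _ _ _ fun _ _ => commute_pair_frameForm _ _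

/-- In `β = ν + τ` the normal part `ν` is annihilated by `ν ^ p`, so only the tangential part
remains. -/
lemma frameForm_pow_mul_beta_pow (hb : ∀ j, b (Sum.inr j) = N j) (k : ℕ) :
    frameForm N ^ p * beta n ^ k =
      frameForm N ^ p * (frameForm fun i => b (Sum.inl i)) ^ k := by
  rw [beta_eq_add_frameForm hb, mul_add_pow_of_mul_eq_zero commute_frameForm]
  rw [← pow_succ, frameForm_pow_succ]

/-- In the binomial expansion of `(ν + τ) ^ n` only `ν ^ p τ ^ d` survives, and its coefficient is
absorbed by the factorials. This is why the volume form has the constant form part `β_n`. -/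
lemma factorial_smul_frameForm_pow_mul_betaPow (hb : ∀ j, b (Sum.inr j) = N j) (hd : d + p = n) :
    ((p.factorial : ℝ)⁻¹ • frameForm N ^ p) * betaPow n d = betaPow n n := by
  have h1 : beta n ^ n = (p + d).choose p • (frameForm N ^ p * beta n ^ d) := by
    rw [frameForm_pow_mul_beta_pow hb, ← add_pow_eq_choose_nsmul commute_frameForm
      frameForm_pow_succ frameForm_pow_succ, ← beta_eq_add_frameForm hb]
    congr 1
    omega
  rw [betaPow, betaPow, h1, smul_mul_smul_comm, ← Nat.cast_smul_eq_nsmul ℝ, smul_smul]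
  congr 1
  have h2 : (((p + d).choose p * p.factorial * d.factorial : ℕ) : ℝ) = ((p + d).factorial : ℕ) := by
    rw [Nat.choose_symm_add, mul_assoc, mul_comm p.factorial, ← mul_assoc]
    have := Nat.add_choose_mul_factorial_mul_factorial p d
    exact_mod_cast (by linarith)
  have h3 : p + d = n := by omega
  rw [h3] at h2 ⊢
  push_cast at h2
  have := Nat.factorial_ne_zero p
  have := Nat.factorial_ne_zero d
  have := Nat.factorial_ne_zero n
  field_simp
  linarith

/-- Expand `u` in the adapted basis. Normal components are killed by `ν ^ p`. For a tangential `e_j`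
with `j ≠ i`, the factor `e_i ∧ e_j^#` kills two of the `k + 1` generators, too few remaining for a
`k`-th power. The component along `e_i` completes `τ ^ k` to `τ ^ (k + 1)`, up to the factor `k +
1`. -/
lemma pair_mul_frameForm_pow_mul_beta_pow (hb : ∀ j, b (Sum.inr j) = N j) {k : ℕ} (hk : d = k + 1)
    (i : Fin d) (u : E n) :
    (k + 1) • (pair (b (Sum.inl i)) u * (frameForm N ^ p * beta n ^ k)) =
      ⟪b (Sum.inl i), u⟫ • (frameForm N ^ p * beta n ^ (k + 1)) := by
  have hc : ∀ v w : E n, ∀ y : SuperAlg n, pair v w * (frameForm N ^ p * y) =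
      frameForm N ^ p * (pair v w * y) := fun v w y => by
    rw [← mul_assoc, ((commute_pair_frameForm v w).pow_right p).eq, mul_assoc]
  have hτ : (frameForm fun i => b (Sum.inl i)) =
      ∑ i, pair (b (Sum.inl i)) (b (Sum.inl i)) := rfl
  have hterm : ∀ j, (k + 1) • (pair (b (Sum.inl i)) (b j) * (frameForm N ^ p * beta n ^ k)) =
      if j = Sum.inl i then frameForm N ^ p * beta n ^ (k + 1) else 0 := by
    rintro (j | j)
    · rw [frameForm_pow_mul_beta_pow hb, frameForm_pow_mul_beta_pow hb, hc, ← mul_smul_comm]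
      split_ifs with h
      · rw [Sum.inl.inj h, hτ, succ_nsmul_mul_sum_pow (a := fun i => pair (b (Sum.inl i)) (b (Sum.inl i)))
          (fun _ _ => commute_pair _ _ _ _) (fun _ => pair_mul_pair_left _ _ _) _
          (Finset.mem_univ i) (by simpa using hk)]
      · have hij : i ≠ j := fun h' => h (by rw [h'])
        rw [hτ, mul_sum_pow_eq_zero
          (a := fun i => pair (b (Sum.inl i)) (b (Sum.inl i)))
          (fun _ _ => commute_pair _ _ _ _) (fun _ => pair_mul_pair_left _ _ _) _ {i, j}
          (Finset.subset_univ _) ?_ ?_, smul_zero, mul_zero]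
        · intro l hl
          rcases Finset.mem_insert.mp hl with rfl | hl
          · exact pair_mul_pair_left _ _ _
          · rw [Finset.mem_singleton.mp hl]
            exact pair_mul_pair_right _ _ _
        · rw [Finset.card_pair hij, Finset.card_univ, Fintype.card_fin]
          omega
    · rw [if_neg (by simp), hb, ← mul_assoc, pair_mul_frameForm_pow_right, zero_mul, smul_zero]
  conv_lhs => rw [← b.sum_repr' u]
  rw [map_sum, Finset.sum_mul, Finset.smul_sum]
  simp_rw [map_smul, smul_mul_assoc, smul_comm (k + 1), hterm]
  simp

/-- The wedge product of `∑ₖ eₖ ∧ (L eₖ)^#` with the normal form and a power of `β` is given by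
the tangential trace of `L`. -/
lemma sum_pair_mul_eq_tanTrace (hN : Orthonormal ℝ N) {k : ℕ} (hk : k + 1 + p = n)
    (L : E n →L[ℝ] E n) :
    (∑ i, pair (EuclideanSpace.single i (1 : ℝ)) (L (EuclideanSpace.single i 1))) *
      (((p.factorial : ℝ)⁻¹ • frameForm N ^ p) * betaPow n k) = tanTrace N L • betaPow n n := by
  obtain ⟨b, hb1, hb⟩ := exists_adapted_basis hN
  have hd : Module.finrank ℝ (Submodule.span ℝ (range N))ᗮ = k + 1 := by
    have h1 := Module.finrank_eq_card_basis b.toBasis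
    rw [finrank_euclideanSpace_fin, Fintype.card_sum, Fintype.card_fin, Fintype.card_fin] at h1
    omega
  have hsum : ∑ i, pair (EuclideanSpace.single i (1 : ℝ)) (L (EuclideanSpace.single i 1)) =
      ∑ i, pair (b i) (L (b i)) := by
    have h := sum_bilin_eq_of_span_eq (EuclideanSpace.basisFun (Fin n) ℝ).orthonormal b.orthonormal
      (by rw [← OrthonormalBasis.coe_toBasis, ← OrthonormalBasis.coe_toBasis,
        Module.Basis.span_eq, Module.Basis.span_eq]) (pair.compl₂ (L : E n →ₗ[ℝ] E n))
    simpa using h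
  have hmain := factorial_smul_frameForm_pow_mul_betaPow hb (by omega)
  rw [betaPow, hd, smul_mul_smul_comm] at hmain
  rw [hsum, Fintype.sum_sum_type, add_mul, Finset.sum_mul, Finset.sum_mul, betaPow,
    smul_mul_smul_comm, tanTrace_eq_sum hN, Finset.sum_smul]
  rw [Finset.sum_eq_zero (s := (Finset.univ : Finset (Fin p))), add_zero]
  · refine Finset.sum_congr rfl fun i _ => ?_
    have h := pair_mul_frameForm_pow_mul_beta_pow hb hd i (L (b (Sum.inl i)))
    rw [mul_smul_comm, ← hmain, ← hb1, real_inner_comm, smul_comm, ← h, ← Nat.cast_smul_eq_nsmul ℝ,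
      smul_smul, Nat.factorial_succ]
    congr 1
    push_cast
    have := Nat.factorial_ne_zero k
    field_simp
  · intro j _
    rw [hb, mul_smul_comm, ← mul_assoc, pair_mul_frameForm_pow_left, zero_mul, smul_zero]

end NormalForm

end Superform

namespace Superform

/-! ### The currents in the evolution equation -/

section Currents

variable {n m : ℕ} {M : Set (E n)}

instance (n : ℕ) : ContinuousMul (SuperAlg n) := by
  refine ⟨?_⟩
  have h : (fun q : SuperAlg n × SuperAlg n => q.1 * q.2) = fun q =>
      ∑ i, (superBasis n).coord i q.1 • LinearMap.mulLeft ℝ (superBasis n i) q.2 := by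
    funext q
    conv_lhs => rw [← (superBasis n).sum_repr q.1]
    rw [Finset.sum_mul]
    simp
  rw [h]
  refine continuous_finsetSum _ fun i _ => ?_
  have h1 : Continuous fun q : SuperAlg n × SuperAlg n => (superBasis n).coord i q.1 :=
    ((superBasis n).coord i).continuous_of_finiteDimensional.comp continuous_fst
  have h2 : Continuous fun q : SuperAlg n × SuperAlg n =>
      LinearMap.mulLeft ℝ (superBasis n i) q.2 :=
    (LinearMap.mulLeft ℝ (superBasis n i)).continuous_of_finiteDimensional.comp continuous_snd
  exact h1.smul h2

lemma continuous_pair : Continuous fun q : E n × E n => pair q.1 q.2 := by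
  have h1 : Continuous fun v : E n => form v :=
    ((ExteriorAlgebra.ι ℝ).comp (LinearMap.inl ℝ (E n) (E n))).continuous_of_finiteDimensional
  have h2 : Continuous fun v : E n => formSharp v :=
    ((ExteriorAlgebra.ι ℝ).comp (LinearMap.inr ℝ (E n) (E n))).continuous_of_finiteDimensional
  exact (h1.comp continuous_fst).mul (h2.comp continuous_snd)

lemma IsClosedSubmanifold.continuousOn_normalSuperform (hM : IsClosedSubmanifold m M) :
    ContinuousOn (normalSuperform m M) M := by
  have h : ContinuousOn (fun x => frameForm (conormal m M x)) M := by
    intro x hx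
    obtain ⟨U, hxU, hU⟩ := hM.exists_isNormalFrame hx
    set N : Fin (n - m) → E n → E n := fun j => ∇ (definingFun (n - m) M x j) with hN
    have h1 : ContinuousWithinAt (fun y => frameForm fun j => N j y) M x := by
      have hNx : ∀ j, ContinuousAt (N j) x := fun j =>
        ((hU.contDiffOn j).contDiffAt (hU.isOpen.mem_nhds hxU)).continuousAt
      have : ContinuousAt (fun y => ∑ j, pair (N j y) (N j y)) x :=
        tendsto_finsetSum _ fun j _ =>
          ContinuousAt.comp (f := fun y => (N j y, N j y)) (g := fun q : E n × E n => pair q.1 q.2)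
            continuous_pair.continuousAt ((hNx j).prodMk (hNx j))
      exact this.continuousWithinAt
    have heq : ∀ y ∈ M ∩ U, frameForm (conormal m M y) = frameForm fun j => N j y :=
      fun y hy => (sum_bilin_eq_of_span_eq (hU.orthonormal y hy) (hM.orthonormal_conormal hy.1)
        (hU.span_eq y hy) pair).symm
    refine h1.congr_of_eventuallyEq ?_ (heq x ⟨hx, hxU⟩)
    filter_upwards [self_mem_nhdsWithin, mem_nhdsWithin_of_mem_nhds (hU.isOpen.mem_nhds hxU)]
      with y hyM hyU
    exact heq y ⟨hyM, hyU⟩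
  exact ((h.pow (n - m)).const_smul ((n - m).factorial : ℝ)⁻¹).congr fun x _ =>
    normalSuperform_eq m M x

lemma IsClosedSubmanifold.normalSuperform_mul_betaPow (hM : IsClosedSubmanifold m M) {x : E n}
    (hx : x ∈ M) : normalSuperform m M x * betaPow n m = betaPow n n := by
  obtain ⟨b, -, hb⟩ := exists_adapted_basis (hM.orthonormal_conormal hx)
  have hd := Module.finrank_eq_card_basis b.toBasis
  rw [finrank_euclideanSpace_fin, Fintype.card_sum, Fintype.card_fin, Fintype.card_fin] at hd
  have hd' : Module.finrank ℝ (Submodule.span ℝ (range (conormal m M x)))ᗮ = m := by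
    have := hM.dim_le
    omega
  have h := factorial_smul_frameForm_pow_mul_betaPow hb hd.symm
  rw [hd'] at h
  rw [normalSuperform_eq]
  exact h

lemma IsClosedSubmanifold.sum_dx_mul_dxi_mul (hM : IsClosedSubmanifold m M) (hm : 1 ≤ m) {x : E n}
    (hx : x ∈ M) (L : E n →L[ℝ] E n) :
    ∑ k, ∑ l, ⟪EuclideanSpace.single l (1 : ℝ), L (EuclideanSpace.single k 1)⟫ •
      (dx k * (dxi l * (normalSuperform m M x * betaPow n (m - 1)))) =
    tanTrace (conormal m M x) L • betaPow n n := by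
  have h := sum_pair_mul_eq_tanTrace (hM.orthonormal_conormal hx) (k := m - 1)
    (by have := hM.dim_le; omega) L
  rw [normalSuperform_eq, ← frameForm, ← h]
  generalize ((n - m).factorial : ℝ)⁻¹ • frameForm (conormal m M x) ^ (n - m) *
    betaPow n (m - 1) = Y
  rw [Finset.sum_mul]
  refine Finset.sum_congr rfl fun k _ => ?_
  conv_rhs => rw [← (EuclideanSpace.basisFun (Fin n) ℝ).sum_repr' (L (EuclideanSpace.single k 1))]
  rw [map_sum, Finset.sum_mul]
  refine Finset.sum_congr rfl fun l _ => ?_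
  rw [map_smul, smul_mul_assoc, pair_apply, EuclideanSpace.basisFun_apply, ← mul_assoc, dx, dxi]

lemma IsClosedSubmanifold.surfaceCurrent_apply (hM : IsClosedSubmanifold m M)
    {φ : E n → SuperAlg n} (hφ : ContinuousOn φ M) (ρ : 𝓓((⊤ : Opens (E n)), ℝ)) :
    surfaceCurrent m M φ ρ = ∫ x in M, ρ x • φ x ∂μHE[m] :=
  TestFunction.integralAgainstBilinCLM_eq_integral
    ((hM.locallyIntegrable hφ).locallyIntegrableOn _)

lemma IsClosedSubmanifold.integrable_smul (hM : IsClosedSubmanifold m M)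
    {φ : E n → SuperAlg n} (hφ : ContinuousOn φ M) (ρ : 𝓓((⊤ : Opens (E n)), ℝ)) :
    Integrable (fun x => ρ x • φ x) (μHE[m].restrict M) :=
  hM.integrable (ρ.continuous.continuousOn.smul hφ) ρ.hasCompactSupport.smul_right

/-- The pairing of `φ N ∧ β_m *dS_M` with a test function, `φ` being a scalar function. -/
lemma IsClosedSubmanifold.surfaceCurrent_smul_wedge_apply (hM : IsClosedSubmanifold m M)
    {f : E n → ℝ} (hf : ContinuousOn f M) (ρ : 𝓓((⊤ : Opens (E n)), ℝ)) :
    (surfaceCurrent m M fun x => f x • normalSuperform m M x).wedge (betaPow n m) ρ =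
      (∫ x in M, f x * ρ x ∂μHE[m]) • betaPow n n := by
  have hc : ContinuousOn (fun x => f x • normalSuperform m M x) M :=
    hf.smul hM.continuousOn_normalSuperform
  rw [Supercurrent.wedge, Distribution.mapCLM_apply, hM.surfaceCurrent_apply hc,
    ← ContinuousLinearMap.integral_comp_comm _ (hM.integrable_smul hc ρ), ← integral_smul_const]
  refine setIntegral_congr_fun hM.isClosed.measurableSet fun x hx => ?_
  change (ρ x • f x • normalSuperform m M x) * betaPow n m = _
  rw [smul_smul, smul_mul_assoc, hM.normalSuperform_mul_betaPow hx, mul_comm (ρ x)]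

lemma IsClosedSubmanifold.volumeForm_apply (hM : IsClosedSubmanifold m M)
    (ρ : 𝓓((⊤ : Opens (E n)), ℝ)) :
    volumeForm m M ρ = (∫ x in M, ρ x ∂μHE[m]) • betaPow n n := by
  have h := hM.surfaceCurrent_smul_wedge_apply (continuousOn_const (c := (1 : ℝ))) ρ
  simp only [one_smul, one_mul] at h
  exact h

lemma lineDeriv_lineDeriv_apply (ρ : 𝓓((⊤ : Opens (E n)), ℝ)) (u v x : E n) :
    (∂_{v} (∂_{u} ρ)) x = ⟪v, fderiv ℝ (∇ (ρ : E n → ℝ)) x u⟫ := by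
  have hρ : ContDiff ℝ ∞ (ρ : E n → ℝ) := ρ.contDiff
  have hdρ : Differentiable ℝ (fderiv ℝ (ρ : E n → ℝ)) :=
    (hρ.fderiv_right (m := ∞) (by simp)).differentiable (by simp)
  have h1 : ∀ (σ : 𝓓((⊤ : Opens (E n)), ℝ)) (w y : E n), (∂_{w} σ) y = fderiv ℝ σ y w := by
    intro σ w y
    have hσ : ContDiff ℝ ∞ (σ : E n → ℝ) := σ.contDiff
    rw [TestFunction.lineDerivOp_eq_lineDerivCLM ℝ, TestFunction.lineDerivCLM_apply_of_le (by simp)]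
    exact (hσ.differentiable (by simp) y).lineDeriv_eq_fderiv
  have h2 : ((∂_{u} ρ : 𝓓((⊤ : Opens (E n)), ℝ)) : E n → ℝ) = fun y => fderiv ℝ ρ y u :=
    funext fun y => h1 ρ u y
  have h3 : fderiv ℝ (fun y => fderiv ℝ ρ y u) x v = fderiv ℝ (fderiv ℝ ρ) x v u := by
    have := (hdρ x).hasFDerivAt.clm_apply (hasFDerivAt_const u x)
    rw [this.fderiv]
    simp
  have h4 : fderiv ℝ (∇ (ρ : E n → ℝ)) x u =
      (InnerProductSpace.toDual ℝ (E n)).symm (fderiv ℝ (fderiv ℝ ρ) x u) := by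
    have := (InnerProductSpace.toDual ℝ (E n)).symm.toContinuousLinearEquiv.hasFDerivAt.comp x
      (hdρ x).hasFDerivAt
    rw [show ∇ (ρ : E n → ℝ) = (InnerProductSpace.toDual ℝ (E n)).symm.toContinuousLinearEquiv ∘
      fderiv ℝ ρ from rfl, this.fderiv]
    rfl
  -- Symmetry of the Hessian exchanges the two directions.
  have h5 : fderiv ℝ (fderiv ℝ ρ) x v u = fderiv ℝ (fderiv ℝ ρ) x u v :=
    (hρ.contDiffAt.isSymmSndFDerivAt (by simpa using ENat.LEInfty.out)) v u
  rw [h1, h2, h3, h4, real_inner_comm, InnerProductSpace.toDual_symm_apply, h5]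

lemma Supercurrent.d_apply (T : Supercurrent n) (ρ : 𝓓((⊤ : Opens (E n)), ℝ)) :
    T.d ρ = -∑ k, dx k * T (∂_{EuclideanSpace.single k (1 : ℝ)} ρ) := by
  rw [Supercurrent.d, ← Finset.sum_neg_distrib]
  simp [Supercurrent.wedgeLeft]

lemma Supercurrent.dSharp_apply (T : Supercurrent n) (ρ : 𝓓((⊤ : Opens (E n)), ℝ)) :
    T.dSharp ρ = -∑ k, dxi k * T (∂_{EuclideanSpace.single k (1 : ℝ)} ρ) := by
  rw [Supercurrent.dSharp, ← Finset.sum_neg_distrib]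
  simp [Supercurrent.wedgeLeft]

/-- The pairing of `d d^# S`, where `S = [M]_s ∧ β_{m-1}`, with a test function. -/
lemma IsClosedSubmanifold.d_dSharp_superCurrent_wedge_apply (hM : IsClosedSubmanifold m M)
    (hm : 1 ≤ m) (ρ : 𝓓((⊤ : Opens (E n)), ℝ)) :
    ((superCurrent m M).wedge (betaPow n (m - 1))).dSharp.d ρ =
      (∫ x in M, tanTrace (conormal m M x) (fderiv ℝ (∇ (ρ : E n → ℝ)) x) ∂μHE[m]) •
        betaPow n n := by
  have hc := hM.continuousOn_normalSuperform
  set e : Fin n → E n := fun k => EuclideanSpace.single k (1 : ℝ) with he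
  have hterm : ∀ k l, dx k * (dxi l * (superCurrent m M).wedge (betaPow n (m - 1))
      (∂_{e l} (∂_{e k} ρ))) = ∫ x in M, (∂_{e l} (∂_{e k} ρ)) x •
        (dx k * (dxi l * (normalSuperform m M x * betaPow n (m - 1)))) ∂μHE[m] := by
    intro k l
    set A : SuperAlg n →L[ℝ] SuperAlg n := LinearMap.toContinuousLinearMap
      (LinearMap.mulLeft ℝ (dx k) ∘ₗ LinearMap.mulLeft ℝ (dxi l) ∘ₗ
        LinearMap.mulRight ℝ (betaPow n (m - 1))) with hA
    have hAy : ∀ y, A y = dx k * (dxi l * (y * betaPow n (m - 1))) := fun y => rfl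
    have h := ContinuousLinearMap.integral_comp_comm A
      (hM.integrable_smul hc (∂_{e l} (∂_{e k} ρ)))
    rw [← hM.surfaceCurrent_apply hc, hAy] at h
    rw [Supercurrent.wedge, Distribution.mapCLM_apply]
    refine h.symm.trans ?_
    simp only [hAy, smul_mul_assoc, mul_smul_comm]
  have hint : ∀ k l, Integrable (fun x => (∂_{e l} (∂_{e k} ρ)) x •
      (dx k * (dxi l * (normalSuperform m M x * betaPow n (m - 1))))) (μHE[m].restrict M) :=
    fun k l => hM.integrable_smul (continuousOn_const.mul (continuousOn_const.mul
      (hc.mul continuousOn_const))) _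
  rw [Supercurrent.d_apply, Finset.sum_congr rfl fun k _ => by rw [Supercurrent.dSharp_apply]]
  -- Each of `d` and `d^#` contributes a sign from integration by parts; the two cancel.
  simp only [mul_neg, Finset.sum_neg_distrib, neg_neg, Finset.mul_sum]
  rw [Finset.sum_congr rfl fun k _ => Finset.sum_congr rfl fun l _ => hterm k l,
    ← integral_smul_const, Finset.sum_congr rfl fun k _ =>
      (integral_finsetSum _ fun l _ => hint k l).symm,
    ← integral_finsetSum _ fun k _ => integrable_finsetSum _ fun l _ => hint k l]
  refine setIntegral_congr_fun hM.isClosed.measurableSet fun x hx => ?_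
  rw [← hM.sum_dx_mul_dxi_mul hm hx]
  simp only [lineDeriv_lineDeriv_apply, he]

end Currents

end Superform

theorem mainTheorem6 (n m : ℕ) (hm : 1 ≤ m) (I : Set ℝ) (hI : I.OrdConnected)
    (hI' : I.Nontrivial) (h0 : (0 : ℝ) ∈ I) (M : ℝ → Set (EuclideanSpace ℝ (Fin n)))
    (hM : ∀ t ∈ I, IsClosedSubmanifold m (M t)) (hflow : MovesByMeanCurvature m I M)
    (S : Supercurrent n) (hS : S = (superCurrent m (M 0)).wedge (betaPow n (m - 1)))
    (ρ : 𝓓((⊤ : Opens (EuclideanSpace ℝ (Fin n))), ℝ)) :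
    HasDerivWithinAt (fun t => volumeForm m (M t) ρ)
      ((-sqMeanCurvatureVolumeForm m (M 0) - S.dSharp.d) ρ) I 0 := by
  subst hS
  have hM0 := hM 0 h0
  obtain ⟨X, F, hF, -, hXH⟩ := hflow.exists_isFlowOn hI hI' h0
  have hHc : ContinuousOn (fun y => ‖meanCurvature m (M 0) y‖ ^ 2) (M 0) :=
    ((contDiff_of_uncurry hF.contDiffOn h0).continuous.norm.pow 2).continuousOn.congr
      fun y hy => by simp only [Pi.pow_apply, hXH y hy, norm_neg]
  have hmain := (hasDerivWithinAt_setIntegral_of_movesByMeanCurvature hI hI' h0 hM hflow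
    ρ.contDiff ρ.hasCompactSupport).smul_const (betaPow n n)
  refine (hmain.congr (fun t ht => (hM t ht).volumeForm_apply ρ) (hM0.volumeForm_apply ρ)).congr_deriv
    ?_
  rw [sub_smul, neg_smul, ← hM0.surfaceCurrent_smul_wedge_apply hHc,
    ← hM0.d_dSharp_superCurrent_wedge_apply hm]
  rfl
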